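/- Let $\mathcal A$ be the mod $2$ Steenrod algebra and $\mathcal A(1)\subset\mathcal A$ the subalgebra generated by $Sq^1$ and $Sq^2$; put $Q_0=Sq^1$ and $Q_1=Sq^2Sq^1+Sq^1Sq^2$. All modules are $\mathbb Z$-graded left $\mathcal A(1)$-modules, $(\Sigma^kM)_n=M_{n-k}$, $\otimes=\otimes_{\mathbb F_2}$ with the action through the coproduct $Sq^n\mapsto\sum_{i+j=n}Sq^i\otimes Sq^j$, and $H(M,Q_i)=\mathrm{Ker}(Q_i)/\mathrm{Im}(Q_i)$. Write $M\simeq N$ for stable isomorphism, i.e. isomorphism in the category of modules and degree-preserving $\mathcal A(1)$-linear maps modulo the maps that factor through a projective module. A bounded-below module $M$ is called $Q_1$-local if $H(M,Q_0)=0$. Let $I=\mathrm{Ker}(\mathcal A(1)\to\mathbb F_2)$ be the augmentation ideal, let $I^{-1}=\mathrm{Cok}(\mathbb F_2\to\Sigma^{-6}\mathcal A(1))$ be the cokernel of the inclusion of the socle, and let $\Omega^nM=I^{\otimes n}\otimes M$ for $n\ge 0$ and $\Omega^{n}M=(I^{-1})^{\otimes(-n)}\otimes M$ for $n<0$. Let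 $P_0$ be the submodule of $\mathbb F_2[x,x^{-1}]$ ($|x|=1$, $Sq^kx^n=\binom nk x^{n+k}$) of elements of degrees $\ge -1$. For $n\in\mathbb Z$ let $P_n=(\Sigma^{-n}\Omega^nP_0)^{\mathrm{red}}$ be the reduced part of $\Sigma^{-n}\Omega^nP_0$: the module, unique up to isomorphism, that has no nonzero free direct summand and satisfies $\Sigma^{-n}\Omega^nP_0\cong F\oplus P_n$ for some free module $F$. (It exists.) Theorem. (1) If $M$ is a bounded-below $Q_1$-local $\mathcal A(1)$-module with $H(M,Q_1)\cong\Sigma^a\mathbb F_2$, $a \in \mathbb Z$, then $M\simeq\Sigma^{a-2b}P_b$ for some $b\in\mathbb Z$. (2) Let $\mathrm{Pic}^{(1)}(\mathcal A(1))$ be the collection of stable isomorphism classes of bounded-below $Q_1$-local modules $M$ for which there is a bounded-below $Q_1$-local module $N$ with $M\otimes N\simeq P_0$. The tensor product makes it an abelian group with identity element $[P_0]$, and $$\mathbb Z\oplus\mathbb Z/4\;\longrightarrow\;\mathrm{Pic}^{(1)}(\mathcal A(1)),\qquad (a,b)\longmapsto[\Sigma^{a-2b}P_b]$$ is a well-defined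 isomorphism of groups. -/

import Mathlib

/-! ### The mod 2 Steenrod algebra -/

/-- The relations of the mod 2 Steenrod algebra on the free algebra on `Sq^0, Sq^1, Sq^2, …`:
`Sq^0 = 1` and the Adem relations. -/
inductive AdemRel : FreeAlgebra (ZMod 2) ℕ → FreeAlgebra (ZMod 2) ℕ → Prop
  | one : AdemRel (FreeAlgebra.ι (ZMod 2) 0) 1
  | adem (a b : ℕ) (ha : 0 < a) (hab : a < 2 * b) :
      AdemRel (FreeAlgebra.ι (ZMod 2) a * FreeAlgebra.ι (ZMod 2) b)
        (∑ c ∈ Finset.range (a / 2 + 1), ((b - c - 1).choose (a - 2 * c) : ZMod 2) •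
          (FreeAlgebra.ι (ZMod 2) (a + b - c) * FreeAlgebra.ι (ZMod 2) c))

/-- The mod 2 Steenrod algebra. -/
def Steenrod : Type := RingQuot AdemRel

noncomputable instance : Ring Steenrod := inferInstanceAs (Ring (RingQuot AdemRel))

noncomputable instance : Algebra (ZMod 2) Steenrod :=
  inferInstanceAs (Algebra (ZMod 2) (RingQuot AdemRel))

namespace Steenrod

/-- The quotient map from the free algebra. -/
noncomputable def mk : FreeAlgebra (ZMod 2) ℕ →ₐ[ZMod 2] Steenrod :=
  RingQuot.mkAlgHom (ZMod 2) AdemRel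

theorem mk_rel {x y : FreeAlgebra (ZMod 2) ℕ} (h : AdemRel x y) : mk x = mk y :=
  RingQuot.mkAlgHom_rel (ZMod 2) h

/-- The Steenrod squares. -/
noncomputable def Sq (n : ℕ) : Steenrod :=
  mk (FreeAlgebra.ι (ZMod 2) n)

theorem Sq_zero : Sq 0 = 1 := by
  have h := mk_rel AdemRel.one
  simpa [Sq] using h

theorem Sq_mul_Sq (a b : ℕ) (ha : 0 < a) (hab : a < 2 * b) :
    Sq a * Sq b = ∑ c ∈ Finset.range (a / 2 + 1),
      ((b - c - 1).choose (a - 2 * c) : ZMod 2) • (Sq (a + b - c) * Sq c) := by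
  have h := mk_rel (AdemRel.adem a b ha hab)
  simpa [Sq] using h

/-- Algebra maps out of the Steenrod algebra. -/
noncomputable def lift {B : Type*} [Ring B] [Algebra (ZMod 2) B] (s : ℕ → B) (h0 : s 0 = 1)
    (h : ∀ a b : ℕ, 0 < a → a < 2 * b → s a * s b = ∑ c ∈ Finset.range (a / 2 + 1),
      ((b - c - 1).choose (a - 2 * c) : ZMod 2) • (s (a + b - c) * s c)) :
    Steenrod →ₐ[ZMod 2] B :=
  RingQuot.liftAlgHom (ZMod 2) ⟨FreeAlgebra.lift (ZMod 2) s, by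
    intro x y hxy
    cases hxy with
    | one => simpa using h0
    | adem a b ha hab => simpa using h a b ha hab⟩

@[simp] theorem lift_Sq {B : Type*} [Ring B] [Algebra (ZMod 2) B] (s : ℕ → B) (h0 : s 0 = 1)
    (h : ∀ a b : ℕ, 0 < a → a < 2 * b → s a * s b = ∑ c ∈ Finset.range (a / 2 + 1),
      ((b - c - 1).choose (a - 2 * c) : ZMod 2) • (s (a + b - c) * s c)) (n : ℕ) :
    lift s h0 h (Sq n) = s n := by
  refine (RingQuot.liftAlgHom_mkAlgHom_apply (ZMod 2) _ _ _).trans ?_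
  simp

/-- The part of degree `n` of the Steenrod algebra (with `Sq^i` of degree `i`): the span of the
words `Sq^{i_1} ⋯ Sq^{i_k}` with `i_1 + ⋯ + i_k = n`. -/
noncomputable def deg (n : ℤ) : Submodule (ZMod 2) Steenrod :=
  Submodule.span (ZMod 2) {x | ∃ l : List ℕ, (l.sum : ℤ) = n ∧ x = (l.map Sq).prod}

/-- The algebra map `Sq^n ↦ Sq^n T^n`, which detects degrees. -/
noncomputable def coact : Steenrod →ₐ[ZMod 2] Polynomial Steenrod :=
  lift (fun n => Polynomial.monomial n (Sq n)) (by simp [Sq_zero]) (by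
    intro a b ha hab
    rw [Polynomial.monomial_mul_monomial, Sq_mul_Sq a b ha hab, map_sum]
    refine Finset.sum_congr rfl fun c hc => ?_
    have hc' : a + b - c + c = a + b := by
      have := Finset.mem_range.1 hc
      omega
    rw [Polynomial.monomial_mul_monomial, hc', Polynomial.smul_monomial])

theorem coact_word (l : List ℕ) :
    coact (l.map Sq).prod = Polynomial.monomial l.sum (l.map Sq).prod := by
  induction l with
  | nil => simp
  | cons a l ih =>
    simp only [List.map_cons, List.prod_cons, List.sum_cons, map_mul, ih]
    simp [coact, lift_Sq, Polynomial.monomial_mul_monomial]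

/-- The words `1, Sq^1, Sq^2, Sq^1Sq^2, Sq^2Sq^1, Sq^1Sq^2Sq^1, Sq^2Sq^1Sq^2, Sq^1Sq^2Sq^1Sq^2`
in two elements of an algebra. -/
def word {B : Type*} [Monoid B] (s t : B) : Fin 8 → B :=
  ![1, s, t, s * t, t * s, s * t * s, t * s * t, s * t * s * t]

/-- The matrices of the `Sq^n` in a module over the Steenrod algebra that is free of rank one over the
subalgebra generated by `Sq^1` and `Sq^2`; they show that this subalgebra has dimension `8`. -/
def repSq : ℕ → Matrix (Fin 8) (Fin 8) (ZMod 2)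
  | 0 => 1
  | 1 => .of fun i j => if (i, j) ∈ ([(1, 0), (3, 2), (5, 4), (7, 6)] : List (Fin 8 × Fin 8))
      then 1 else 0
  | 2 => .of fun i j => if (i, j) ∈
      ([(2, 0), (4, 1), (5, 2), (6, 3), (7, 5)] : List (Fin 8 × Fin 8)) then 1 else 0
  | 3 => .of fun i j => if (i, j) ∈ ([(3, 0), (5, 1), (7, 3)] : List (Fin 8 × Fin 8))
      then 1 else 0
  | 4 => .of fun i j => if (i, j) = (6, 1) then 1 else 0
  | 5 => .of fun i j => if (i, j) = (7, 1) then 1 else 0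
  | 6 => .of fun i j => if (i, j) = (7, 0) then 1 else 0
  | _ => 0

theorem repSq_of_lt (n : ℕ) (h : 6 < n) : repSq n = 0 := by
  match n, h with
  | n + 7, _ => rfl

set_option maxRecDepth 100000 in
theorem repSq_mul_eq_zero (i j : ℕ) (h : 6 < i + j) : repSq i * repSq j = 0 := by
  by_cases hi : 6 < i
  · rw [repSq_of_lt i hi, zero_mul]
  by_cases hj : 6 < j
  · rw [repSq_of_lt j hj, mul_zero]
  have key : ∀ i j : Fin 7, 6 < i.val + j.val → repSq i * repSq j = 0 := by decide
  exact key ⟨i, by omega⟩ ⟨j, by omega⟩ h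

set_option maxRecDepth 100000 in
theorem repSq_adem (a b : ℕ) (ha : 0 < a) (hab : a < 2 * b) :
    repSq a * repSq b = ∑ c ∈ Finset.range (a / 2 + 1),
      ((b - c - 1).choose (a - 2 * c) : ZMod 2) • (repSq (a + b - c) * repSq c) := by
  by_cases h : 6 < a + b
  · rw [repSq_mul_eq_zero a b h]
    refine (Finset.sum_eq_zero fun c hc => ?_).symm
    have := Finset.mem_range.1 hc
    rw [repSq_mul_eq_zero _ _ (by omega), smul_zero]
  have key : ∀ a b : Fin 7, 0 < a.val → a.val < 2 * b.val → a.val + b.val ≤ 6 →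
      repSq a * repSq b = ∑ c ∈ Finset.range (a / 2 + 1),
      ((b - c - 1).choose (a - 2 * c) : ZMod 2) • (repSq (a + b - c) * repSq c) := by decide
  exact key ⟨a, by omega⟩ ⟨b, by omega⟩ ha hab (by simpa using h)

noncomputable def rep : Steenrod →ₐ[ZMod 2] Matrix (Fin 8) (Fin 8) (ZMod 2) :=
  lift repSq rfl repSq_adem

theorem rep_Sq (n : ℕ) : rep (Sq n) = repSq n := lift_Sq _ _ _ n

set_option maxRecDepth 100000 in
theorem rep_word (i j : Fin 8) :
    (word (repSq 1) (repSq 2) i) j 0 = if i = j then 1 else 0 := by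
  revert i j
  decide

end Steenrod

/-! ### The subalgebra `A(1)` -/

/-- `A(1)`, the subalgebra of the mod 2 Steenrod algebra generated by `Sq^1` and `Sq^2`. -/
abbrev A1 : Type :=
  ↥(Algebra.adjoin (ZMod 2) ({Steenrod.Sq 1, Steenrod.Sq 2} : Set Steenrod))

namespace A1

open Steenrod in
noncomputable def sq1 : A1 := ⟨Sq 1, Algebra.subset_adjoin (by simp)⟩

open Steenrod in
noncomputable def sq2 : A1 := ⟨Sq 2, Algebra.subset_adjoin (by simp)⟩

theorem sq1_mul_sq1 : sq1 * sq1 = 0 := by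
  apply Subtype.ext
  have h := Steenrod.Sq_mul_Sq 1 1 (by norm_num) (by norm_num)
  simpa [sq1] using h

theorem sq2_mul_sq2 : sq2 * sq2 = sq1 * sq2 * sq1 := by
  apply Subtype.ext
  have h := Steenrod.Sq_mul_Sq 2 2 (by norm_num) (by norm_num)
  have h' := Steenrod.Sq_mul_Sq 1 2 (by norm_num) (by norm_num)
  simp [Finset.sum_range_succ, Steenrod.Sq_zero] at h h'
  simp [sq1, sq2, h, h']

/-- The coefficients of an element of `A(1)` in the basis of words. -/
noncomputable def coef (a : A1) (i : Fin 8) : ZMod 2 := Steenrod.rep a.1 i 0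

theorem coef_add (a b : A1) (i : Fin 8) : coef (a + b) i = coef a i + coef b i := by
  simp [coef]

theorem coef_smul (c : ZMod 2) (a : A1) (i : Fin 8) : coef (c • a) i = c * coef a i := by
  simp [coef]

theorem coef_one (i : Fin 8) : coef 1 i = if i = 0 then 1 else 0 := by
  simp [coef, Matrix.one_apply]

theorem coef_sq1_mul (a : A1) (i : Fin 8) :
    coef (sq1 * a) i = ∑ j, Steenrod.repSq 1 i j * coef a j := by
  simp [coef, sq1, Steenrod.rep_Sq, Matrix.mul_apply]

theorem coef_sq2_mul (a : A1) (i : Fin 8) :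
    coef (sq2 * a) i = ∑ j, Steenrod.repSq 2 i j * coef a j := by
  simp [coef, sq2, Steenrod.rep_Sq, Matrix.mul_apply]

section lift

variable {B : Type*} [Ring B] [Algebra (ZMod 2) B] (s t : B)

theorem mul_word_one (hs : s * s = 0) (i : Fin 8) :
    s * Steenrod.word s t i = ∑ j, Steenrod.repSq 1 j i • Steenrod.word s t j := by
  have h1 : ∀ x, s * (s * x) = 0 := fun x => by rw [← mul_assoc, hs, zero_mul]
  fin_cases i <;>
    simp [Steenrod.repSq, Steenrod.word, mul_assoc, hs, h1, Prod.ext_iff]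

theorem mul_word_two (hs : s * s = 0) (ht : t * t = s * t * s) (i : Fin 8) :
    t * Steenrod.word s t i = ∑ j, Steenrod.repSq 2 j i • Steenrod.word s t j := by
  have h1 : ∀ x, s * (s * x) = 0 := fun x => by rw [← mul_assoc, hs, zero_mul]
  have h2 : t * t = s * (t * s) := by rw [ht, mul_assoc]
  have h3 : ∀ x, t * (t * x) = s * (t * (s * x)) := fun x => by
    rw [← mul_assoc, h2]; simp only [mul_assoc]
  have h4 : t * (s * (t * s)) = s * (t * (s * t)) := by
    rw [← h2, h3]
  have h5 : t * (s * (t * (s * t))) = 0 := by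
    have : t * (s * (t * (s * t))) = (t * (s * (t * s))) * t := by simp only [mul_assoc]
    rw [this, h4]
    simp only [mul_assoc, h2, h1, mul_zero]
  fin_cases i <;>
    simp [Steenrod.repSq, Steenrod.word, mul_assoc, hs, h1, h2, h3, h4, h5,
      Prod.ext_iff]

/-- The linear map underlying `A1.lift`. -/
noncomputable def liftFun (a : A1) : B := ∑ i, coef a i • Steenrod.word s t i

theorem liftFun_add (a b : A1) : liftFun s t (a + b) = liftFun s t a + liftFun s t b := by
  simp [liftFun, coef_add, add_smul, Finset.sum_add_distrib]

theorem liftFun_smul (c : ZMod 2) (a : A1) : liftFun s t (c • a) = c • liftFun s t a := by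
  simp [liftFun, coef_smul, mul_smul, Finset.smul_sum]

theorem liftFun_one : liftFun s t 1 = 1 := by
  simp [liftFun, coef_one, Steenrod.word]

theorem liftFun_sq1_mul (hs : s * s = 0) (a : A1) :
    liftFun s t (sq1 * a) = s * liftFun s t a := by
  simp only [liftFun, coef_sq1_mul, Finset.mul_sum, mul_smul_comm, mul_word_one s t hs,
    Finset.sum_smul, Finset.smul_sum, smul_smul]
  rw [Finset.sum_comm]
  simp only [mul_comm]

theorem liftFun_sq2_mul (hs : s * s = 0) (ht : t * t = s * t * s) (a : A1) :
    liftFun s t (sq2 * a) = t * liftFun s t a := by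
  simp only [liftFun, coef_sq2_mul, Finset.mul_sum, mul_smul_comm, mul_word_two s t hs ht,
    Finset.sum_smul, Finset.smul_sum, smul_smul]
  rw [Finset.sum_comm]
  simp only [mul_comm]

/-- Induction for `A(1)`: it is generated by `Sq^1` and `Sq^2`. -/
theorem induction {p : A1 → Prop} (h1 : p sq1) (h2 : p sq2)
    (hc : ∀ c : ZMod 2, p (algebraMap (ZMod 2) A1 c)) (hadd : ∀ a b, p a → p b → p (a + b))
    (hmul : ∀ a b, p a → p b → p (a * b)) (a : A1) : p a := by
  obtain ⟨a, ha⟩ := a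
  induction ha using Algebra.adjoin_induction with
  | mem x hx =>
    rcases hx with rfl | rfl
    · exact h1
    · exact h2
  | algebraMap r => exact hc r
  | add x y hx hy ihx ihy => exact hadd _ _ ihx ihy
  | mul x y hx hy ihx ihy => exact hmul _ _ ihx ihy

theorem liftFun_mul (hs : s * s = 0) (ht : t * t = s * t * s) (a b : A1) :
    liftFun s t (a * b) = liftFun s t a * liftFun s t b := by
  induction a using A1.induction generalizing b with
  | h1 =>
    have := liftFun_sq1_mul s t hs 1
    rw [mul_one, liftFun_one, mul_one] at this
    rw [liftFun_sq1_mul s t hs, this]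
  | h2 =>
    have := liftFun_sq2_mul s t hs ht 1
    rw [mul_one, liftFun_one, mul_one] at this
    rw [liftFun_sq2_mul s t hs ht, this]
  | hc c =>
    rw [Algebra.algebraMap_eq_smul_one, smul_mul_assoc, one_mul, liftFun_smul, liftFun_smul,
      liftFun_one, smul_mul_assoc, one_mul]
  | hadd x y hx hy => rw [add_mul, liftFun_add, hx, hy, liftFun_add, add_mul]
  | hmul x y hx hy => rw [mul_assoc, hx, hy, hx, mul_assoc]

/-- `A(1)` is presented by the generators `Sq^1`, `Sq^2` and the relations `Sq^1 Sq^1 = 0`,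
`Sq^2 Sq^2 = Sq^1 Sq^2 Sq^1`. -/
noncomputable def lift (hs : s * s = 0) (ht : t * t = s * t * s) : A1 →ₐ[ZMod 2] B :=
  AlgHom.ofLinearMap
    { toFun := liftFun s t
      map_add' := liftFun_add s t
      map_smul' := liftFun_smul s t }
    (liftFun_one s t) (liftFun_mul s t hs ht)

@[simp] theorem lift_sq1 (hs : s * s = 0) (ht : t * t = s * t * s) : lift s t hs ht sq1 = s := by
  have := liftFun_sq1_mul s t hs 1
  rwa [mul_one, liftFun_one, mul_one] at this

@[simp] theorem lift_sq2 (hs : s * s = 0) (ht : t * t = s * t * s) : lift s t hs ht sq2 = t := by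
  have := liftFun_sq2_mul s t hs ht 1
  rwa [mul_one, liftFun_one, mul_one] at this

variable {s t} in
theorem algHom_ext {f g : A1 →ₐ[ZMod 2] B} (h1 : f sq1 = g sq1) (h2 : f sq2 = g sq2) : f = g := by
  ext a
  induction a using A1.induction with
  | h1 => exact h1
  | h2 => exact h2
  | hc c => simp
  | hadd x y hx hy => simp [hx, hy]
  | hmul x y hx hy => simp [hx, hy]

end lift

theorem eq_sum_word (a : A1) : a = ∑ i, coef a i • Steenrod.word sq1 sq2 i := by
  have h : lift sq1 sq2 sq1_mul_sq1 sq2_mul_sq2 = AlgHom.id (ZMod 2) A1 :=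
    algHom_ext (lift_sq1 sq1 sq2 sq1_mul_sq1 sq2_mul_sq2) (lift_sq2 sq1 sq2 sq1_mul_sq1 sq2_mul_sq2)
  exact (DFunLike.congr_fun h a).symm

theorem coef_word (i j : Fin 8) :
    coef (Steenrod.word sq1 sq2 i) j = if i = j then 1 else 0 := by
  have h : Steenrod.rep ((Steenrod.word sq1 sq2 i : A1) : Steenrod)
      = Steenrod.word (Steenrod.repSq 1) (Steenrod.repSq 2) i := by
    fin_cases i <;> simp [Steenrod.word, sq1, sq2, Steenrod.rep_Sq]
  rw [coef, h, Steenrod.rep_word]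

/-- The part of degree `n` of `A(1)`. -/
noncomputable def deg (n : ℤ) : Submodule (ZMod 2) A1 :=
  (Steenrod.deg n).comap (Subalgebra.val _).toLinearMap

/-- The degrees of the basis words. -/
def wdeg : Fin 8 → ℕ := ![0, 1, 2, 3, 3, 4, 5, 6]

theorem word_eq (i : Fin 8) : ∃ l : List ℕ, l.sum = wdeg i ∧
    ((Steenrod.word sq1 sq2 i : A1) : Steenrod) = (l.map Steenrod.Sq).prod := by
  fin_cases i
  · exact ⟨[], by simp [wdeg], by simp [Steenrod.word]⟩
  · exact ⟨[1], by simp [wdeg], by simp [Steenrod.word, sq1]⟩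
  · exact ⟨[2], by simp [wdeg], by simp [Steenrod.word, sq2]⟩
  · exact ⟨[1, 2], by simp [wdeg], by simp [Steenrod.word, sq1, sq2]⟩
  · exact ⟨[2, 1], by simp [wdeg], by simp [Steenrod.word, sq1, sq2]⟩
  · exact ⟨[1, 2, 1], by simp [wdeg], by simp [Steenrod.word, sq1, sq2, mul_assoc]⟩
  · exact ⟨[2, 1, 2], by simp [wdeg], by simp [Steenrod.word, sq1, sq2, mul_assoc]⟩
  · exact ⟨[1, 2, 1, 2], by simp [wdeg], by simp [Steenrod.word, sq1, sq2, mul_assoc]⟩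

theorem word_mem_deg (i : Fin 8) : Steenrod.word sq1 sq2 i ∈ deg (wdeg i) := by
  obtain ⟨l, hl, h⟩ := word_eq i
  exact Submodule.subset_span ⟨l, by exact_mod_cast hl, h⟩

theorem sq1_mem_deg : sq1 ∈ deg 1 := word_mem_deg 1

theorem sq2_mem_deg : sq2 ∈ deg 2 := word_mem_deg 2

end A1

namespace Steenrod

/-- The projection of the Steenrod algebra to degree `n`. -/
noncomputable def proj (n : ℤ) : Steenrod →ₗ[ZMod 2] Steenrod where
  toFun a := if 0 ≤ n then (coact a).coeff n.toNat else 0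
  map_add' a b := by
    by_cases h : 0 ≤ n <;> simp [h]
  map_smul' c a := by
    by_cases h : 0 ≤ n <;> simp [h]

theorem proj_word (n : ℤ) (l : List ℕ) :
    proj n (l.map Sq).prod = if (l.sum : ℤ) = n then (l.map Sq).prod else 0 := by
  simp only [proj, LinearMap.coe_mk, AddHom.coe_mk, coact_word, Polynomial.coeff_monomial]
  split_ifs <;> first | rfl | omega

theorem proj_of_mem {m : ℤ} (n : ℤ) {a : Steenrod} (ha : a ∈ deg m) :
    proj n a = if m = n then a else 0 := by
  induction ha using Submodule.span_induction with
  | mem x hx =>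
    obtain ⟨l, rfl, rfl⟩ := hx
    exact proj_word n l
  | zero => simp
  | add x y _ _ hx hy => rw [map_add, hx, hy]; split_ifs <;> simp
  | smul c x _ hx => rw [map_smul, hx]; split_ifs <;> simp

end Steenrod

namespace A1

theorem eq_sum_of_mem_deg {n : ℤ} {a : A1} (ha : a ∈ deg n) :
    a = ∑ i, if (wdeg i : ℤ) = n then coef a i • Steenrod.word sq1 sq2 i else 0 := by
  have h := Steenrod.proj_of_mem n (show (a : Steenrod) ∈ Steenrod.deg n from ha)
  rw [if_pos rfl] at h
  apply Subtype.ext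
  rw [← h]
  conv_lhs => rw [eq_sum_word a]
  simp only [AddSubmonoidClass.coe_finsetSum, map_sum]
  refine Finset.sum_congr rfl fun i _ => ?_
  obtain ⟨l, hl, hw⟩ := word_eq i
  rw [Subalgebra.coe_smul, map_smul, hw, Steenrod.proj_word, hl]
  split_ifs
  · rw [Subalgebra.coe_smul, hw]
  · simp

end A1

/-- A criterion for independence of a family of submodules: a jointly injective family of maps,
each of which sees only one member of the family. -/
theorem iSupIndep_of_maps {M : Type*} [AddCommGroup M] [Module (ZMod 2) M]
    {deg : ℤ → Submodule (ZMod 2) M} {κ X : Type*} [AddCommGroup X] [Module (ZMod 2) X]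
    (p : κ → M →ₗ[ZMod 2] X) (f : κ → ℤ)
    (h0 : ∀ k m x, x ∈ deg m → m ≠ f k → p k x = 0)
    (hinj : ∀ x, (∀ k, p k x = 0) → x = 0) : iSupIndep deg := by
  rw [iSupIndep_def]
  intro i
  rw [Submodule.disjoint_def]
  intro x hx hx'
  refine hinj x fun k => ?_
  by_cases hk : i = f k
  · have hle : (⨆ j, ⨆ _ : j ≠ i, deg j) ≤ LinearMap.ker (p k) :=
      iSup₂_le fun j hj y hy => h0 k j y hy (by rwa [← hk])
    exact hle hx'
  · exact h0 k i x hx hk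

theorem A1.isInternal_deg : DirectSum.IsInternal A1.deg := by
  refine DirectSum.isInternal_submodule_of_iSupIndep_of_iSup_eq_top ?_ ?_
  · refine iSupIndep_of_maps (fun k : ℤ => Steenrod.proj k ∘ₗ (Subalgebra.val _).toLinearMap) id
      (fun k m x hx hne => ?_) (fun x hx => ?_)
    · have := Steenrod.proj_of_mem k (show (x : Steenrod) ∈ Steenrod.deg m from hx)
      rw [if_neg (show m ≠ k from hne)] at this
      exact this
    · have hc : Steenrod.coact (x : Steenrod) = 0 := by
        ext n
        have := hx n
        simpa [Steenrod.proj] using this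
      have key : ∀ a : A1, Polynomial.eval₂ (RingHom.id Steenrod) 1 (Steenrod.coact a) = a := by
        intro a
        conv_lhs => rw [A1.eq_sum_word a]
        conv_rhs => rw [A1.eq_sum_word a]
        simp only [AddSubmonoidClass.coe_finsetSum, map_sum, Polynomial.eval₂_finsetSum]
        refine Finset.sum_congr rfl fun i _ => ?_
        obtain ⟨l, hl, hw⟩ := A1.word_eq i
        rw [Subalgebra.coe_smul, map_smul, hw, Steenrod.coact_word, Polynomial.smul_monomial]
        simp
      have := key x
      rw [hc] at this
      apply Subtype.ext
      simpa using this.symm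
  · rw [eq_top_iff]
    intro a _
    rw [A1.eq_sum_word a]
    refine Submodule.sum_mem _ fun i _ => Submodule.smul_mem _ _ ?_
    exact Submodule.mem_iSup_of_mem _ (A1.word_mem_deg i)

/-! ### Graded modules over `A(1)` -/

universe u v w

/-- A graded (left) `A(1)`-module: an `A(1)`-module which is the direct sum of `𝔽₂`-subspaces
`deg n`, `n ∈ ℤ`, such that `A(1)_i · deg n ⊆ deg (i + n)`. -/
structure GMod where
  carrier : Type u
  [addCommGroup : AddCommGroup carrier]
  [moduleF : Module (ZMod 2) carrier]
  [moduleA : Module A1 carrier]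
  [tower : IsScalarTower (ZMod 2) A1 carrier]
  deg : ℤ → Submodule (ZMod 2) carrier
  isInternal : DirectSum.IsInternal deg
  smul_mem : ∀ (i n : ℤ) (a : A1) (x : carrier), a ∈ A1.deg i → x ∈ deg n → a • x ∈ deg (i + n)

namespace GMod

instance : CoeSort GMod.{u} (Type u) := ⟨GMod.carrier⟩

attribute [instance] GMod.addCommGroup GMod.moduleF GMod.moduleA GMod.tower

instance (M : GMod.{u}) : SMulCommClass (ZMod 2) A1 M := IsScalarTower.to_smulCommClass

/-- To see that a grading is compatible with the action of `A(1)` it is enough to look at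
`Sq^1` and `Sq^2`. -/
theorem smul_mem_of_gen {M : Type*} [AddCommGroup M] [Module (ZMod 2) M] [Module A1 M]
    [IsScalarTower (ZMod 2) A1 M] (deg : ℤ → Submodule (ZMod 2) M)
    (h1 : ∀ n x, x ∈ deg n → A1.sq1 • x ∈ deg (n + 1))
    (h2 : ∀ n x, x ∈ deg n → A1.sq2 • x ∈ deg (n + 2))
    (i n : ℤ) (a : A1) (x : M) (ha : a ∈ A1.deg i) (hx : x ∈ deg n) : a • x ∈ deg (i + n) := by
  have hw : ∀ j : Fin 8, Steenrod.word A1.sq1 A1.sq2 j • x ∈ deg (A1.wdeg j + n) := by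
    have e : ∀ {k l : ℤ} {y : M}, y ∈ deg k → k = l → y ∈ deg l := fun h e => e ▸ h
    intro j
    fin_cases j
    · simpa [Steenrod.word, A1.wdeg] using hx
    · exact e (h1 _ _ hx) (by simp [A1.wdeg]; ring)
    · exact e (h2 _ _ hx) (by simp [A1.wdeg]; ring)
    · simp only [Steenrod.word]
      exact e (by simpa [mul_smul] using h1 _ _ (h2 _ _ hx)) (by simp [A1.wdeg]; ring)
    · exact e (by simpa [Steenrod.word, mul_smul] using h2 _ _ (h1 _ _ hx))
        (by simp [A1.wdeg]; ring)
    · exact e (by simpa [Steenrod.word, mul_smul] using h1 _ _ (h2 _ _ (h1 _ _ hx)))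
        (by simp [A1.wdeg]; ring)
    · exact e (by simpa [Steenrod.word, mul_smul] using h2 _ _ (h1 _ _ (h2 _ _ hx)))
        (by simp [A1.wdeg]; ring)
    · exact e (by simpa [Steenrod.word, mul_smul] using h1 _ _ (h2 _ _ (h1 _ _ (h2 _ _ hx))))
        (by simp [A1.wdeg]; ring)
  rw [A1.eq_sum_of_mem_deg ha, Finset.sum_smul]
  refine Submodule.sum_mem _ fun j _ => ?_
  split_ifs with hj
  · rw [smul_assoc, ← hj]
    exact Submodule.smul_mem _ _ (hw j)
  · rw [zero_smul]
    exact Submodule.zero_mem _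

theorem sq1_mem (M : GMod.{u}) {n : ℤ} {x : M} (hx : x ∈ M.deg n) :
    A1.sq1 • x ∈ M.deg (n + 1) := by
  rw [add_comm]; exact M.smul_mem _ _ _ _ A1.sq1_mem_deg hx

theorem sq2_mem (M : GMod.{u}) {n : ℤ} {x : M} (hx : x ∈ M.deg n) :
    A1.sq2 • x ∈ M.deg (n + 2) := by
  rw [add_comm]; exact M.smul_mem _ _ _ _ A1.sq2_mem_deg hx

/-- The projection of a graded module to degree `n`. -/
noncomputable def proj (M : GMod.{u}) (n : ℤ) : M →ₗ[ZMod 2] M :=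
  letI := M.isInternal.chooseDecomposition
  (M.deg n).subtype ∘ₗ DirectSum.component (ZMod 2) ℤ (fun i => M.deg i) n ∘ₗ
    (DirectSum.decomposeLinearEquiv M.deg).toLinearMap

theorem proj_of_mem (M : GMod.{u}) {m : ℤ} (n : ℤ) {x : M} (hx : x ∈ M.deg m) :
    M.proj n x = if m = n then x else 0 := by
  let := M.isInternal.chooseDecomposition
  change ((DirectSum.decompose M.deg x n : M.deg n) : M) = _
  split_ifs with h
  · subst h
    exact DirectSum.decompose_of_mem_same _ hx
  · exact DirectSum.decompose_of_mem_ne _ hx h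

theorem proj_mem (M : GMod.{u}) (n : ℤ) (x : M) : M.proj n x ∈ M.deg n :=
  Submodule.coe_mem _

/-- Induction over homogeneous elements. -/
theorem induction (M : GMod.{u}) {p : M → Prop} (h0 : p 0)
    (hdeg : ∀ n x, x ∈ M.deg n → p x) (hadd : ∀ x y, p x → p y → p (x + y)) (x : M) : p x := by
  have hx : x ∈ ⨆ n, M.deg n := by
    rw [M.isInternal.submodule_iSup_eq_top]; trivial
  exact Submodule.iSup_induction _ (motive := p) hx hdeg h0 hadd

theorem eq_zero_of_proj (M : GMod.{u}) (x : M) (h : ∀ n, M.proj n x = 0) : x = 0 := by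
  let := M.isInternal.chooseDecomposition
  apply (DirectSum.decompose M.deg).injective
  ext n
  rw [DirectSum.decompose_zero]
  exact h n

theorem exists_sum_proj (M : GMod.{u}) (x : M) :
    ∃ s : Finset ℤ, ∀ t, s ⊆ t → ∑ n ∈ t, M.proj n x = x := by
  classical
  induction x using M.induction with
  | h0 => exact ⟨∅, fun t _ => by simp⟩
  | hdeg m x hx =>
    refine ⟨{m}, fun t ht => ?_⟩
    rw [Finset.sum_eq_single m]
    · rw [M.proj_of_mem m hx, if_pos rfl]
    · intro n _ hn
      rw [M.proj_of_mem n hx, if_neg hn.symm]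
    · intro hm
      exact absurd (ht (Finset.mem_singleton_self m)) hm
  | hadd x y hx hy =>
    obtain ⟨s, hs⟩ := hx
    obtain ⟨t, ht⟩ := hy
    refine ⟨s ∪ t, fun r hr => ?_⟩
    simp only [map_add, Finset.sum_add_distrib]
    rw [hs r (Finset.union_subset_left hr), ht r (Finset.union_subset_right hr)]

/-- A grading by the criterion of a family of maps. -/
theorem isInternal_of_maps {M : Type*} [AddCommGroup M] [Module (ZMod 2) M]
    {deg : ℤ → Submodule (ZMod 2) M} {κ X : Type*} [AddCommGroup X] [Module (ZMod 2) X]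
    (p : κ → M →ₗ[ZMod 2] X) (f : κ → ℤ)
    (h0 : ∀ k m x, x ∈ deg m → m ≠ f k → p k x = 0)
    (hinj : ∀ x, (∀ k, p k x = 0) → x = 0) (htop : ∀ x, x ∈ ⨆ n, deg n) :
    DirectSum.IsInternal deg :=
  DirectSum.isInternal_submodule_of_iSupIndep_of_iSup_eq_top
    (iSupIndep_of_maps p f h0 hinj) (eq_top_iff.2 fun x _ => htop x)

/-- The graded module given by an action map `A(1) → End V` on a graded vector space `V`. -/
noncomputable def ofAct (V : Type u) [AddCommGroup V] [Module (ZMod 2) V]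
    (φ : A1 →ₐ[ZMod 2] Module.End (ZMod 2) V) (deg : ℤ → Submodule (ZMod 2) V)
    (hdeg : DirectSum.IsInternal deg) (h1 : ∀ n x, x ∈ deg n → φ A1.sq1 x ∈ deg (n + 1))
    (h2 : ∀ n x, x ∈ deg n → φ A1.sq2 x ∈ deg (n + 2)) : GMod.{u} :=
  letI : Module A1 V := Module.compHom V φ.toRingHom
  haveI : IsScalarTower (ZMod 2) A1 V := ⟨fun c a x => by
    change φ (c • a) x = c • φ a x
    rw [map_smul]; rfl⟩
  { carrier := V
    deg := deg
    isInternal := hdeg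
    smul_mem := smul_mem_of_gen deg h1 h2 }

/-! #### Homomorphisms -/

/-- The homomorphisms of graded modules: the `A(1)`-linear maps of degree `0`. -/
noncomputable def homs (M : GMod.{u}) (N : GMod.{v}) : AddSubgroup (M →ₗ[A1] N) where
  carrier := {f | ∀ n x, x ∈ M.deg n → f x ∈ N.deg n}
  add_mem' hf hg n x hx := Submodule.add_mem _ (hf n x hx) (hg n x hx)
  zero_mem' _ _ _ := Submodule.zero_mem _
  neg_mem' hf n x hx := Submodule.neg_mem _ (hf n x hx)

/-- The type of homomorphisms of graded modules. -/
abbrev Hom (M : GMod.{u}) (N : GMod.{v}) : Type max u v := ↥(homs M N)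

/-- Composition: `g.comp f` is `f` followed by `g`. -/
noncomputable def Hom.comp {M : GMod.{u}} {N : GMod.{v}} {K : GMod.{w}} (g : Hom N K) (f : Hom M N) :
    Hom M K :=
  ⟨g.1 ∘ₗ f.1, fun n x hx => g.2 n _ (f.2 n x hx)⟩

/-- The identity. -/
noncomputable def Hom.id (M : GMod.{u}) : Hom M M := ⟨LinearMap.id, fun _ _ hx => hx⟩

/-- `M ≅ N`: isomorphism of graded `A(1)`-modules. -/
def Iso (M : GMod.{u}) (N : GMod.{v}) : Prop :=
  ∃ (f : Hom M N) (g : Hom N M), g.comp f = Hom.id M ∧ f.comp g = Hom.id N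

/-- `P` is projective in the category of graded `A(1)`-modules. -/
def IsProjective (P : GMod.{u}) : Prop :=
  ∀ (X Y : GMod.{u}) (g : Hom X Y) (f : Hom P Y), Function.Surjective g.1 →
    ∃ h : Hom P X, g.comp h = f

/-- `F` is a free graded `A(1)`-module: it has a basis of homogeneous elements. -/
def IsFree (F : GMod.{u}) : Prop :=
  ∃ (ι : Type u) (b : Module.Basis ι A1 F), ∀ i, ∃ n, b i ∈ F.deg n

/-! #### Direct sums -/

/-- The direct sum `M ⊕ N`. -/
noncomputable def prod (M : GMod.{u}) (N : GMod.{u}) : GMod.{u} where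
  carrier := M × N
  deg n := (M.deg n).prod (N.deg n)
  isInternal := by
    refine isInternal_of_maps (κ := ℤ × Bool) (X := M × N)
      (fun k => bif k.2 then LinearMap.prodMap (M.proj k.1) 0 else
        LinearMap.prodMap 0 (N.proj k.1)) Prod.fst ?_ ?_ ?_
    · rintro ⟨k, b⟩ m x hx hne
      have hne : m ≠ k := hne
      cases b
      · simp [N.proj_of_mem k hx.2, hne]
      · simp [M.proj_of_mem k hx.1, hne]
    · intro x hx
      refine Prod.ext (M.eq_zero_of_proj _ fun n => ?_) (N.eq_zero_of_proj _ fun n => ?_)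
      · simpa using congrArg Prod.fst (hx (n, true))
      · simpa using congrArg Prod.snd (hx (n, false))
    · rintro ⟨x, y⟩
      have h1 : ∀ x : M, ((x, 0) : M × N) ∈ ⨆ n, (M.deg n).prod (N.deg n) := by
        intro x
        induction x using M.induction with
        | h0 => exact Submodule.zero_mem _
        | hdeg n x hx =>
          exact Submodule.mem_iSup_of_mem n ⟨hx, Submodule.zero_mem _⟩
        | hadd x y hx hy => simpa using Submodule.add_mem _ hx hy
      have h2 : ∀ y : N, ((0, y) : M × N) ∈ ⨆ n, (M.deg n).prod (N.deg n) := by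
        intro x
        induction x using N.induction with
        | h0 => exact Submodule.zero_mem _
        | hdeg n x hx =>
          exact Submodule.mem_iSup_of_mem n ⟨Submodule.zero_mem _, hx⟩
        | hadd x y hx hy => simpa using Submodule.add_mem _ hx hy
      simpa using Submodule.add_mem _ (h1 x) (h2 y)
  smul_mem i n a x ha hx := ⟨M.smul_mem i n a _ ha hx.1, N.smul_mem i n a _ ha hx.2⟩

/-! #### Stable isomorphism -/

/-- The maps that factor through a projective module, i.e. the zero maps of the stable module
category. -/
def Hom.IsNull {M N : GMod.{u}} (f : Hom M N) : Prop :=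
  ∃ (P : GMod.{u}) (g : Hom M P) (h : Hom P N), IsProjective P ∧ f = h.comp g

/-- `M ≃ N`: stable isomorphism, i.e. isomorphism in the stable module category. -/
def StableIso (M N : GMod.{u}) : Prop :=
  ∃ (f : Hom M N) (g : Hom N M),
    (g.comp f - Hom.id M).IsNull ∧ (f.comp g - Hom.id N).IsNull

theorem isProjective_zero : ∃ P : GMod.{u}, IsProjective P := by
  refine ⟨{ carrier := PUnit.{u + 1}, deg := fun _ => ⊥, isInternal := ?_, smul_mem := ?_ }, ?_⟩
  · exact isInternal_of_maps (κ := Unit) (X := PUnit.{u + 1}) (fun _ => 0) (fun _ => 0)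
      (fun _ _ _ _ _ => rfl) (fun _ _ => rfl) (fun x => Submodule.zero_mem _)
  · intro i n a x ha hx; exact Submodule.zero_mem _
  · intro X Y g f hg
    refine ⟨0, ?_⟩
    apply Subtype.ext
    refine LinearMap.ext fun x => ?_
    exact (map_zero g.1).trans (map_zero f.1).symm

theorem IsProjective.prod {P Q : GMod.{u}} (hP : IsProjective P) (hQ : IsProjective Q) :
    IsProjective (P.prod Q) := by
  intro X Y g f hg
  let i1 : Hom P (P.prod Q) :=
    ⟨LinearMap.inl A1 P Q, fun n x hx => ⟨hx, Submodule.zero_mem _⟩⟩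
  let i2 : Hom Q (P.prod Q) :=
    ⟨LinearMap.inr A1 P Q, fun n x hx => ⟨Submodule.zero_mem _, hx⟩⟩
  obtain ⟨h1, e1⟩ := hP X Y g (f.comp i1) hg
  obtain ⟨h2, e2⟩ := hQ X Y g (f.comp i2) hg
  refine ⟨⟨LinearMap.coprod h1.1 h2.1, fun n x hx => Submodule.add_mem _ (h1.2 n _ hx.1)
    (h2.2 n _ hx.2)⟩, ?_⟩
  apply Subtype.ext
  refine LinearMap.ext fun x => ?_
  have e1' := DFunLike.congr_fun (congrArg Subtype.val e1) x.1
  have e2' := DFunLike.congr_fun (congrArg Subtype.val e2) x.2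
  change g.1 (h1.1 x.1) = f.1 (x.1, 0) at e1'
  change g.1 (h2.1 x.2) = f.1 (0, x.2) at e2'
  change g.1 (h1.1 x.1 + h2.1 x.2) = f.1 x
  rw [map_add, e1', e2']
  refine (f.1.map_add (x.1, 0) (0, x.2)).symm.trans (congrArg f.1 ?_)
  exact Prod.ext (add_zero x.1) (zero_add x.2)

theorem Hom.isNull_zero (M N : GMod.{u}) : (0 : Hom M N).IsNull := by
  obtain ⟨P, hP⟩ := isProjective_zero.{u}
  refine ⟨P, 0, 0, hP, rfl⟩

theorem Hom.IsNull.add {M N : GMod.{u}} {f g : Hom M N} (hf : f.IsNull) (hg : g.IsNull) :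
    (f + g).IsNull := by
  obtain ⟨P, f1, f2, hP, rfl⟩ := hf
  obtain ⟨Q, g1, g2, hQ, rfl⟩ := hg
  exact ⟨P.prod Q, ⟨LinearMap.prod f1.1 g1.1, fun n x hx => ⟨f1.2 n x hx, g1.2 n x hx⟩⟩,
    ⟨LinearMap.coprod f2.1 g2.1, fun n x hx => Submodule.add_mem _ (f2.2 n _ hx.1)
      (g2.2 n _ hx.2)⟩, hP.prod hQ, rfl⟩

theorem Hom.IsNull.comp_comp {M N K L : GMod.{u}} {f : Hom N K} (hf : f.IsNull)
    (g : Hom K L) (h : Hom M N) : (g.comp (f.comp h)).IsNull := by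
  obtain ⟨P, f1, f2, hP, rfl⟩ := hf
  exact ⟨P, f1.comp h, g.comp f2, hP, rfl⟩

theorem StableIso.refl (M : GMod.{u}) : StableIso M M := by
  refine ⟨Hom.id M, Hom.id M, ?_, ?_⟩
  all_goals
    have h : (Hom.id M).comp (Hom.id M) - Hom.id M = 0 := sub_self (Hom.id M)
    rw [h]
    exact Hom.isNull_zero M M

theorem StableIso.symm {M N : GMod.{u}} (h : StableIso M N) : StableIso N M := by
  obtain ⟨f, g, h1, h2⟩ := h
  exact ⟨g, f, h2, h1⟩

theorem StableIso.trans {M N K : GMod.{u}} (h : StableIso M N) (h' : StableIso N K) :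
    StableIso M K := by
  obtain ⟨f, g, h1, h2⟩ := h
  obtain ⟨f', g', h1', h2'⟩ := h'
  refine ⟨f'.comp f, g.comp g', ?_, ?_⟩
  · have e : (g.comp g').comp (f'.comp f) - Hom.id M
        = g.comp ((g'.comp f' - Hom.id N).comp f) + (g.comp f - Hom.id M) := by
      apply Subtype.ext
      refine LinearMap.ext fun x => ?_
      change g.1 (g'.1 (f'.1 (f.1 x))) - x
        = g.1 (g'.1 (f'.1 (f.1 x)) - f.1 x) + (g.1 (f.1 x) - x)
      rw [map_sub]; abel
    rw [e]
    exact (h1'.comp_comp g f).add h1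
  · have e : (f'.comp f).comp (g.comp g') - Hom.id K
        = f'.comp ((f.comp g - Hom.id N).comp g') + (f'.comp g' - Hom.id K) := by
      apply Subtype.ext
      refine LinearMap.ext fun x => ?_
      change f'.1 (f.1 (g.1 (g'.1 x))) - x
        = f'.1 (f.1 (g.1 (g'.1 x)) - g'.1 x) + (f'.1 (g'.1 x) - x)
      rw [map_sub]; abel
    rw [e]
    exact (h2.comp_comp f' g').add h2'

/-- The setoid of stable isomorphism. -/
def stableSetoid : Setoid GMod.{u} :=
  ⟨StableIso, StableIso.refl, StableIso.symm, StableIso.trans⟩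

/-! #### Reduced modules -/

/-- `M` is reduced: it has no free direct summand other than `0`. -/
def IsReduced (M : GMod.{u}) : Prop :=
  ∀ F N : GMod.{u}, IsFree F → Iso M (F.prod N) → Subsingleton F

/-- `N` is a reduced part `M^red` of `M`: it is reduced and `M ≅ F ⊕ N` with `F` free. (It is
unique up to isomorphism.) -/
def IsReducedPart (N M : GMod.{u}) : Prop :=
  IsReduced N ∧ ∃ F : GMod.{u}, IsFree F ∧ Iso M (F.prod N)

/-! #### Suspension -/

/-- The suspension `Σ^k M`: `(Σ^k M)_n = M_{n-k}`. -/
noncomputable def susp (k : ℤ) (M : GMod.{u}) : GMod.{u} where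
  carrier := M
  deg n := M.deg (n - k)
  isInternal := by
    refine isInternal_of_maps (fun n : ℤ => M.proj (n - k)) id ?_ ?_ ?_
    · intro n m x hx hne
      rw [M.proj_of_mem _ hx, if_neg]
      intro h
      exact hne (by simpa using h)
    · intro x hx
      refine M.eq_zero_of_proj x fun n => ?_
      have := hx (n + k)
      simpa using this
    · intro x
      induction x using M.induction with
      | h0 => exact Submodule.zero_mem _
      | hdeg n x hx => exact Submodule.mem_iSup_of_mem (n + k) (by simpa using hx)
      | hadd x y hx hy => exact Submodule.add_mem _ hx hy
  smul_mem i n a x ha hx := by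
    have := M.smul_mem i (n - k) a x ha hx
    rwa [← add_sub_assoc] at this

/-! #### Submodules and quotients -/

/-- A homogeneous submodule: it contains the homogeneous components of its elements. -/
def IsHomogeneous (M : GMod.{u}) (S : Submodule A1 M) : Prop :=
  ∀ x ∈ S, ∀ n, M.proj n x ∈ S

/-- A homogeneous submodule as a graded module. -/
noncomputable def sub (M : GMod.{u}) (S : Submodule A1 M) (hS : M.IsHomogeneous S) : GMod.{u} where
  carrier := S
  deg n := (M.deg n).comap (S.subtype.restrictScalars (ZMod 2))
  isInternal := by
    classical
    refine isInternal_of_maps (fun n : ℤ => M.proj n ∘ₗ S.subtype.restrictScalars (ZMod 2)) id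
      ?_ ?_ ?_
    · intro n m x hx hne
      have := M.proj_of_mem n (show (x : M) ∈ M.deg m from hx)
      rwa [if_neg (show m ≠ n from hne)] at this
    · intro x hx
      exact Subtype.ext (M.eq_zero_of_proj _ hx)
    · intro x
      obtain ⟨s, hs⟩ := M.exists_sum_proj (x : M)
      have hx : x = ∑ n ∈ s, (⟨M.proj n x, hS _ x.2 n⟩ : S) := by
        apply Subtype.ext
        rw [AddSubmonoidClass.coe_finsetSum]
        exact (hs s subset_rfl).symm
      rw [hx]
      exact Submodule.sum_mem _ fun n _ => Submodule.mem_iSup_of_mem n (M.proj_mem n x)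
  smul_mem i n a x ha hx := M.smul_mem i n a x ha hx

/-- The quotient of a graded module by a homogeneous submodule. -/
noncomputable def quot (M : GMod.{u}) (S : Submodule A1 M) (hS : M.IsHomogeneous S) : GMod.{u} where
  carrier := M ⧸ S
  deg n := (M.deg n).map (S.mkQ.restrictScalars (ZMod 2))
  isInternal := by
    let p : ∀ n : ℤ, (M ⧸ S) →ₗ[ZMod 2] (M ⧸ S) := fun n =>
      { toFun := Quotient.lift (fun x => S.mkQ (M.proj n x)) (by
          intro x y hxy
          have hxy' : x - y ∈ S := (Submodule.quotientRel_def S).1 hxy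
          refine (Submodule.Quotient.eq S).2 ?_
          rw [← map_sub]
          exact hS _ hxy' n)
        map_add' := by
          rintro ⟨x⟩ ⟨y⟩
          change S.mkQ (M.proj n (x + y)) = S.mkQ (M.proj n x) + S.mkQ (M.proj n y)
          rw [map_add, map_add]
        map_smul' := by
          rintro c ⟨x⟩
          change S.mkQ (M.proj n (c • x)) = c • S.mkQ (M.proj n x)
          rw [map_smul]; rfl }
    have hp : ∀ n x, p n (S.mkQ x) = S.mkQ (M.proj n x) := fun _ _ => rfl
    refine isInternal_of_maps p id ?_ ?_ ?_
    · rintro n m _ ⟨x, hx, rfl⟩ hne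
      change S.mkQ (M.proj n x) = 0
      rw [M.proj_of_mem n hx, if_neg (show m ≠ n from hne), map_zero]
    · intro x hx
      obtain ⟨x, rfl⟩ := S.mkQ_surjective x
      obtain ⟨s, hs⟩ := M.exists_sum_proj x
      rw [← hs s subset_rfl, map_sum]
      exact Finset.sum_eq_zero fun n _ => hx n
    · intro x
      obtain ⟨x, rfl⟩ := S.mkQ_surjective x
      obtain ⟨s, hs⟩ := M.exists_sum_proj x
      rw [← hs s subset_rfl, map_sum]
      exact Submodule.sum_mem _ fun n _ =>
        Submodule.mem_iSup_of_mem n ⟨_, M.proj_mem n x, rfl⟩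
  smul_mem := by
    rintro i n a _ ha ⟨x, hx, rfl⟩
    exact ⟨a • x, M.smul_mem i n a x ha hx, map_smul S.mkQ a x⟩

/-- The same module in a larger universe. -/
noncomputable def ulift (M : GMod.{u}) : GMod.{max u v} where
  carrier := ULift.{v} M
  deg n := (M.deg n).comap (ULift.moduleEquiv (R := ZMod 2) (M := M)).toLinearMap
  isInternal := by
    refine isInternal_of_maps
      (fun n : ℤ => M.proj n ∘ₗ (ULift.moduleEquiv (R := ZMod 2) (M := M)).toLinearMap) id ?_ ?_ ?_
    · intro n m x hx hne
      have := M.proj_of_mem n (show x.down ∈ M.deg m from hx)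
      rwa [if_neg (show m ≠ n from hne)] at this
    · intro x hx
      exact ULift.ext _ _ (M.eq_zero_of_proj _ hx)
    · rintro ⟨x⟩
      induction x using M.induction with
      | h0 => exact Submodule.zero_mem _
      | hdeg n x hx => exact Submodule.mem_iSup_of_mem n hx
      | hadd x y hx hy => exact Submodule.add_mem _ hx hy
  smul_mem i n a x ha hx := M.smul_mem i n a x.down ha hx

end GMod

open scoped TensorProduct

namespace A1

theorem add_self {B : Type*} [Ring B] [Algebra (ZMod 2) B] (x : B) : x + x = 0 := by
  rw [← two_smul (ZMod 2) x, show (2 : ZMod 2) = 0 from rfl, zero_smul]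

/-- The coproduct of `A(1)`: `ψ(Sq^n) = ∑_{i+j=n} Sq^i ⊗ Sq^j`. -/
noncomputable def comul : A1 →ₐ[ZMod 2] A1 ⊗[ZMod 2] A1 :=
  lift (sq1 ⊗ₜ 1 + 1 ⊗ₜ sq1) (sq2 ⊗ₜ 1 + sq1 ⊗ₜ sq1 + 1 ⊗ₜ sq2)
    (by
      simp only [mul_add, add_mul, Algebra.TensorProduct.tmul_mul_tmul, mul_one, one_mul,
        sq1_mul_sq1, TensorProduct.zero_tmul, TensorProduct.tmul_zero, zero_add, add_zero]
      exact add_self _)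
    (by
      have h2 : sq2 * sq2 = sq1 * (sq2 * sq1) := by rw [sq2_mul_sq2, mul_assoc]
      simp only [mul_add, add_mul, Algebra.TensorProduct.tmul_mul_tmul, mul_one, one_mul,
        mul_assoc, sq1_mul_sq1, h2, TensorProduct.zero_tmul,
        TensorProduct.tmul_zero, zero_add, add_zero]
      rw [← sub_eq_zero]
      simp only [sub_eq_add_neg, neg_add]
      have hn : ∀ x : A1 ⊗[ZMod 2] A1, -x = x := fun x =>
        (eq_neg_of_add_eq_zero_left (add_self x)).symm
      simp only [hn]
      abel_nf
      have h2' : ∀ x : A1 ⊗[ZMod 2] A1, (2 : ℤ) • x = 0 := fun x => by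
        rw [two_zsmul]; exact add_self x
      simp [h2'])

/-- The augmentation `A(1) → 𝔽₂`. -/
noncomputable def counit : A1 →ₐ[ZMod 2] ZMod 2 := lift 0 0 (by simp) (by simp)

/-- The Milnor primitives `Q_0 = Sq^1` and `Q_1 = Sq^2 Q_0 + Q_0 Sq^2`. -/
noncomputable def Q : Fin 2 → A1 := ![sq1, sq2 * sq1 + sq1 * sq2]

end A1

namespace GMod

/-! #### Tensor products -/

/-- The action of `A(1)` on `M ⊗ N` through the coproduct. -/
noncomputable def tensorAct (M : GMod.{u}) (N : GMod.{v}) :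
    A1 →ₐ[ZMod 2] Module.End (ZMod 2) (M ⊗[ZMod 2] N) :=
  (Module.endTensorEndAlgHom (R := ZMod 2) (S := ZMod 2) (A := ZMod 2) (M := M) (N := N)).comp
    ((Algebra.TensorProduct.map (Algebra.lsmul (ZMod 2) (ZMod 2) M)
      (Algebra.lsmul (ZMod 2) (ZMod 2) N)).comp A1.comul)

theorem tensorAct_sq1 (M : GMod.{u}) (N : GMod.{v}) (x : M) (y : N) :
    tensorAct M N A1.sq1 (x ⊗ₜ y) = (A1.sq1 • x) ⊗ₜ y + x ⊗ₜ (A1.sq1 • y) := by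
  simp [tensorAct, A1.comul, A1.lift_sq1, Module.endTensorEndAlgHom_apply]

theorem tensorAct_sq2 (M : GMod.{u}) (N : GMod.{v}) (x : M) (y : N) :
    tensorAct M N A1.sq2 (x ⊗ₜ y) =
      (A1.sq2 • x) ⊗ₜ y + (A1.sq1 • x) ⊗ₜ (A1.sq1 • y) + x ⊗ₜ (A1.sq2 • y) := by
  simp [tensorAct, A1.comul, A1.lift_sq2, Module.endTensorEndAlgHom_apply]

/-- The grading of `M ⊗ N`. -/
noncomputable def tensorDeg (M : GMod.{u}) (N : GMod.{v}) (n : ℤ) :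
    Submodule (ZMod 2) (M ⊗[ZMod 2] N) :=
  Submodule.span (ZMod 2)
    {z | ∃ i j : ℤ, i + j = n ∧ ∃ x ∈ M.deg i, ∃ y ∈ N.deg j, z = x ⊗ₜ y}

theorem tensor_exists_sum_proj (M : GMod.{u}) (N : GMod.{v}) (z : M ⊗[ZMod 2] N) :
    ∃ s t : Finset ℤ, ∀ s' t', s ⊆ s' → t ⊆ t' →
      ∑ i ∈ s', ∑ j ∈ t', TensorProduct.map (M.proj i) (N.proj j) z = z := by
  classical
  induction z using TensorProduct.induction_on with
  | zero => exact ⟨∅, ∅, fun _ _ _ _ => by simp⟩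
  | tmul x y =>
    obtain ⟨s, hs⟩ := M.exists_sum_proj x
    obtain ⟨t, ht⟩ := N.exists_sum_proj y
    refine ⟨s, t, fun s' t' hs' ht' => ?_⟩
    simp only [TensorProduct.map_tmul, ← TensorProduct.tmul_sum, ← TensorProduct.sum_tmul]
    rw [hs s' hs', ht t' ht']
  | add z w hz hw =>
    obtain ⟨s, t, h⟩ := hz
    obtain ⟨s', t', h'⟩ := hw
    refine ⟨s ∪ s', t ∪ t', fun a b ha hb => ?_⟩
    simp only [map_add, Finset.sum_add_distrib]
    rw [h a b (Finset.union_subset_left ha) (Finset.union_subset_left hb),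
      h' a b (Finset.union_subset_right ha) (Finset.union_subset_right hb)]

theorem isInternal_tensorDeg (M : GMod.{u}) (N : GMod.{v}) :
    DirectSum.IsInternal (tensorDeg M N) := by
  refine isInternal_of_maps (κ := ℤ × ℤ)
    (fun k => TensorProduct.map (M.proj k.1) (N.proj k.2)) (fun k => k.1 + k.2) ?_ ?_ ?_
  · rintro ⟨i, j⟩ m z hz hne
    induction hz using Submodule.span_induction with
    | mem z hz =>
      obtain ⟨i', j', rfl, x, hx, y, hy, rfl⟩ := hz
      rw [TensorProduct.map_tmul, M.proj_of_mem _ hx, N.proj_of_mem _ hy]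
      have hne : i' + j' ≠ i + j := hne
      by_cases hi : i' = i
      · have hj : j' ≠ j := fun hj => hne (by rw [hi, hj])
        simp [hj]
      · simp [hi]
    | zero => exact map_zero _
    | add z w _ _ hz hw => rw [map_add, hz, hw, add_zero]
    | smul c z _ hz => rw [map_smul, hz, smul_zero]
  · intro z hz
    obtain ⟨s, t, h⟩ := tensor_exists_sum_proj M N z
    rw [← h s t subset_rfl subset_rfl]
    exact Finset.sum_eq_zero fun i _ => Finset.sum_eq_zero fun j _ => hz (i, j)
  · intro z
    induction z using TensorProduct.induction_on with
    | zero => exact Submodule.zero_mem _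
    | tmul x y =>
      obtain ⟨s, hs⟩ := M.exists_sum_proj x
      obtain ⟨t, ht⟩ := N.exists_sum_proj y
      rw [← hs s subset_rfl, ← ht t subset_rfl, TensorProduct.sum_tmul]
      refine Submodule.sum_mem _ fun i _ => ?_
      rw [TensorProduct.tmul_sum]
      refine Submodule.sum_mem _ fun j _ => Submodule.mem_iSup_of_mem (i + j) ?_
      exact Submodule.subset_span ⟨i, j, rfl, _, M.proj_mem i x, _, N.proj_mem j y, rfl⟩
    | add z w hz hw => exact Submodule.add_mem _ hz hw

theorem tmul_mem_tensorDeg (M : GMod.{u}) (N : GMod.{v}) {n i j : ℤ} {x : M} {y : N}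
    (hx : x ∈ M.deg i) (hy : y ∈ N.deg j) (h : i + j = n) :
    x ⊗ₜ[ZMod 2] y ∈ tensorDeg M N n :=
  Submodule.subset_span ⟨_, _, h, _, hx, _, hy, rfl⟩

theorem tensorAct_sq1_mem (M : GMod.{u}) (N : GMod.{v}) (n : ℤ) (z : M ⊗[ZMod 2] N)
    (hz : z ∈ tensorDeg M N n) : tensorAct M N A1.sq1 z ∈ tensorDeg M N (n + 1) := by
  induction hz using Submodule.span_induction with
  | mem z hz =>
    obtain ⟨i, j, rfl, x, hx, y, hy, rfl⟩ := hz
    rw [tensorAct_sq1]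
    exact Submodule.add_mem _ (tmul_mem_tensorDeg M N (M.sq1_mem hx) hy (by ring))
      (tmul_mem_tensorDeg M N hx (N.sq1_mem hy) (by ring))
  | zero => rw [map_zero]; exact Submodule.zero_mem _
  | add z w _ _ hz hw => rw [map_add]; exact Submodule.add_mem _ hz hw
  | smul c z _ hz => rw [map_smul]; exact Submodule.smul_mem _ _ hz

theorem tensorAct_sq2_mem (M : GMod.{u}) (N : GMod.{v}) (n : ℤ) (z : M ⊗[ZMod 2] N)
    (hz : z ∈ tensorDeg M N n) : tensorAct M N A1.sq2 z ∈ tensorDeg M N (n + 2) := by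
  induction hz using Submodule.span_induction with
  | mem z hz =>
    obtain ⟨i, j, rfl, x, hx, y, hy, rfl⟩ := hz
    rw [tensorAct_sq2]
    exact Submodule.add_mem _ (Submodule.add_mem _ (tmul_mem_tensorDeg M N (M.sq2_mem hx) hy (by ring))
      (tmul_mem_tensorDeg M N (M.sq1_mem hx) (N.sq1_mem hy) (by ring)))
      (tmul_mem_tensorDeg M N hx (N.sq2_mem hy) (by ring))
  | zero => rw [map_zero]; exact Submodule.zero_mem _
  | add z w _ _ hz hw => rw [map_add]; exact Submodule.add_mem _ hz hw
  | smul c z _ hz => rw [map_smul]; exact Submodule.smul_mem _ _ hz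

/-- The tensor product `M ⊗ N` (over `𝔽₂`) of graded `A(1)`-modules, with the diagonal action. -/
noncomputable def tensor (M : GMod.{u}) (N : GMod.{v}) : GMod.{max u v} :=
  ofAct (M ⊗[ZMod 2] N) (tensorAct M N) (tensorDeg M N) (isInternal_tensorDeg M N)
    (tensorAct_sq1_mem M N) (tensorAct_sq2_mem M N)

/-! #### Loops -/

/-- `A(1)` as a graded module over itself. -/
noncomputable abbrev reg : GMod.{0} where
  carrier := A1
  deg := A1.deg
  isInternal := A1.isInternal_deg
  smul_mem := by
    have key : ∀ (k : ℕ) (n m : ℤ) (x : Steenrod), x ∈ Steenrod.deg n → n + k = m →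
        Steenrod.Sq k * x ∈ Steenrod.deg m := by
      rintro k n m x hx rfl
      induction hx using Submodule.span_induction with
      | mem x hx =>
        obtain ⟨l, rfl, rfl⟩ := hx
        exact Submodule.subset_span ⟨k :: l, by simp [add_comm], by simp⟩
      | zero => rw [mul_zero]; exact Submodule.zero_mem _
      | add x y _ _ hx hy => rw [mul_add]; exact Submodule.add_mem _ hx hy
      | smul c x _ hx => rw [mul_smul_comm]; exact Submodule.smul_mem _ _ hx
    exact smul_mem_of_gen A1.deg (fun n x hx => key 1 n _ x hx (by simp))
      (fun n x hx => key 2 n _ x hx (by simp))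

theorem counit_of_mem {n : ℤ} {a : A1} (ha : a ∈ A1.deg n) (hn : n ≠ 0) : A1.counit a = 0 := by
  rw [A1.eq_sum_of_mem_deg ha, map_sum]
  refine Finset.sum_eq_zero fun i _ => ?_
  split_ifs with h
  · rw [map_smul]
    have h1 : A1.counit A1.sq1 = 0 := A1.lift_sq1 _ _ _ _
    have h2 : A1.counit A1.sq2 = 0 := A1.lift_sq2 _ _ _ _
    have hw : i ≠ 0 → A1.counit (Steenrod.word A1.sq1 A1.sq2 i) = 0 := by
      fin_cases i <;> simp [Steenrod.word, h1, h2]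
    rw [hw, smul_zero]
    rintro rfl
    exact hn (by rw [← h]; rfl)
  · exact map_zero _

theorem counit_proj (n : ℤ) (a : A1) :
    A1.counit (reg.proj n a) = if n = 0 then A1.counit a else 0 := by
  induction a using reg.induction with
  | h0 =>
    have h : A1.counit 0 = 0 := map_zero _
    simp [h]
  | hdeg m a ha =>
    rw [reg.proj_of_mem n ha]
    by_cases hm : m = n
    · subst hm
      rw [if_pos rfl]
      split_ifs with h
      · rfl
      · exact counit_of_mem ha h
    · rw [if_neg hm, map_zero]
      split_ifs with h
      · exact (counit_of_mem ha (by rwa [h] at hm)).symm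
      · rfl
  | hadd x y hx hy =>
    rw [map_add]
    refine (map_add A1.counit _ _).trans ?_
    rw [hx, hy]
    split_ifs
    · exact (map_add A1.counit _ _).symm
    · simp

/-- The augmentation ideal `I = Ker(A(1) → 𝔽₂)`. -/
noncomputable def augIdeal : GMod.{0} :=
  reg.sub (RingHom.ker A1.counit) (fun x hx n => by
    change A1.counit (reg.proj n x) = 0
    rw [counit_proj, show A1.counit x = 0 from hx, ite_self])

/-- The algebraic loops `ΩM = I ⊗ M`. -/
noncomputable def loop (M : GMod.{u}) : GMod.{u} := augIdeal.tensor M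

/-- The socle `{0, Sq^2Sq^2Sq^2}` of `A(1)`, which lies in degree `6`. -/
noncomputable def socle : Submodule A1 A1 := Submodule.span A1 {A1.sq2 * A1.sq2 * A1.sq2}

theorem isHomogeneous_socle : reg.IsHomogeneous socle := by
  intro x hx n
  obtain ⟨a, rfl⟩ := Submodule.mem_span_singleton.1 hx
  clear hx
  induction a using reg.induction with
  | h0 =>
    rw [zero_smul, map_zero]; exact Submodule.zero_mem _
  | hdeg m a ha =>
    have hs : a • (A1.sq2 * A1.sq2 * A1.sq2) ∈ reg.deg (m + (2 + 2 + 2)) := by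
      have h := reg.smul_mem m (2 + 2 + 2) a _ ha (reg.sq2_mem (reg.sq2_mem A1.sq2_mem_deg))
      rwa [mul_assoc]
    rw [reg.proj_of_mem n hs]
    split_ifs
    · exact Submodule.smul_mem _ _ (Submodule.mem_span_singleton_self _)
    · exact Submodule.zero_mem _
  | hadd x y hx hy =>
    have h := Submodule.add_mem _ hx hy
    rw [← map_add] at h
    rw [add_smul]
    exact h

/-- `I⁻¹`, the cokernel of the inclusion `𝔽₂ → Σ^{-6} A(1)` of the socle. -/
noncomputable def augInv : GMod.{0} := (reg.quot socle isHomogeneous_socle).susp (-6)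

/-- The inverse loops `Ω⁻¹M = I⁻¹ ⊗ M`. -/
noncomputable def loopInv (M : GMod.{u}) : GMod.{u} := augInv.tensor M

/-- The iterated loops `Ω^n M`, `n ∈ ℤ`. -/
noncomputable def loops : ℤ → GMod.{u} → GMod.{u}
  | Int.ofNat n => loop^[n]
  | Int.negSucc n => loopInv^[n + 1]

/-! #### Margolis homology and local modules -/

/-- The action of `a ∈ A(1)` as an `𝔽₂`-linear map. -/
noncomputable def act (M : GMod.{u}) (a : A1) : M →ₗ[ZMod 2] M :=
  Algebra.lsmul (ZMod 2) (ZMod 2) M a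

/-- The part of degree `n` of the Margolis homology `H(M, Q_k) = Ker Q_k / Im Q_k`. -/
abbrev homology (M : GMod.{u}) (k : Fin 2) (n : ℤ) : Type u :=
  ↥(M.deg n ⊓ LinearMap.ker (M.act (A1.Q k))) ⧸
    (LinearMap.range (M.act (A1.Q k))).comap
      (M.deg n ⊓ LinearMap.ker (M.act (A1.Q k))).subtype

/-- `H(M, Q_k) ≅ Σ^a 𝔽₂` as a graded vector space. -/
def HomologyIso (M : GMod.{u}) (k : Fin 2) (a : ℤ) : Prop :=
  (∀ n, n ≠ a → Subsingleton (M.homology k n)) ∧ Nonempty (M.homology k a ≃ₗ[ZMod 2] ZMod 2)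

/-- `M` is bounded below. -/
def IsBoundedBelow (M : GMod.{u}) : Prop := ∃ b : ℤ, ∀ n < b, M.deg n = ⊥

/-- `M` is an object of the category of bounded-below `Q_k`-local modules: it is bounded below and
its `Q_i`-homology vanishes for `i ≠ k`. -/
def IsLocal (k : Fin 2) (M : GMod.{u}) : Prop :=
  M.IsBoundedBelow ∧ ∀ i, i ≠ k → ∀ n, Subsingleton (M.homology i n)

/-! #### The module `P_0` -/

/-- `Sq^k` on the Laurent polynomials `𝔽₂[x, x⁻¹]` (finitely supported families of coefficients):
`Sq^k x^n = (n choose k) x^{n+k}`. -/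
noncomputable def laurentSq (k : ℕ) : (ℤ →₀ ZMod 2) →ₗ[ZMod 2] (ℤ →₀ ZMod 2) :=
  Finsupp.linearCombination (ZMod 2)
    fun n : ℤ => Finsupp.single (n + k) ((Ring.choose n k : ℤ) : ZMod 2)

theorem laurentSq_single (k : ℕ) (n : ℤ) (c : ZMod 2) :
    laurentSq k (Finsupp.single n c)
      = Finsupp.single (n + k) (c * ((Ring.choose n k : ℤ) : ZMod 2)) := by
  rw [laurentSq, Finsupp.linearCombination_single, Finsupp.smul_single, smul_eq_mul]

theorem choose_two (m : ℤ) : ((Ring.choose (4 * m) 2 : ℤ) : ZMod 2) = 0 ∧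
    ((Ring.choose (4 * m + 1) 2 : ℤ) : ZMod 2) = 0 ∧
    ((Ring.choose (4 * m + 2) 2 : ℤ) : ZMod 2) = 1 ∧
    ((Ring.choose (4 * m + 3) 2 : ℤ) : ZMod 2) = 1 := by
  have h : ∀ n : ℤ, 2 * Ring.choose n 2 = n * (n - 1) := by
    intro n
    have h := Ring.descPochhammer_eq_factorial_smul_choose n 2
    have h2 : Polynomial.smeval (descPochhammer ℤ 2) n = n * (n - 1) := by
      rw [← Polynomial.eval_eq_smeval]
      simp [descPochhammer_succ_left]
    rw [h2] at h
    simpa [Nat.factorial] using h.symm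
  have z2 : (2 : ZMod 2) = 0 := rfl
  refine ⟨?_, ?_, ?_, ?_⟩
  · have : Ring.choose (4 * m) 2 = 2 * (m * (4 * m - 1)) := by linarith [h (4 * m)]
    rw [this]; push_cast; rw [z2, zero_mul]
  · have : Ring.choose (4 * m + 1) 2 = 2 * (m * (4 * m + 1)) := by linarith [h (4 * m + 1)]
    rw [this]; push_cast; rw [z2, zero_mul]
  · have : Ring.choose (4 * m + 2) 2 = 2 * (4 * m ^ 2 + 3 * m) + 1 := by
      linarith [h (4 * m + 2)]
    rw [this]; push_cast; rw [z2, zero_mul, zero_add]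
  · have : Ring.choose (4 * m + 3) 2 = 2 * (4 * m ^ 2 + 5 * m + 1) + 1 := by
      linarith [h (4 * m + 3)]
    rw [this]; push_cast; rw [z2, zero_mul, zero_add]

theorem laurentSq_one_mul : laurentSq 1 * laurentSq 1 = 0 := by
  refine Finsupp.lhom_ext fun n c => ?_
  change laurentSq 1 (laurentSq 1 (Finsupp.single n c)) = 0
  rw [laurentSq_single, laurentSq_single, Finsupp.single_eq_zero]
  have h : ∀ y : ZMod 2, c * y * (y + 1) = 0 := by revert c; decide
  simpa using h n

theorem laurentSq_two_mul : laurentSq 2 * laurentSq 2 = laurentSq 1 * laurentSq 2 * laurentSq 1 := by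
  refine Finsupp.lhom_ext fun n c => ?_
  change laurentSq 2 (laurentSq 2 (Finsupp.single n c))
    = laurentSq 1 (laurentSq 2 (laurentSq 1 (Finsupp.single n c)))
  simp only [laurentSq_single]
  have e : n + ((2 : ℕ) : ℤ) + ((2 : ℕ) : ℤ) = n + ((1 : ℕ) : ℤ) + ((2 : ℕ) : ℤ) + ((1 : ℕ) : ℤ) := by
    push_cast; ring
  rw [e]
  congr 1
  have z4 : (4 : ZMod 2) = 0 := rfl
  have z2 : (2 : ZMod 2) = 0 := rfl
  have z3 : (3 : ZMod 2) = 1 := rfl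
  have h4 : n = 4 * (n / 4) ∨ n = 4 * (n / 4) + 1 ∨ n = 4 * (n / 4) + 2 ∨ n = 4 * (n / 4) + 3 := by
    omega
  generalize n / 4 = m at h4
  obtain ⟨a0, a1, a2, a3⟩ := choose_two m
  obtain ⟨b0, b1, b2, b3⟩ := choose_two (m + 1)
  have hb0 : 4 * m + 4 = 4 * (m + 1) := by ring
  have hb1 : 4 * m + 5 = 4 * (m + 1) + 1 := by ring
  rcases h4 with rfl | rfl | rfl | rfl
  · simp [a0, z4]
  · simp [a1, z4, add_assoc]
  · simp [a2, z4, z2, add_assoc]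
    rw [hb0, b0]
    simp
  · simp [a3, z4, z3, add_assoc]
    rw [hb0, hb1, b0, b1]
    simp

/-- The action of `A(1)` on the Laurent polynomials. -/
noncomputable def laurentAct : A1 →ₐ[ZMod 2] Module.End (ZMod 2) (ℤ →₀ ZMod 2) :=
  A1.lift (laurentSq 1) (laurentSq 2) laurentSq_one_mul laurentSq_two_mul

theorem laurentAct_sq1 : laurentAct A1.sq1 = laurentSq 1 := A1.lift_sq1 _ _ _ _

theorem laurentAct_sq2 : laurentAct A1.sq2 = laurentSq 2 := A1.lift_sq2 _ _ _ _

theorem laurentSq_mem (k : ℕ) (n : ℤ) (x : ℤ →₀ ZMod 2)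
    (hx : x ∈ Submodule.span (ZMod 2) {(Finsupp.single n 1 : ℤ →₀ ZMod 2)}) :
    laurentSq k x ∈ Submodule.span (ZMod 2) {(Finsupp.single (n + k) 1 : ℤ →₀ ZMod 2)} := by
  obtain ⟨c, rfl⟩ := Submodule.mem_span_singleton.1 hx
  rw [map_smul, laurentSq_single, one_mul]
  refine Submodule.smul_mem _ _ (Submodule.mem_span_singleton.2
    ⟨((Ring.choose n k : ℤ) : ZMod 2), ?_⟩)
  rw [Finsupp.smul_single, smul_eq_mul, mul_one]

/-- The Laurent series ring `L = 𝔽₂[x, x⁻¹]`, with `x` in degree `1`. -/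
noncomputable def laurent : GMod.{0} :=
  ofAct (ℤ →₀ ZMod 2) laurentAct (fun n => Submodule.span (ZMod 2) {Finsupp.single n 1})
    (by
      refine isInternal_of_maps (fun n : ℤ => Finsupp.lapply n) id ?_ ?_ ?_
      · intro n m x hx hne
        obtain ⟨c, rfl⟩ := Submodule.mem_span_singleton.1 hx
        simp [show m ≠ n from hne]
      · intro x hx
        exact Finsupp.ext hx
      · intro x
        induction x using Finsupp.induction_linear with
        | zero => exact Submodule.zero_mem _
        | add x y hx hy => exact Submodule.add_mem _ hx hy
        | single n c =>
          exact Submodule.mem_iSup_of_mem n (Submodule.mem_span_singleton.2 ⟨c, by simp⟩))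
    (fun n x hx => by rw [laurentAct_sq1]; exact laurentSq_mem 1 n x hx)
    (fun n x hx => by rw [laurentAct_sq2]; exact laurentSq_mem 2 n x hx)

theorem laurent_smul_sq1 (f : laurent) : A1.sq1 • f = laurentSq 1 f := by
  change laurentAct A1.sq1 f = _
  rw [laurentAct_sq1]

theorem laurent_smul_sq2 (f : laurent) : A1.sq2 • f = laurentSq 2 f := by
  change laurentAct A1.sq2 f = _
  rw [laurentAct_sq2]

theorem laurentSq_coeff (k : ℕ) (f : ℤ →₀ ZMod 2) (hf : ∀ n < -1, f n = 0) (n : ℤ)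
    (hn : n < -1) : laurentSq k f n = 0 := by
  rw [laurentSq, Finsupp.linearCombination_apply, Finsupp.sum, Finsupp.finsetSum_apply]
  refine Finset.sum_eq_zero fun m hm => ?_
  rw [Finsupp.smul_single, Finsupp.single_apply, if_neg]
  intro h
  exact (Finsupp.mem_support_iff.1 hm) (hf m (by omega))

/-- The submodule of `L` of the elements that vanish in degrees below `-1`. -/
noncomputable def P0sub : Submodule A1 laurent where
  carrier := {f : ℤ →₀ ZMod 2 | ∀ n < -1, f n = 0}
  add_mem' := by
    intro f g hf hg n hn
    refine (Finsupp.add_apply (f : ℤ →₀ ZMod 2) g n).trans ?_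
    rw [hf n hn, hg n hn, add_zero]
  zero_mem' := fun n _ => rfl
  smul_mem' := by
    intro a f hf
    induction a using A1.induction generalizing f with
    | h1 => rw [laurent_smul_sq1]; exact laurentSq_coeff 1 f hf
    | h2 => rw [laurent_smul_sq2]; exact laurentSq_coeff 2 f hf
    | hc c =>
      rw [algebraMap_smul]
      intro n hn
      refine (Finsupp.smul_apply c (f : ℤ →₀ ZMod 2) n).trans ?_
      rw [hf n hn, smul_zero]
    | hadd a b ha hb =>
      intro n hn
      rw [add_smul]
      refine (Finsupp.add_apply (a • f : laurent) (b • f : laurent) n).trans ?_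
      rw [ha hf n hn, hb hf n hn, add_zero]
    | hmul a b ha hb => rw [mul_smul]; exact ha (hb hf)

theorem laurent_proj (n : ℤ) (f : ℤ →₀ ZMod 2) :
    laurent.proj n f = Finsupp.single n (f n) := by
  induction f using Finsupp.induction_linear with
  | zero =>
    exact (map_zero (laurent.proj n)).trans (Finsupp.single_zero n).symm
  | add f g hf hg =>
    refine (map_add (laurent.proj n) f g).trans ?_
    rw [Finsupp.add_apply, Finsupp.single_add]
    exact congrArg₂ (fun a b : ℤ →₀ ZMod 2 => a + b) hf hg
  | single m c =>
    have hm : (Finsupp.single m c : ℤ →₀ ZMod 2) ∈ laurent.deg m :=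
      Submodule.mem_span_singleton.2 ⟨c, by simp⟩
    rw [laurent.proj_of_mem n hm]
    by_cases h : m = n
    · subst h
      exact (if_pos rfl).trans (congrArg (Finsupp.single m) Finsupp.single_eq_same.symm)
    · rw [Finsupp.single_apply, if_neg h]
      exact (if_neg h).trans (Finsupp.single_zero n).symm

/-- The module `P_0`, the part of `L` in degrees `-1` and higher. -/
noncomputable def P0 : GMod.{u} :=
  ulift.{0, u} (laurent.sub P0sub (by
    intro f hf n k hk
    have := laurent_proj n f
    rw [this, Finsupp.single_apply]
    split_ifs with h
    · rw [h]; exact hf k hk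
    · rfl))

/-! #### The Picard group -/

/-- The stable isomorphism classes of graded `A(1)`-modules. -/
def StableClass : Type (u + 1) := Quotient stableSetoid.{u}

/-- The stable isomorphism class of a module. -/
def cls (M : GMod.{u}) : StableClass.{u} := Quotient.mk _ M

/-- The elements of `Pic^{(1)}(A(1))`: the stable isomorphism classes of the bounded-below
`Q_1`-local modules `M` that are invertible, i.e. such that `M ⊗ N ≃ P_0` for some bounded-below
`Q_1`-local module `N`; `P_0` is the unit for the tensor product of `Q_1`-local modules. -/
def Pic1 : Set StableClass.{u} :=
  {c | ∃ M N : GMod.{u}, IsLocal 1 M ∧ IsLocal 1 N ∧ StableIso (M.tensor N) P0 ∧ c = cls M}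

end GMod

/-! ### Calculation in modules over `A(1)` -/

namespace A1

section modules

variable {M : Type*} [AddCommGroup M] [Module A1 M]

/-! A local module is controlled by a well-chosen generator of its `Q_1`-homology.

Freeness is detected by Margolis homology. Lifts of a basis of `top • M`, where `top` spans the
socle of `A(1)`, generate a free direct summand (`exists_maximal_free`), and `top` kills its
complement. If `M` satisfies the freeness condition over the exterior algebra on `Q_0` and `Q_1`,
the complement equals the augmentation ideal times itself (`FreeCond.exists_of_top_smul`) and
vanishes by Nakayama. For bounded-below `M` that condition follows from the vanishing of both
homologies (`freeCond_of_acyclic`). Passing to a cokernel, a map of bounded-below modules that is an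
isomorphism in both homologies is a stable isomorphism (`stableIso_of_isEquiv`).

Suppose that a local module `N` has a generator `w` of its `Q_1`-homology, in degree `a`, that is
killed by `Sq^1` and `Sq^2`. Then `x ↦ w ⊗ x` is a stable isomorphism `Σ^a M → N ⊗ M` for every
local `M`. The element `x^0` of `P_0` is of this sort, so `P_0` is a unit; taking `M = P_0` gives `N
≃ Σ^a P_0` (`KindZero.stableIso`).

In general the generator is not invariant, but it can be put into one of four shapes, kinds 0 to 3
(`exists_kind`). The connecting isomorphism of `0 → I ⊗ M → A(1) ⊗ M → M → 0` raises the degree of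
the generator by 3 and changes the kind by 3 → 2 → 1 → 0 → 3. Hence `k` loops carry a module of kind
`k` to a suspension of `P_0`. As loops are invertible on local modules, `M ≃ Σ^{a+3k} Ω^{-k} P_0`,
which is (1).

Going once round the cycle gives `Ω^4 P_0 ≃ Σ^12 P_0`. The period is not shorter: `Ω^2 P_0` is of
kind 2, and a module of kind 2 has an invariant element in degree `a + 2` that is not a multiple of
`top`, whereas `Sq^2` is injective on `Σ^a P_0` in that degree (`KindTwo.not_stableIso`). Finally,
the Künneth formula forces an invertible module to have one-dimensional homology
(`exists_isGen_of_tensor`). -/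

theorem two_eq_zero : (2 : A1) = 0 := by
  rw [← one_add_one_eq_two]
  exact add_self 1

theorem char_two_add (x : M) : x + x = 0 := by
  rw [← two_smul A1 x, two_eq_zero, zero_smul]

theorem add_self_left (x y : M) : x + (x + y) = y := by
  rw [← add_assoc, char_two_add, zero_add]

theorem two_zsmul_eq_zero (x : M) : (2 : ℤ) • x = 0 := by
  rw [two_zsmul, char_two_add]

theorem four_zsmul_eq_zero (x : M) : (4 : ℤ) • x = 0 := by
  rw [show (4 : ℤ) = 2 * 2 by norm_num, mul_smul, two_zsmul_eq_zero]

theorem neg_eq_self (x : M) : -x = x :=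
  (eq_neg_of_add_eq_zero_left (char_two_add x)).symm

theorem eq_of_add_eq_zero {x y : M} (h : x + y = 0) : x = y := by
  rw [← neg_eq_self y]
  exact eq_neg_of_add_eq_zero_left h

theorem sq1_sq1 (x : M) : sq1 • sq1 • x = 0 := by
  rw [← mul_smul, sq1_mul_sq1, zero_smul]

theorem sq2_sq2 (x : M) : sq2 • sq2 • x = sq1 • sq2 • sq1 • x := by
  simp only [← mul_smul, sq2_mul_sq2, mul_assoc]

/-- Both sides are `Sq^2 Sq^2 Sq^2 x`, bracketed in two ways. -/
theorem sq2_sq1_sq2_sq1 (x : M) : sq2 • sq1 • sq2 • sq1 • x = sq1 • sq2 • sq1 • sq2 • x := by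
  rw [← sq2_sq2 x, sq2_sq2 (sq2 • x)]

theorem Q_zero_smul (x : M) : Q 0 • x = sq1 • x := rfl

theorem Q_one_smul (x : M) : Q 1 • x = sq2 • sq1 • x + sq1 • sq2 • x := by
  change (sq2 * sq1 + sq1 * sq2) • x = _
  rw [add_smul, mul_smul, mul_smul]

/-- The product `Sq^1 Sq^2 Sq^1 Sq^2`, which spans the socle. -/
noncomputable def top : A1 := sq1 * sq2 * sq1 * sq2

theorem top_smul (x : M) : top • x = sq1 • sq2 • sq1 • sq2 • x := by
  simp only [top, mul_smul]

theorem Q_one_Q_one (x : M) : Q 1 • Q 1 • x = 0 := by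
  simp [Q_one_smul, sq1_sq1, sq2_sq2, sq2_sq1_sq2_sq1, char_two_add]

theorem Q_Q (k : Fin 2) (x : M) : Q k • Q k • x = 0 := by
  fin_cases k
  · exact sq1_sq1 x
  · exact Q_one_Q_one x

theorem Q_one_sq1 (x : M) : Q 1 • sq1 • x = sq1 • sq2 • sq1 • x := by
  simp [Q_one_smul, sq1_sq1]

theorem sq1_Q_one (x : M) : sq1 • Q 1 • x = sq1 • sq2 • sq1 • x := by
  simp [Q_one_smul, sq1_sq1]

theorem Q_one_sq1_sq2 (x : M) : Q 1 • sq1 • sq2 • x = top • x := by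
  simp [Q_one_smul, sq1_sq1, top_smul]

theorem sq1_top (x : M) : sq1 • top • x = 0 := by
  simp [top_smul, sq1_sq1]

theorem sq2_top (x : M) : sq2 • top • x = 0 := by
  simp [top_smul, sq1_sq1, sq2_sq2, sq2_sq1_sq2_sq1]

theorem top_sq1 (x : M) : top • sq1 • x = 0 := by
  simp [top_smul, sq1_sq1, sq2_sq1_sq2_sq1]

theorem top_sq2 (x : M) : top • sq2 • x = 0 := by
  simp [top_smul, sq1_sq1, sq2_sq2]

/-- A nonzero module over `A(1)` has nonzero invariants. -/
theorem exists_invariant {x : M} (hx : x ≠ 0) :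
    ∃ a : A1, a • x ≠ 0 ∧ sq1 • a • x = 0 ∧ sq2 • a • x = 0 := by
  by_contra! H
  -- Under the negated conclusion every word kills `x`, the longest first: `Sq^1` and `Sq^2` send
  -- each word to zero or to a word already dealt with.
  have h7 : sq1 • sq2 • sq1 • sq2 • x = 0 := by
    by_contra h
    exact H top (by rwa [top_smul]) (sq1_top x) (sq2_top x)
  have h6 : sq2 • sq1 • sq2 • x = 0 := by
    by_contra h
    refine H (sq2 * sq1 * sq2) (by simpa only [mul_smul]) ?_ ?_ <;>
      simp [mul_smul, sq1_sq1, sq2_sq2, h7]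
  have h5 : sq1 • sq2 • sq1 • x = 0 := by
    by_contra h
    refine H (sq1 * sq2 * sq1) (by simpa only [mul_smul]) ?_ ?_ <;>
      simp [mul_smul, sq1_sq1, sq2_sq1_sq2_sq1, h7]
  have h3 : sq1 • sq2 • x = 0 := by
    by_contra h
    refine H (sq1 * sq2) (by simpa only [mul_smul]) ?_ ?_ <;>
      simp [mul_smul, sq1_sq1, h6]
  have h4 : sq2 • sq1 • x = 0 := by
    by_contra h
    refine H (sq2 * sq1) (by simpa only [mul_smul]) ?_ ?_ <;>
      simp [mul_smul, sq1_sq1, sq2_sq2, h5]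
  have h2 : sq2 • x = 0 := by
    by_contra h
    exact H sq2 h h3 (by rw [sq2_sq2, h5])
  have h1 : sq1 • x = 0 := by
    by_contra h
    exact H sq1 h (sq1_sq1 x) h4
  exact H 1 (by rwa [one_smul]) (by rwa [one_smul]) (by rwa [one_smul])

/-- Nakayama's lemma for `A(1)`. -/
theorem eq_zero_of_forall_mem_augIdeal (H : ∀ x : M, ∃ a b : M, x = sq1 • a + sq2 • b) (x : M) :
    x = 0 := by
  -- The words annihilate the whole module, the longest first: multiplied on the right by `Sq^1` or
  -- `Sq^2`, a word becomes zero or one treated earlier.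
  have h7 (y : M) : sq1 • sq2 • sq1 • sq2 • y = 0 := by
    obtain ⟨a, b, rfl⟩ := H y
    simp [sq2_sq2, sq1_sq1, sq2_sq1_sq2_sq1]
  have h6 (y : M) : sq2 • sq1 • sq2 • y = 0 := by
    obtain ⟨a, b, rfl⟩ := H y
    simp [sq2_sq2, sq1_sq1, sq2_sq1_sq2_sq1, h7]
  have h5 (y : M) : sq1 • sq2 • sq1 • y = 0 := by
    obtain ⟨a, b, rfl⟩ := H y
    simp [sq1_sq1, h7]
  have h3 (y : M) : sq1 • sq2 • y = 0 := by
    obtain ⟨a, b, rfl⟩ := H y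
    simp [sq2_sq2, h5]
  have h4 (y : M) : sq2 • sq1 • y = 0 := by
    obtain ⟨a, b, rfl⟩ := H y
    simp [sq1_sq1, h6]
  have h2 (y : M) : sq2 • y = 0 := by
    obtain ⟨a, b, rfl⟩ := H y
    simp [sq2_sq2, h4]
  obtain ⟨a, b, rfl⟩ := H x
  obtain ⟨c, d, rfl⟩ := H a
  simp [sq1_sq1, h2]

variable {N : Type*} [AddCommGroup N] [Module A1 N]

variable [Module (ZMod 2) M] [Module (ZMod 2) N]

section
variable [IsScalarTower (ZMod 2) A1 M] [IsScalarTower (ZMod 2) A1 N]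

/-- An `𝔽₂`-linear map that commutes with `Sq^1` and `Sq^2` is `A(1)`-linear. -/
def toLinearMap (f : M →ₗ[ZMod 2] N) (h1 : ∀ x, f (sq1 • x) = sq1 • f x)
    (h2 : ∀ x, f (sq2 • x) = sq2 • f x) : M →ₗ[A1] N where
  toFun := f
  map_add' := map_add f
  map_smul' a := by
    induction a using A1.induction with
    | h1 => exact h1
    | h2 => exact h2
    | hc c => intro x; simp [algebraMap_smul]
    | hadd a b ha hb =>
      intro x
      simp only [RingHom.id_apply] at ha hb ⊢
      rw [add_smul, map_add, ha, hb, add_smul]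
    | hmul a b ha hb =>
      intro x
      simp only [RingHom.id_apply] at ha hb ⊢
      rw [mul_smul, ha, hb, mul_smul]

@[simp] theorem toLinearMap_apply (f : M →ₗ[ZMod 2] N) (h1 : ∀ x, f (sq1 • x) = sq1 • f x)
    (h2 : ∀ x, f (sq2 • x) = sq2 • f x) (x : M) : toLinearMap f h1 h2 x = f x := rfl

variable (M) in
/-- The action of an element of `A(1)`, as an `𝔽₂`-linear map. -/
noncomputable def lact (a : A1) : M →ₗ[ZMod 2] M := Algebra.lsmul (ZMod 2) (ZMod 2) M a

@[simp] theorem lact_apply (a : A1) (x : M) : lact M a x = a • x := rfl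

/-- The `A(1)`-linear map obtained from an `𝔽₂`-linear map by means of the Casimir element of the
symmetric algebra `A(1)`. -/
noncomputable def casimir (l : M →ₗ[ZMod 2] N) : M →ₗ[A1] N :=
  toLinearMap
    -- The sum of `b ∘ l ∘ b'` over the words `b` and their dual basis `b'` for the pairing
    -- "coefficient of `top` in `b b'`"; the dual of a word is again a word.
    (l ∘ₗ lact M (sq1 * sq2 * sq1 * sq2) + lact N sq1 ∘ₗ l ∘ₗ lact M (sq2 * sq1 * sq2)
      + lact N sq2 ∘ₗ l ∘ₗ lact M (sq1 * sq2 * sq1) + lact N (sq1 * sq2) ∘ₗ l ∘ₗ lact M (sq1 * sq2)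
      + lact N (sq2 * sq1) ∘ₗ l ∘ₗ lact M (sq2 * sq1) + lact N (sq1 * sq2 * sq1) ∘ₗ l ∘ₗ lact M sq2
      + lact N (sq2 * sq1 * sq2) ∘ₗ l ∘ₗ lact M sq1 + lact N (sq1 * sq2 * sq1 * sq2) ∘ₗ l)
    (fun x => by
      simp [mul_smul, sq1_sq1, sq2_sq1_sq2_sq1])
    (fun x => by
      simp [mul_smul, sq1_sq1, sq2_sq2, sq2_sq1_sq2_sq1])

theorem casimir_apply (l : M →ₗ[ZMod 2] N) (x : M) :
    casimir l x = l (sq1 • sq2 • sq1 • sq2 • x) + sq1 • l (sq2 • sq1 • sq2 • x)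
      + sq2 • l (sq1 • sq2 • sq1 • x) + sq1 • sq2 • l (sq1 • sq2 • x)
      + sq2 • sq1 • l (sq2 • sq1 • x) + sq1 • sq2 • sq1 • l (sq2 • x)
      + sq2 • sq1 • sq2 • l (sq1 • x) + sq1 • sq2 • sq1 • sq2 • l x := by
  simp [casimir, mul_smul]

end

end modules

/-! ### Coefficients in the word basis, and the socle of `A(1)`. -/

theorem coef_sq1_mul_eq (b : A1) : coef (sq1 * b) 1 = coef b 0 ∧ coef (sq1 * b) 3 = coef b 2 ∧
    coef (sq1 * b) 5 = coef b 4 ∧ coef (sq1 * b) 7 = coef b 6 ∧ coef (sq1 * b) 0 = 0 ∧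
    coef (sq1 * b) 2 = 0 ∧ coef (sq1 * b) 4 = 0 ∧ coef (sq1 * b) 6 = 0 := by
  simp only [coef_sq1_mul, Fin.sum_univ_eight]
  simp [Steenrod.repSq, Prod.ext_iff]

theorem coef_sq2_mul_eq (b : A1) : coef (sq2 * b) 2 = coef b 0 ∧ coef (sq2 * b) 4 = coef b 1 ∧
    coef (sq2 * b) 5 = coef b 2 ∧ coef (sq2 * b) 6 = coef b 3 ∧ coef (sq2 * b) 7 = coef b 5 ∧
    coef (sq2 * b) 0 = 0 ∧ coef (sq2 * b) 1 = 0 ∧ coef (sq2 * b) 3 = 0 := by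
  simp only [coef_sq2_mul, Fin.sum_univ_eight]
  simp [Steenrod.repSq, Prod.ext_iff]

theorem coef_ext {a b : A1} (h : ∀ i, coef a i = coef b i) : a = b := by
  rw [eq_sum_word a, eq_sum_word b]
  simp only [h]

theorem coef_zero (i : Fin 8) : coef 0 i = 0 := by simp [coef]

theorem coef_top (i : Fin 8) : coef top i = if i = 7 then 1 else 0 := by
  have := coef_word 7 i
  rw [show Steenrod.word sq1 sq2 7 = top from rfl] at this
  rw [this]
  simp only [eq_comm]

/-- The invariants of `A(1)`. -/
theorem eq_smul_top {b : A1} (h1 : sq1 * b = 0) (h2 : sq2 * b = 0) : b = coef b 7 • top := by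
  obtain ⟨a0, a2, a4, a6, -⟩ := coef_sq1_mul_eq b
  obtain ⟨b0, b1, b2, b3, b5, -⟩ := coef_sq2_mul_eq b
  rw [h1, coef_zero] at a0 a2 a4 a6
  rw [h2, coef_zero] at b0 b1 b2 b3 b5
  refine coef_ext fun i => ?_
  rw [coef_smul, coef_top]
  fin_cases i <;> simp [← a0, ← b1, ← a2, ← a4, ← a6, ← b3, ← b5]

theorem top_ne_zero : top ≠ 0 := by
  intro h
  have := coef_top 7
  rw [h, coef_zero] at this
  simp at this

theorem counit_sq1 : counit sq1 = 0 := lift_sq1 _ _ _ _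
theorem counit_sq2 : counit sq2 = 0 := lift_sq2 _ _ _ _

theorem counit_sq1_mul (a : A1) : counit (sq1 * a) = 0 := by rw [map_mul, counit_sq1, zero_mul]
theorem counit_sq2_mul (a : A1) : counit (sq2 * a) = 0 := by rw [map_mul, counit_sq2, zero_mul]

/-- `Sq^1` and `Sq^2` kill `top`, so `A(1)` acts on the line it spans through the augmentation. -/
theorem mul_top (a : A1) : a * top = counit a • top := by
  induction a using A1.induction with
  | h1 => rw [counit_sq1, zero_smul]; simpa using sq1_top (M := A1) 1
  | h2 => rw [counit_sq2, zero_smul]; simpa using sq2_top (M := A1) 1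
  | hc c => rw [AlgHom.commutes, Algebra.algebraMap_eq_smul_one, smul_mul_assoc, one_mul]; rfl
  | hadd a b ha hb => rw [add_mul, ha, hb, map_add, add_smul]
  | hmul a b ha hb => rw [mul_assoc, hb, mul_smul_comm, ha, smul_smul, map_mul, mul_comm]

end A1

namespace GMod

open A1

/-! ### Components of homomorphisms -/

variable {M N K : GMod.{u}}

@[simp] theorem Hom.comp_apply {M : GMod.{u}} {N : GMod.{v}} {K : GMod.{w}} (g : Hom N K)
    (f : Hom M N) (x : M) : (g.comp f).1 x = g.1 (f.1 x) := rfl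

@[simp] theorem Hom.id_apply (M : GMod.{u}) (x : M) : (Hom.id M).1 x = x := rfl

theorem Hom.ext' {M : GMod.{u}} {N : GMod.{v}} {f g : Hom M N} (h : ∀ x, f.1 x = g.1 x) : f = g :=
  Subtype.ext (LinearMap.ext h)

theorem Hom.congr {M : GMod.{u}} {N : GMod.{v}} {f g : Hom M N} (h : f = g) (x : M) :
    f.1 x = g.1 x := by rw [h]

@[simp] theorem Hom.sub_apply {M : GMod.{u}} {N : GMod.{v}} (f g : Hom M N) (x : M) :
    (f - g).1 x = f.1 x - g.1 x := rfl

@[simp] theorem Hom.map_zmod_smul {M : GMod.{u}} {N : GMod.{v}} (f : M →ₗ[A1] N) (c : ZMod 2)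
    (x : M) : f (c • x) = c • f x := (f.restrictScalars (ZMod 2)).map_smul c x

/-- A homomorphism from an `𝔽₂`-linear map that commutes with `Sq^1` and `Sq^2`. -/
noncomputable def Hom.mk' {M : GMod.{u}} {N : GMod.{v}} (f : M →ₗ[ZMod 2] N)
    (h1 : ∀ x, f (sq1 • x) = sq1 • f x) (h2 : ∀ x, f (sq2 • x) = sq2 • f x)
    (hd : ∀ n x, x ∈ M.deg n → f x ∈ N.deg n) : Hom M N :=
  ⟨toLinearMap f h1 h2, hd⟩

theorem map_proj_of_shift {M : GMod.{u}} {N : GMod.{v}} (f : M →ₗ[ZMod 2] N) (k : ℤ)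
    (hf : ∀ n x, x ∈ M.deg n → f x ∈ N.deg (n + k)) (n : ℤ) (x : M) :
    f (M.proj n x) = N.proj (n + k) (f x) := by
  induction x using M.induction with
  | h0 => simp
  | hdeg m x hx =>
    rw [M.proj_of_mem n hx, N.proj_of_mem (n + k) (hf m x hx)]
    by_cases h : m = n <;> simp [h]
  | hadd x y hx hy => simp [hx, hy]

theorem Hom.map_proj {M : GMod.{u}} {N : GMod.{v}} (f : Hom M N) (n : ℤ) (x : M) :
    f.1 (M.proj n x) = N.proj n (f.1 x) := by
  have := map_proj_of_shift (f.1.restrictScalars (ZMod 2)) 0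
    (fun n x hx => by rw [add_zero]; exact f.2 n x hx) n x
  rwa [add_zero] at this

theorem proj_self {M : GMod.{u}} {n : ℤ} {x : M} (hx : x ∈ M.deg n) : M.proj n x = x := by
  rw [M.proj_of_mem n hx, if_pos rfl]

theorem mem_deg_of_proj {M : GMod.{u}} {n : ℤ} {x : M} (hx : M.proj n x = x) : x ∈ M.deg n :=
  hx ▸ M.proj_mem n x

theorem mem_deg_cast {M : GMod.{u}} {m n : ℤ} {x : M} (hx : x ∈ M.deg m) (h : m = n) :
    x ∈ M.deg n := h ▸ hx

theorem sq1_proj (M : GMod.{u}) (n : ℤ) (x : M) :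
    sq1 • M.proj n x = M.proj (n + 1) (sq1 • x) :=
  map_proj_of_shift (lact M sq1) 1 (fun _ _ hx => M.sq1_mem hx) n x

theorem sq2_proj (M : GMod.{u}) (n : ℤ) (x : M) :
    sq2 • M.proj n x = M.proj (n + 2) (sq2 • x) :=
  map_proj_of_shift (lact M sq2) 2 (fun _ _ hx => M.sq2_mem hx) n x

/-- The degree of `Q_k`. -/
def Qdeg : Fin 2 → ℤ := ![1, 3]

theorem Q_mem (M : GMod.{u}) (k : Fin 2) {n : ℤ} {x : M} (hx : x ∈ M.deg n) :
    Q k • x ∈ M.deg (n + Qdeg k) := by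
  fin_cases k
  · exact M.sq1_mem hx
  · change Q 1 • x ∈ M.deg (n + 3)
    rw [Q_one_smul]
    exact Submodule.add_mem _ (mem_deg_cast (M.sq2_mem (M.sq1_mem hx)) (by ring))
      (mem_deg_cast (M.sq1_mem (M.sq2_mem hx)) (by ring))

theorem Q_proj (M : GMod.{u}) (k : Fin 2) (n : ℤ) (x : M) :
    Q k • M.proj n x = M.proj (n + Qdeg k) (Q k • x) :=
  map_proj_of_shift (lact M (Q k)) (Qdeg k) (fun _ _ hx => M.Q_mem k hx) n x

theorem Q_one_mem (M : GMod.{u}) {n : ℤ} {x : M} (hx : x ∈ M.deg n) :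
    Q 1 • x ∈ M.deg (n + 3) := M.Q_mem 1 hx

theorem top_mem (M : GMod.{u}) {n : ℤ} {x : M} (hx : x ∈ M.deg n) :
    top • x ∈ M.deg (n + 6) := by
  rw [top_smul]
  exact mem_deg_cast (M.sq1_mem (M.sq2_mem (M.sq1_mem (M.sq2_mem hx)))) (by ring)

/-- The part of degree `0` of a linear map. -/
theorem exists_degreeZero {M : GMod.{u}} {N : GMod.{v}} (h : M →ₗ[ZMod 2] N) :
    ∃ k : M →ₗ[ZMod 2] N, ∀ n x, x ∈ M.deg n → k x = N.proj n (h x) := by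
  let e := LinearEquiv.ofBijective (DirectSum.coeLinearMap M.deg) M.isInternal
  refine ⟨DirectSum.toModule (ZMod 2) ℤ N
    (fun n => N.proj n ∘ₗ h ∘ₗ (M.deg n).subtype) ∘ₗ e.symm.toLinearMap, fun n x hx => ?_⟩
  have : e.symm x = DirectSum.lof (ZMod 2) ℤ (fun n => M.deg n) n ⟨x, hx⟩ := by
    rw [LinearEquiv.symm_apply_eq]
    exact (DirectSum.coeLinearMap_lof M.deg n ⟨x, hx⟩).symm
  simp [this]

/-- The degree-zero part remains `A(1)`-linear because `Sq^1` and `Sq^2` merely shift the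
projections. In this way ungraded liftings and retractions yield graded ones. -/
theorem exists_hom_degreeZero {M : GMod.{u}} {N : GMod.{v}} (h : M →ₗ[A1] N) :
    ∃ k : Hom M N, ∀ n x, x ∈ M.deg n → k.1 x = N.proj n (h x) := by
  obtain ⟨k, hk⟩ := exists_degreeZero (h.restrictScalars (ZMod 2))
  refine ⟨Hom.mk' k ?_ ?_ ?_, hk⟩
  · intro x
    induction x using M.induction with
    | h0 => simp
    | hdeg n x hx =>
      rw [hk _ _ hx, hk _ _ (M.sq1_mem hx), sq1_proj]
      simp
    | hadd x y hx hy => simp only [smul_add, map_add, hx, hy]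
  · intro x
    induction x using M.induction with
    | h0 => simp
    | hdeg n x hx =>
      rw [hk _ _ hx, hk _ _ (M.sq2_mem hx), sq2_proj]
      simp
    | hadd x y hx hy => simp only [smul_add, map_add, hx, hy]
  · intro n x hx
    rw [hk n x hx]
    exact N.proj_mem _ _

theorem Hom.ext_deg {M : GMod.{u}} {N : GMod.{v}} {f g : Hom M N}
    (h : ∀ n x, x ∈ M.deg n → f.1 x = g.1 x) : f = g := by
  refine Hom.ext' fun x => ?_
  induction x using M.induction with
  | h0 => simp
  | hdeg n x hx => exact h n x hx
  | hadd x y hx hy => rw [map_add, map_add, hx, hy]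

/-- A module that is projective as an ungraded module is projective as a graded module. -/
theorem isProjective_of_projective (P : GMod.{u}) [Module.Projective A1 P] : IsProjective P := by
  intro X Y g f hg
  obtain ⟨h, hh⟩ := Module.projective_lifting_property g.1 f.1 hg
  obtain ⟨k, hk⟩ := exists_hom_degreeZero h
  refine ⟨k, Hom.ext_deg fun n x hx => ?_⟩
  rw [Hom.comp_apply, hk n x hx, Hom.map_proj]
  have : g.1 (h x) = f.1 x := DFunLike.congr_fun hh x
  rw [this, proj_self (f.2 n x hx)]

theorem IsFree.isProjective {F : GMod.{u}} (hF : IsFree F) : IsProjective F := by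
  obtain ⟨ι, b, -⟩ := hF
  have := Module.Projective.of_basis b
  exact isProjective_of_projective F

/-! ### Direct summands -/

theorem Iso.symm {M : GMod.{u}} {N : GMod.{v}} (h : Iso M N) : Iso N M := by
  obtain ⟨f, g, h1, h2⟩ := h
  exact ⟨g, f, h2, h1⟩

theorem Iso.trans {M : GMod.{u}} {N : GMod.{v}} {K : GMod.{w}} (h : Iso M N) (h' : Iso N K) :
    Iso M K := by
  obtain ⟨f, g, h1, h2⟩ := h
  obtain ⟨f', g', h1', h2'⟩ := h'
  refine ⟨f'.comp f, g.comp g', Hom.ext' fun x => ?_, Hom.ext' fun x => ?_⟩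
  · have a := Hom.congr h1' (f.1 x)
    have b := Hom.congr h1 x
    simp only [Hom.comp_apply, Hom.id_apply] at *
    rw [a, b]
  · have a := Hom.congr h2' x
    have b := Hom.congr h2 (g'.1 x)
    simp only [Hom.comp_apply, Hom.id_apply] at *
    rw [b, a]

theorem Iso.stableIso {M N : GMod.{u}} (h : Iso M N) : StableIso M N := by
  obtain ⟨f, g, h1, h2⟩ := h
  refine ⟨f, g, ?_, ?_⟩
  · rw [h1, sub_self]; exact Hom.isNull_zero _ _
  · rw [h2, sub_self]; exact Hom.isNull_zero _ _

/-- The kernel of a homomorphism as a graded module. -/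
noncomputable def ker {M : GMod.{u}} {N : GMod.{v}} (f : Hom M N) : GMod.{u} :=
  M.sub (LinearMap.ker f.1) (fun x hx n => by
    rw [LinearMap.mem_ker] at hx ⊢
    rw [Hom.map_proj, hx, map_zero])

/-- A retract is a direct summand. -/
theorem iso_prod_ker {F M : GMod.{u}} (i : Hom F M) (r : Hom M F) (h : r.comp i = Hom.id F) :
    Iso M (F.prod (ker r)) := by
  have hri (x : F) : r.1 (i.1 x) = x := Hom.congr h x
  let p : M →ₗ[A1] M := LinearMap.id - i.1 ∘ₗ r.1
  have hp (x : M) : p x ∈ LinearMap.ker r.1 := by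
    rw [LinearMap.mem_ker]
    change r.1 (x - i.1 (r.1 x)) = 0
    rw [map_sub, hri, sub_self]
  refine ⟨⟨LinearMap.prod r.1 (p.codRestrict _ hp), fun n x hx => ⟨r.2 n x hx, ?_⟩⟩,
    ⟨LinearMap.coprod i.1 (LinearMap.ker r.1).subtype, fun n x hx =>
      Submodule.add_mem _ (i.2 n _ hx.1) hx.2⟩, Hom.ext' fun x => ?_, Hom.ext' fun x => ?_⟩
  · exact Submodule.sub_mem _ hx (i.2 n _ (r.2 n x hx))
  · change i.1 (r.1 x) + (x - i.1 (r.1 x)) = x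
    abel
  · obtain ⟨x, y⟩ := x
    obtain ⟨y, hy⟩ := y
    have hy : r.1 y = 0 := hy
    refine Prod.ext ?_ (Subtype.ext ?_)
    · change r.1 (i.1 x + y) = x
      rw [map_add, hri, hy, add_zero]
    · change (i.1 x + y) - i.1 (r.1 (i.1 x + y)) = y
      rw [map_add, hri, hy, add_zero]
      abel

/-- On `F ⊕ N`, projecting to `N` and including back differs from the identity by a map through the
projective summand `F`. -/
theorem stableIso_of_iso_prod {F N M : GMod.{u}} (hF : IsProjective F) (h : Iso M (F.prod N)) :
    StableIso M N := by
  refine h.stableIso.trans ?_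
  let i : Hom N (F.prod N) := ⟨LinearMap.inr A1 F N, fun n x hx => ⟨Submodule.zero_mem _, hx⟩⟩
  let r : Hom (F.prod N) N := ⟨LinearMap.snd A1 F N, fun n x hx => hx.2⟩
  let i' : Hom F (F.prod N) := ⟨LinearMap.inl A1 F N, fun n x hx => ⟨hx, Submodule.zero_mem _⟩⟩
  let r' : Hom (F.prod N) F := ⟨LinearMap.fst A1 F N, fun n x hx => hx.1⟩
  refine ⟨r, i, ⟨F, r', 0 - i', hF, Hom.ext' fun x => ?_⟩, ?_⟩
  · obtain ⟨x, y⟩ := x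
    change ((0, y) - (x, y) : F × N) = (0, 0) - (x, 0)
    ext <;> simp
  · have : r.comp i - Hom.id N = 0 := by
      refine Hom.ext' fun x => ?_
      change x - x = 0
      rw [sub_self]
    rw [this]
    exact Hom.isNull_zero _ _

/-! ### Free summands -/

section free

/-- A nonzero relation, regarded as a vector of coefficients, has a multiple that is nonzero and
invariant. The entries of that multiple are scalars times `top`, so it is a nontrivial `𝔽₂`-relation
between the `top • m i`. -/
theorem top_smul_finsupp_eq_zero {ι : Type*} {M : Type*} [AddCommGroup M] [Module A1 M]
    [Module (ZMod 2) M] [IsScalarTower (ZMod 2) A1 M] {m : ι → M}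
    (hm : LinearIndependent (ZMod 2) fun i => top • m i) : LinearIndependent A1 m := by
  rw [linearIndependent_iff]
  intro c hc
  by_contra hne
  obtain ⟨a, ha, h1, h2⟩ := exists_invariant hne
  have hcoef (i : ι) : (a • c) i = coef ((a • c) i) 7 • top :=
    eq_smul_top (by simpa using DFunLike.congr_fun h1 i) (by simpa using DFunLike.congr_fun h2 i)
  have h0 : Finsupp.linearCombination A1 m (a • c) = 0 := by rw [map_smul, hc, smul_zero]
  have hlin : Finsupp.linearCombination (ZMod 2) (fun i => top • m i)
      ((a • c).mapRange (fun b => coef b 7) (coef_zero 7)) = 0 := by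
    rw [← h0, Finsupp.linearCombination_apply, Finsupp.linearCombination_apply,
      Finsupp.sum_mapRange_index (by simp)]
    refine Finset.sum_congr rfl fun i _ => ?_
    change _ = (a • c) i • m i
    conv_rhs => rw [hcoef i, smul_assoc]
  have h3 := (linearIndependent_iff.1 hm) _ hlin
  refine ha (Finsupp.ext fun i => ?_)
  have h4 := DFunLike.congr_fun h3 i
  rw [Finsupp.mapRange_apply, Finsupp.zero_apply] at h4
  rw [hcoef i, h4, zero_smul, Finsupp.zero_apply]

theorem proj_smul_mem {M : GMod.{u}} (S : Submodule A1 M) {x : M} (hx : ∀ n, M.proj n x ∈ S)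
    (a : A1) (n : ℤ) : M.proj n (a • x) ∈ S := by
  induction a using A1.induction generalizing x n with
  | h1 =>
    have := S.smul_mem sq1 (hx (n - 1))
    rwa [sq1_proj, sub_add_cancel] at this
  | h2 =>
    have := S.smul_mem sq2 (hx (n - 2))
    rwa [sq2_proj, sub_add_cancel] at this
  | hc c =>
    have := S.smul_mem (algebraMap (ZMod 2) A1 c) (hx n)
    rwa [algebraMap_smul, ← map_smul, ← algebraMap_smul A1] at this
  | hadd a b ha hb => rw [add_smul, map_add]; exact S.add_mem (ha hx n) (hb hx n)
  | hmul a b ha hb => rw [mul_smul]; exact ha (hb hx) n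

theorem isHomogeneous_span {M : GMod.{u}} {ι : Type*} (m : ι → M) (d : ι → ℤ)
    (hm : ∀ i, m i ∈ M.deg (d i)) : M.IsHomogeneous (Submodule.span A1 (Set.range m)) := by
  intro x hx
  induction hx using Submodule.span_induction with
  | mem x hx =>
    obtain ⟨b, rfl⟩ := hx
    intro n
    rw [M.proj_of_mem n (hm b)]
    split_ifs
    · exact Submodule.subset_span ⟨b, rfl⟩
    · exact Submodule.zero_mem _
  | zero => intro n; rw [map_zero]; exact Submodule.zero_mem _
  | add x y _ _ hx hy => intro n; rw [map_add]; exact Submodule.add_mem _ (hx n) (hy n)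
  | smul a x _ hx => exact proj_smul_mem _ hx a

/-- The coefficient of `top`. -/
noncomputable def coefTop : A1 →ₗ[ZMod 2] ZMod 2 where
  toFun a := coef a 7
  map_add' a b := coef_add a b 7
  map_smul' c a := coef_smul c a 7

theorem coefTop_word (i : Fin 8) :
    coefTop (Steenrod.word sq1 sq2 i) = if i = 7 then 1 else 0 := coef_word i 7

/-- Free modules are injective (in the ungraded sense). -/
theorem exists_retraction_of_basis {M : Type*} [AddCommGroup M] [Module A1 M] [Module (ZMod 2) M]
    [IsScalarTower (ZMod 2) A1 M] {S : Type*} [AddCommGroup S] [Module A1 S] [Module (ZMod 2) S]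
    [IsScalarTower (ZMod 2) A1 S] {ι : Type*} (b : Module.Basis ι A1 S) (i : S →ₗ[A1] M)
    (hi : Function.Injective i) : ∃ r : M →ₗ[A1] S, ∀ x, r (i x) = x := by
  obtain ⟨ρ, hρ⟩ := (i.restrictScalars (ZMod 2)).exists_leftInverse_of_injective
    (LinearMap.ker_eq_bot.2 hi)
  have hρ (x : S) : ρ (i x) = x := DFunLike.congr_fun hρ x
  -- `θ` takes the coefficient of `top` in each coordinate. On a basis element only the Casimir term
  -- in which `top` is applied before `l` survives, and it returns that element.
  let θ : S →ₗ[ZMod 2] S := Finsupp.linearCombination (ZMod 2) b ∘ₗ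
    Finsupp.mapRange.linearMap coefTop ∘ₗ (b.repr.restrictScalars (ZMod 2)).toLinearMap
  have hθ (k : Fin 8) (j : ι) :
      θ (Steenrod.word sq1 sq2 k • b j) = if k = 7 then b j else 0 := by
    simp [θ, coefTop_word]
  let l : M →ₗ[ZMod 2] S := θ ∘ₗ ρ
  have hl (x : S) : l (i x) = θ x := congrArg θ (hρ x)
  refine ⟨casimir l, fun x => ?_⟩
  have : casimir l ∘ₗ i = LinearMap.id := by
    refine b.ext fun j => ?_
    have h0 := hθ 0 j
    have h1 := hθ 1 j
    have h2 := hθ 2 j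
    have h3 := hθ 3 j
    have h4 := hθ 4 j
    have h5 := hθ 5 j
    have h6 := hθ 6 j
    have h7 := hθ 7 j
    simp [Steenrod.word, mul_smul] at h0 h1 h2 h3 h4 h5 h6 h7
    simp only [LinearMap.comp_apply, LinearMap.id_apply, casimir_apply, ← map_smul i, hl, h0, h1,
      h2, h3, h4, h5, h6, h7, smul_zero, add_zero]
  exact DFunLike.congr_fun this x

/-- The maximal free summand: homogeneous elements `m i` such that the `top • m i` form a basis of
`top • M` generate a free direct summand. -/
theorem exists_maximal_free (M : GMod.{u}) : ∃ (F : GMod.{u}) (i : Hom F M) (r : Hom M F),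
    IsFree F ∧ r.comp i = Hom.id F ∧ ∀ x : M, r.1 x = 0 → top • x = 0 := by
  classical
  -- The spanning set of `top • M` is restricted to homogeneous `x`, so that the chosen lifts `m b`
  -- of a basis are homogeneous.
  let S : Set M := {y | ∃ n, ∃ x ∈ M.deg n, y = top • x}
  obtain ⟨B, hBS, hspan, hB⟩ := exists_linearIndependent (ZMod 2) S
  choose d m hmd hm using fun b : B => hBS b.2
  have hm' : LinearIndependent (ZMod 2) fun b => top • m b := by
    have : (fun b : B => top • m b) = Subtype.val := funext fun b => (hm b).symm
    rwa [this]
  have hli := top_smul_finsupp_eq_zero hm'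
  let F := M.sub _ (isHomogeneous_span m d hmd)
  let b : Module.Basis B A1 F := Module.Basis.span hli
  have hb (j : B) : ((b j).1 : M) = m j :=
    congrArg Subtype.val (Module.Basis.span_apply hli j)
  let i : Hom F M := ⟨(Submodule.span A1 (Set.range m)).subtype, fun n x hx => hx⟩
  obtain ⟨r0, hr0⟩ := exists_retraction_of_basis b i.1 Subtype.val_injective
  obtain ⟨r, hr⟩ := exists_hom_degreeZero r0
  have hri : r.comp i = Hom.id F := by
    refine Hom.ext_deg fun n x hx => ?_
    rw [Hom.comp_apply, hr n _ (i.2 n x hx), hr0]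
    exact proj_self hx
  refine ⟨F, i, r, ⟨B, b, fun j => ⟨d j, ?_⟩⟩, hri, fun x hx => ?_⟩
  · change ((b j).1 : M) ∈ M.deg (d j)
    rw [hb]
    exact hmd j
  -- All of `top • M` lies in `F`, where `i ∘ r` is the identity; hence `top • x = i (top • r x)`,
  -- which vanishes if `r x = 0`.
  · have hmem : ∀ x : M, top • x ∈ Submodule.span (ZMod 2) S := fun x => by
      induction x using M.induction with
      | h0 => rw [smul_zero]; exact Submodule.zero_mem _
      | hdeg n x hx => exact Submodule.subset_span ⟨n, x, hx, rfl⟩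
      | hadd x y hx hy => rw [smul_add]; exact Submodule.add_mem _ hx hy
    have hfix : ∀ y ∈ Submodule.span (ZMod 2) S, i.1 (r.1 y) = y := by
      rw [← hspan]
      intro y hy
      induction hy using Submodule.span_induction with
      | mem y hy =>
        have : y = i.1 (top • b ⟨y, hy⟩) := by
          rw [map_smul]
          refine (hm ⟨y, hy⟩).trans ?_
          rw [← hb]
          rfl
        rw [this]
        exact congrArg i.1 (Hom.congr hri _)
      | zero => simp
      | add x y _ _ hx hy => rw [map_add, map_add, hx, hy]
      | smul c x _ hx => simp only [Hom.map_zmod_smul, hx]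
    rw [← hfix _ (hmem x), map_smul, hx, smul_zero, map_zero]

end free

/-! ### Reduced parts -/

/-- A basis element of a free summand would not be killed by `top`. -/
theorem isReduced_of_top_smul {N : GMod.{u}} (h : ∀ x : N, top • x = 0) : IsReduced N := by
  rintro F K ⟨ι, b, -⟩ ⟨f, g, -, h2⟩
  have hF (x : F) : top • x = 0 := by
    have h3 := Hom.congr h2 ((x, 0) : F × K)
    have h4 : top • ((x, 0) : F × K) = 0 := by
      rw [← (show f.1 (g.1 ((x, 0) : F × K)) = ((x, 0) : F × K) from h3)]
      refine (map_smul f.1 top _).symm.trans ?_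
      rw [h, map_zero]
      rfl
    exact congrArg Prod.fst h4
  have hι : IsEmpty ι := ⟨fun j => by
    have h5 := congrArg (fun y => b.repr y j) (hF (b j))
    simp [top_ne_zero] at h5⟩
  exact b.repr.toEquiv.subsingleton

theorem exists_isReducedPart (M : GMod.{u}) : ∃ N : GMod.{u}, IsReducedPart N M := by
  obtain ⟨F, i, r, hF, hri, h⟩ := exists_maximal_free M
  exact ⟨ker r, isReduced_of_top_smul fun x => Subtype.ext (h x.1 x.2), F, hF,
    iso_prod_ker i r hri⟩

theorem IsReducedPart.stableIso {N M : GMod.{u}} (h : IsReducedPart N M) : StableIso M N := by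
  obtain ⟨-, F, hF, h⟩ := h
  exact stableIso_of_iso_prod hF.isProjective h

/-! ### A criterion for freeness -/

/-- Freeness over the exterior algebra on `Q_0` and `Q_1`, in terms of elements. -/
def FreeCond (M : Type*) [AddCommGroup M] [Module A1 M] : Prop :=
  ∀ x : M, Q 0 • Q 1 • x = 0 → ∃ a b : M, x = Q 0 • a + Q 1 • b

/-- This is the passage from the exterior algebra to `A(1)`. Since `Q_0 Q_1 Sq^2 = top`, the
hypothesis on `M` applies to `Sq^2 x`. Correcting `x` by elements of the form `Sq^1 b` and `Sq^2 d`,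
which is harmless for the conclusion, achieves `Sq^2 x = 0`. Then `Q_0 Q_1 x = Sq^2 Sq^2 x = 0`, and
the hypothesis applies to the corrected `x` itself. -/
theorem FreeCond.exists_of_top_smul {M : Type*} [AddCommGroup M] [Module A1 M] (hM : FreeCond M)
    {x : M} (hx : top • x = 0) : ∃ a b : M, x = sq1 • a + sq2 • b := by
  simp only [FreeCond, Q_one_smul, Q_zero_smul] at hM
  rw [top_smul] at hx
  obtain ⟨a, b, h1⟩ := hM (sq2 • x) (by simp [sq1_sq1, hx])
  have h2 : sq2 • (x + sq1 • b) = sq1 • (a + sq2 • b) := by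
    rw [smul_add, h1]
    simp [add_comm, add_left_comm, char_two_add]
  obtain ⟨y, hy⟩ : ∃ y, y = x + sq1 • b := ⟨_, rfl⟩
  obtain ⟨p, hp⟩ : ∃ p, p = a + sq2 • b := ⟨_, rfl⟩
  rw [← hy, ← hp] at h2
  -- This is `Q_0 Q_1 p`. Writing `p = Q_0 c + Q_1 d` turns `Sq^1 p` into `Sq^2 Sq^2 d`, which the
  -- correction of `y` by `Sq^2 d` removes.
  have h3 : sq1 • sq2 • sq1 • p = 0 := by
    rw [← h2, sq2_sq2]; simp [sq1_sq1]
  obtain ⟨c, d, h4⟩ := hM p (by simp [sq1_sq1, h3])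
  have h5 : sq2 • (y + sq2 • d) = 0 := by
    rw [smul_add, h2, h4]
    simp [sq1_sq1, sq2_sq2, char_two_add]
  obtain ⟨e, f, h6⟩ := hM (y + sq2 • d) (by
    rw [smul_add, sq1_sq1, add_zero, ← sq2_sq2, h5, smul_zero])
  refine ⟨e + sq2 • f + b, sq1 • f + d, ?_⟩
  have h7 : x = (y + sq2 • d) + sq1 • b + sq2 • d := by
    rw [hy]
    simp [add_assoc, add_left_comm, char_two_add]
  rw [h7, h6]
  simp [add_comm, add_left_comm, add_assoc]

/-- The complement of a maximal free summand is killed by `top`, so each of its elements is `Sq^1 a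
+ Sq^2 b`; projecting `a` and `b` to the complement, Nakayama's lemma shows that it is zero. -/
theorem FreeCond.isFree {M : GMod.{u}} (hM : FreeCond M) : IsFree M := by
  obtain ⟨F, i, r, ⟨ι, b, hb⟩, hri, h⟩ := exists_maximal_free M
  have hri (x : F) : r.1 (i.1 x) = x := Hom.congr hri x
  have h0 (x : ker r) : x = 0 := by
    refine eq_zero_of_forall_mem_augIdeal (fun x => ?_) x
    obtain ⟨a, b, hab⟩ := hM.exists_of_top_smul (h x.1 x.2)
    have hp (y : M) : y - i.1 (r.1 y) ∈ LinearMap.ker r.1 := by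
      rw [LinearMap.mem_ker, map_sub, hri, sub_self]
    refine ⟨⟨a - i.1 (r.1 a), hp a⟩, ⟨b - i.1 (r.1 b), hp b⟩, Subtype.ext ?_⟩
    change x.1 = sq1 • (a - i.1 (r.1 a)) + sq2 • (b - i.1 (r.1 b))
    have h3 : i.1 (r.1 (sq1 • a + sq2 • b)) = 0 := by
      rw [← hab, show r.1 x.1 = 0 from x.2, map_zero]
    rw [map_add, map_add, map_smul, map_smul, map_smul, map_smul] at h3
    rw [smul_sub, smul_sub, sub_add_sub_comm, h3, sub_zero, hab]
  have hinj : Function.Injective r.1 := by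
    rw [injective_iff_map_eq_zero]
    intro x hx
    exact congrArg Subtype.val (h0 ⟨x, hx⟩)
  let e : F ≃ₗ[A1] M := LinearEquiv.ofBijective i.1
    ⟨Function.LeftInverse.injective hri, fun y => ⟨r.1 y, hinj (hri _)⟩⟩
  refine ⟨ι, b.map e, fun j => ?_⟩
  obtain ⟨n, hn⟩ := hb j
  exact ⟨n, by rw [Module.Basis.map_apply]; exact i.2 n _ hn⟩

/-! ### Tensor products -/

section tensor

variable (M : GMod.{u}) (N : GMod.{v})

/-- The bilinear map `M × N → M ⊗ N`. -/
noncomputable def tm : M →ₗ[ZMod 2] N →ₗ[ZMod 2] (M.tensor N) :=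
  TensorProduct.mk (ZMod 2) M N

variable {M N}

theorem sq1_tm (x : M) (y : N) :
    sq1 • tm M N x y = tm M N (sq1 • x) y + tm M N x (sq1 • y) :=
  tensorAct_sq1 M N x y

theorem sq2_tm (x : M) (y : N) :
    sq2 • tm M N x y
      = tm M N (sq2 • x) y + tm M N (sq1 • x) (sq1 • y) + tm M N x (sq2 • y) :=
  tensorAct_sq2 M N x y

/-- `Q_1` is primitive: the cross terms coming from the coproduct of `Sq^2` occur twice in the
commutator and cancel. -/
theorem Q_tm (k : Fin 2) (x : M) (y : N) :
    Q k • tm M N x y = tm M N (Q k • x) y + tm M N x (Q k • y) := by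
  fin_cases k
  · exact sq1_tm x y
  · change Q 1 • _ = tm M N (Q 1 • x) y + tm M N x (Q 1 • y)
    simp only [Q_one_smul, sq1_tm, sq2_tm, smul_add, map_add, LinearMap.add_apply, sq1_sq1,
      map_zero, LinearMap.zero_apply]
    apply eq_of_add_eq_zero
    abel_nf
    simp only [two_zsmul_eq_zero, add_zero]

theorem tm_mem {i j n : ℤ} {x : M} {y : N} (hx : x ∈ M.deg i) (hy : y ∈ N.deg j)
    (h : i + j = n) : tm M N x y ∈ (M.tensor N).deg n :=
  tmul_mem_tensorDeg M N hx hy h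

theorem tensor_induction {p : M.tensor N → Prop} (h0 : p 0) (ht : ∀ x y, p (tm M N x y))
    (hadd : ∀ x y, p x → p y → p (x + y)) (z : M.tensor N) : p z :=
  TensorProduct.induction_on z h0 ht hadd

/-- Linear maps out of the tensor product. -/
noncomputable def tlift {X : Type*} [AddCommGroup X] [Module (ZMod 2) X]
    (f : M →ₗ[ZMod 2] N →ₗ[ZMod 2] X) : (M.tensor N) →ₗ[ZMod 2] X :=
  TensorProduct.lift f

@[simp] theorem tlift_tm {X : Type*} [AddCommGroup X] [Module (ZMod 2) X]
    (f : M →ₗ[ZMod 2] N →ₗ[ZMod 2] X) (x : M) (y : N) : tlift f (tm M N x y) = f x y :=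
  TensorProduct.lift.tmul x y

theorem tensor_deg_induction {n : ℤ} {p : M.tensor N → Prop}
    (htm : ∀ i j x y, x ∈ M.deg i → y ∈ N.deg j → i + j = n → p (tm M N x y)) (h0 : p 0)
    (hadd : ∀ x y, p x → p y → p (x + y)) (hsmul : ∀ (c : ZMod 2) x, p x → p (c • x))
    {z : M.tensor N} (hz : z ∈ (M.tensor N).deg n) : p z := by
  refine Submodule.span_induction (R := ZMod 2) (M := M.tensor N)
    (s := {z : M.tensor N | ∃ i j : ℤ, i + j = n ∧ ∃ x ∈ M.deg i, ∃ y ∈ N.deg j, z = tm M N x y})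
    (p := fun z _ => p z) ?_ h0 (fun x y _ _ => hadd x y) (fun c x _ => hsmul c x) hz
  rintro z ⟨i, j, h, x, hx, y, hy, rfl⟩
  exact htm i j x y hx hy h

theorem tlift_mem {X : GMod.{w}} (f : M →ₗ[ZMod 2] N →ₗ[ZMod 2] X) (k : ℤ)
    (hf : ∀ i j x y, x ∈ M.deg i → y ∈ N.deg j → f x y ∈ X.deg (i + j + k)) (n : ℤ)
    (z : M.tensor N) (hz : z ∈ (M.tensor N).deg n) : tlift f z ∈ X.deg (n + k) := by
  refine tensor_deg_induction (p := fun z => tlift f z ∈ X.deg (n + k)) ?_ ?_ ?_ ?_ hz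
  · intro i j x y hx hy h
    rw [tlift_tm, ← h]
    exact hf i j x y hx hy
  · rw [map_zero]; exact Submodule.zero_mem _
  · intro z w hz hw; rw [map_add]; exact Submodule.add_mem _ hz hw
  · intro c z hz; rw [map_smul]; exact Submodule.smul_mem _ _ hz

theorem tensor_ext {X : Type*} [AddCommGroup X] [Module (ZMod 2) X]
    {f g : (M.tensor N) →ₗ[ZMod 2] X} (h : ∀ x y, f (tm M N x y) = g (tm M N x y)) : f = g := by
  refine LinearMap.ext fun z => ?_
  induction z using tensor_induction with
  | h0 => simp
  | ht x y => exact h x y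
  | hadd x y hx hy => rw [map_add, map_add, hx, hy]

theorem tensor_forall {X : Type*} [AddCommGroup X] [Module (ZMod 2) X]
    {f g : (M.tensor N) →ₗ[ZMod 2] X} (h : ∀ x y, f (tm M N x y) = g (tm M N x y))
    (z : M.tensor N) : f z = g z :=
  LinearMap.congr_fun (tensor_ext h) z

/-- A homomorphism out of the tensor product from a bilinear map. -/
noncomputable def tHom {X : GMod.{w}} (f : M →ₗ[ZMod 2] N →ₗ[ZMod 2] X)
    (h1 : ∀ x y, f (sq1 • x) y + f x (sq1 • y) = sq1 • f x y)
    (h2 : ∀ x y, f (sq2 • x) y + f (sq1 • x) (sq1 • y) + f x (sq2 • y) = sq2 • f x y)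
    (hd : ∀ i j x y, x ∈ M.deg i → y ∈ N.deg j → f x y ∈ X.deg (i + j)) : Hom (M.tensor N) X :=
  Hom.mk' (tlift f)
    (tensor_forall (f := tlift f ∘ₗ lact _ sq1) (g := lact _ sq1 ∘ₗ tlift f) fun x y => by
      simp [sq1_tm, h1])
    (tensor_forall (f := tlift f ∘ₗ lact _ sq2) (g := lact _ sq2 ∘ₗ tlift f) fun x y => by
      simp [sq2_tm, h2])
    (fun n z hz => by
      have := tlift_mem f 0 (fun i j x y hx hy => by rw [add_zero]; exact hd i j x y hx hy) n z hz
      rwa [add_zero] at this)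

@[simp] theorem tHom_tm {X : GMod.{w}} (f : M →ₗ[ZMod 2] N →ₗ[ZMod 2] X)
    (h1 : ∀ x y, f (sq1 • x) y + f x (sq1 • y) = sq1 • f x y)
    (h2 : ∀ x y, f (sq2 • x) y + f (sq1 • x) (sq1 • y) + f x (sq2 • y) = sq2 • f x y)
    (hd : ∀ i j x y, x ∈ M.deg i → y ∈ N.deg j → f x y ∈ X.deg (i + j)) (x : M) (y : N) :
    (tHom f h1 h2 hd).1 (tm M N x y) = f x y := tlift_tm f x y

theorem tensor_hom_ext {X : GMod.{w}} {f g : Hom (M.tensor N) X}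
    (h : ∀ x y, f.1 (tm M N x y) = g.1 (tm M N x y)) : f = g :=
  Hom.ext' (tensor_forall (f := f.1.restrictScalars (ZMod 2)) (g := g.1.restrictScalars (ZMod 2)) h)

end tensor

universe u₁ u₂ u₃ u₄

/-- The tensor product of homomorphisms. -/
noncomputable def Hom.tensor {M : GMod.{u₁}} {N : GMod.{u₂}} {M' : GMod.{u₃}} {N' : GMod.{u₄}}
    (f : Hom M M') (g : Hom N N') : Hom (M.tensor N) (M'.tensor N') :=
  tHom ((tm M' N').compl₁₂ (f.1.restrictScalars (ZMod 2)) (g.1.restrictScalars (ZMod 2)))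
    (fun x y => by simp [sq1_tm]) (fun x y => by simp [sq2_tm])
    (fun i j x y hx hy => tm_mem (f.2 i x hx) (g.2 j y hy) rfl)

@[simp] theorem Hom.tensor_tm {M : GMod.{u₁}} {N : GMod.{u₂}} {M' : GMod.{u₃}} {N' : GMod.{u₄}}
    (f : Hom M M') (g : Hom N N') (x : M) (y : N) :
    (f.tensor g).1 (tm M N x y) = tm M' N' (f.1 x) (g.1 y) :=
  tHom_tm _ _ _ _ x y

/-- The symmetry of the tensor product. -/
noncomputable def tensorSwap (M : GMod.{u}) (N : GMod.{v}) : Hom (M.tensor N) (N.tensor M) :=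
  tHom (tm N M).flip (fun x y => by simp only [LinearMap.flip_apply]; rw [sq1_tm, add_comm])
    (fun x y => by simp only [LinearMap.flip_apply]; rw [sq2_tm]; abel)
    (fun i j x y hx hy => tm_mem hy hx (add_comm _ _))

@[simp] theorem tensorSwap_tm (M : GMod.{u}) (N : GMod.{v}) (x : M) (y : N) :
    (tensorSwap M N).1 (tm M N x y) = tm N M y x :=
  tHom_tm _ _ _ _ x y

theorem iso_tensor_comm (M : GMod.{u}) (N : GMod.{v}) : Iso (M.tensor N) (N.tensor M) := by
  refine ⟨tensorSwap M N, tensorSwap N M, tensor_hom_ext fun x y => ?_,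
    tensor_hom_ext fun x y => ?_⟩ <;> simp

theorem iso_tensor_assoc (M : GMod.{u}) (N : GMod.{v}) (K : GMod.{w}) :
    Iso ((M.tensor N).tensor K) (M.tensor (N.tensor K)) := by
  let F : (M.tensor N) →ₗ[ZMod 2] K →ₗ[ZMod 2] (M.tensor (N.tensor K)) :=
    tlift (LinearMap.mk₂ (ZMod 2) (fun x y => tm M (N.tensor K) x ∘ₗ tm N K y)
      (fun x y z => by ext; simp) (fun c x y => by ext; simp) (fun x y z => by ext; simp)
      (fun c x y => by ext; simp))
  have hF (x : M) (y : N) (z : K) : F (tm M N x y) z = tm _ _ x (tm _ _ y z) := by simp [F]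
  let G : M →ₗ[ZMod 2] (N.tensor K) →ₗ[ZMod 2] ((M.tensor N).tensor K) :=
    LinearMap.mk₂ (ZMod 2) (fun x w => tlift (tm (M.tensor N) K ∘ₗ tm M N x) w)
      (fun x y w => by
        have : tlift (tm (M.tensor N) K ∘ₗ tm M N (x + y)) = tlift (tm (M.tensor N) K ∘ₗ tm M N x)
          + tlift (tm (M.tensor N) K ∘ₗ tm M N y) := tensor_ext fun _ _ => by simp
        rw [this]; rfl)
      (fun c x w => by
        have : tlift (tm (M.tensor N) K ∘ₗ tm M N (c • x))
          = c • tlift (tm (M.tensor N) K ∘ₗ tm M N x) := tensor_ext fun _ _ => by simp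
        rw [this]; rfl)
      (fun x y w => by simp)
      (fun c x y => by simp)
  have hG (x : M) (y : N) (z : K) : G x (tm _ _ y z) = tm _ _ (tm _ _ x y) z := by simp [G]
  let f : Hom ((M.tensor N).tensor K) (M.tensor (N.tensor K)) :=
    tHom F
      (fun w z => by
        induction w using tensor_induction with
        | h0 => simp
        | ht x y => simp [hF, sq1_tm, add_assoc]
        | hadd x y hx hy => simp only [smul_add, map_add, LinearMap.add_apply, ← hx, ← hy]; abel)
      (fun w z => by
        induction w using tensor_induction with
        | h0 => simp
        | ht x y =>
          simp [hF, sq1_tm, sq2_tm]; abel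
        | hadd x y hx hy => simp only [smul_add, map_add, LinearMap.add_apply, ← hx, ← hy]; abel)
      (fun i j w z hw hz => by
        refine tensor_deg_induction (p := fun w => F w z ∈ (M.tensor (N.tensor K)).deg (i + j))
          ?_ ?_ ?_ ?_ hw
        · intro a b x y hx hy h
          rw [hF]
          exact tm_mem hx (tm_mem hy hz rfl) (by rw [← h]; ring)
        · rw [map_zero]; exact Submodule.zero_mem _
        · intro x y hx hy
          rw [map_add, LinearMap.add_apply]; exact Submodule.add_mem _ hx hy
        · intro c x hx
          rw [map_smul, LinearMap.smul_apply]; exact Submodule.smul_mem _ _ hx)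
  let g : Hom (M.tensor (N.tensor K)) ((M.tensor N).tensor K) :=
    tHom G
      (fun x w => by
        induction w using tensor_induction with
        | h0 => simp
        | ht y z => simp [hG, sq1_tm, add_assoc]
        | hadd x y hx hy => simp only [smul_add, map_add, ← hx, ← hy]; abel)
      (fun x w => by
        induction w using tensor_induction with
        | h0 => simp
        | ht y z => simp [hG, sq1_tm, sq2_tm]; abel
        | hadd x y hx hy => simp only [smul_add, map_add, ← hx, ← hy]; abel)
      (fun i j x w hx hw => by
        refine tensor_deg_induction
          (p := fun w => G x w ∈ ((M.tensor N).tensor K).deg (i + j)) ?_ ?_ ?_ ?_ hw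
        · intro a b y z hy hz h
          rw [hG]
          exact tm_mem (tm_mem hx hy rfl) hz (by rw [← h]; ring)
        · rw [map_zero]; exact Submodule.zero_mem _
        · intro y z hy hz; rw [map_add]; exact Submodule.add_mem _ hy hz
        · intro c y hy; rw [map_smul]; exact Submodule.smul_mem _ _ hy)
  refine ⟨f, g, tensor_hom_ext fun w z => ?_, tensor_hom_ext fun x w => ?_⟩
  · induction w using tensor_induction with
    | h0 => simp
    | ht x y => simp [f, g, hF, hG]
    | hadd x y hx hy => simp only [map_add, LinearMap.add_apply, hx, hy]
  · induction w using tensor_induction with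
    | h0 => simp
    | ht x y => simp [f, g, hF, hG]
    | hadd x y hx hy => simp only [map_add, hx, hy]

/-! ### Projective modules and tensor products -/

/-- The identity is a commutator of an `𝔽₂`-linear map with `Q_0` and `Q_1`; this characterises the
modules that are free over the exterior algebra on `Q_0` and `Q_1`. -/
def Contractible (M : Type*) [AddCommGroup M] [Module A1 M] [Module (ZMod 2) M] : Prop :=
  ∃ θ : M →ₗ[ZMod 2] M, ∀ x,
    Q 0 • Q 1 • θ x + Q 0 • θ (Q 1 • x) + Q 1 • θ (Q 0 • x) + θ (Q 0 • Q 1 • x) = x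

theorem Q_comm {M : Type*} [AddCommGroup M] [Module A1 M] (x : M) :
    Q 0 • Q 1 • x = Q 1 • Q 0 • x := by
  rw [Q_zero_smul, Q_zero_smul, sq1_Q_one, Q_one_sq1]

theorem Contractible.freeCond {M : Type*} [AddCommGroup M] [Module A1 M] [Module (ZMod 2) M]
    (h : Contractible M) : FreeCond M := by
  obtain ⟨θ, h⟩ := h
  intro x hx
  refine ⟨Q 1 • θ x + θ (Q 1 • x), θ (Q 0 • x), ?_⟩
  conv_lhs => rw [← h x, hx, map_zero, add_zero]
  rw [smul_add]

theorem Contractible.retract {M N : Type*} [AddCommGroup M] [Module A1 M] [Module (ZMod 2) M]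
    [AddCommGroup N] [Module A1 N] [Module (ZMod 2) N] [IsScalarTower (ZMod 2) A1 M]
    [IsScalarTower (ZMod 2) A1 N] (h : Contractible M) (i : N →ₗ[A1] M) (r : M →ₗ[A1] N)
    (hri : ∀ x, r (i x) = x) : Contractible N := by
  obtain ⟨θ, h⟩ := h
  refine ⟨r.restrictScalars (ZMod 2) ∘ₗ θ ∘ₗ i.restrictScalars (ZMod 2), fun x => ?_⟩
  have := congrArg r (h (i x))
  simpa [hri] using this

/-- `θ ⊗ 1` works, without any condition on `N`: since the `Q_k` are primitive and commute, the
terms in which some `Q_k` acts on the second factor cancel in pairs. -/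
theorem Contractible.tensor {M : GMod.{u}} (h : Contractible M) (N : GMod.{v}) :
    Contractible (M.tensor N) := by
  obtain ⟨θ, h⟩ := h
  refine ⟨tlift ((tm M N).comp θ), tensor_forall
    (f := lact _ (Q 0) ∘ₗ lact _ (Q 1) ∘ₗ tlift ((tm M N).comp θ)
      + lact _ (Q 0) ∘ₗ tlift ((tm M N).comp θ) ∘ₗ lact _ (Q 1)
      + lact _ (Q 1) ∘ₗ tlift ((tm M N).comp θ) ∘ₗ lact _ (Q 0)
      + tlift ((tm M N).comp θ) ∘ₗ lact _ (Q 0) ∘ₗ lact _ (Q 1)) (g := LinearMap.id)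
    fun x y => ?_⟩
  have h2 := congrArg (fun z => tm M N z y) (h x)
  simp only [map_add, LinearMap.add_apply] at h2
  simp only [LinearMap.add_apply, LinearMap.comp_apply, lact_apply, tlift_tm, Q_tm,
    map_add, LinearMap.id_apply]
  rw [← h2, Q_comm y]
  apply eq_of_add_eq_zero
  abel_nf
  simp only [two_zsmul_eq_zero, four_zsmul_eq_zero, add_zero]

/-- The coefficients as linear maps. -/
noncomputable def coefₗ (i : Fin 8) : A1 →ₗ[ZMod 2] ZMod 2 where
  toFun a := coef a i
  map_add' a b := coef_add a b i
  map_smul' c a := coef_smul c a i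

/-- `A(1)` is free over the exterior algebra on `1` and `Sq^2`. The top words of the two copies are
`Q_0 Q_1 = Sq^1 Sq^2 Sq^1` and `Q_0 Q_1 Sq^2 = top`, of index 5 and 7, and `θ` sends them back to
`1` and `Sq^2`. -/
theorem contractible_reg : Contractible A1 := by
  let θ : A1 →ₗ[ZMod 2] A1 := (coefₗ 5).smulRight 1 + (coefₗ 7).smulRight sq2
  have hθ (i : Fin 8) : θ (Steenrod.word sq1 sq2 i) =
      (if i = 5 then 1 else 0 : ZMod 2) • 1 + (if i = 7 then 1 else 0 : ZMod 2) • sq2 := by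
    rw [← coef_word, ← coef_word]
    rfl
  have h0 : θ 1 = 0 := by simpa [Steenrod.word] using hθ 0
  have h1 : θ (sq1 • 1) = 0 := by simpa [Steenrod.word] using hθ 1
  have h2 : θ (sq2 • 1) = 0 := by simpa [Steenrod.word] using hθ 2
  have h3 : θ (sq1 • sq2 • 1) = 0 := by simpa [Steenrod.word, mul_assoc] using hθ 3
  have h4 : θ (sq2 • sq1 • 1) = 0 := by simpa [Steenrod.word, mul_assoc] using hθ 4
  have h5 : θ (sq1 • sq2 • sq1 • 1) = 1 := by simpa [Steenrod.word, mul_assoc] using hθ 5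
  have h6 : θ (sq2 • sq1 • sq2 • 1) = 0 := by simpa [Steenrod.word, mul_assoc] using hθ 6
  have h7 : θ (sq1 • sq2 • sq1 • sq2 • 1) = sq2 • 1 := by
    simpa [Steenrod.word, mul_assoc] using hθ 7
  refine ⟨θ, fun a => ?_⟩
  let F : A1 →ₗ[ZMod 2] A1 := lact A1 (Q 0) ∘ₗ lact A1 (Q 1) ∘ₗ θ
    + lact A1 (Q 0) ∘ₗ θ ∘ₗ lact A1 (Q 1)
    + lact A1 (Q 1) ∘ₗ θ ∘ₗ lact A1 (Q 0) + θ ∘ₗ lact A1 (Q 0) ∘ₗ lact A1 (Q 1)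
  change F a = a
  rw [eq_sum_word a, map_sum]
  refine Finset.sum_congr rfl fun i _ => ?_
  rw [map_smul]
  congr 1
  have hw : Steenrod.word sq1 sq2 i = Steenrod.word sq1 sq2 i • (1 : A1) := by simp
  rw [hw]
  simp only [F, LinearMap.add_apply, LinearMap.comp_apply, lact_apply, Q_zero_smul, Q_one_smul]
  fin_cases i <;>
    simp only [Steenrod.word, mul_smul, one_smul, Fin.zero_eta, Fin.mk_one, Fin.reduceFinMk,
      Matrix.cons_val, map_add, smul_add, sq1_sq1, sq2_sq2, sq2_sq1_sq2_sq1,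
      smul_zero, map_zero, add_zero, zero_add, h0, h1, h2, h3, h4, h5, h6, h7, char_two_add]
  rw [add_left_comm, char_two_add, add_zero]

/-- The augmentation `A(1) ⊗ M → M`. -/
noncomputable def augMap (M : GMod.{u}) : Hom (reg.tensor M) M :=
  tHom (LinearMap.mk₂ (ZMod 2) (fun (a : reg) x => A1.counit a • x)
    (fun a b x => by rw [← add_smul]; exact congrArg (· • x) (map_add A1.counit a b))
    (fun c a x => by
      rw [← smul_assoc]; exact congrArg (· • x) (map_smul A1.counit c a))
    (fun a x y => smul_add _ _ _) (fun c a x => smul_comm _ _ _))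
    (fun a x => by
      change A1.counit (sq1 * a) • x + A1.counit a • sq1 • x = sq1 • (A1.counit a • x)
      rw [counit_sq1_mul, zero_smul, zero_add, smul_comm])
    (fun a x => by
      change A1.counit (sq2 * a) • x + A1.counit (sq1 * a) • sq1 • x + A1.counit a • sq2 • x
        = sq2 • (A1.counit a • x)
      rw [counit_sq1_mul, counit_sq2_mul, zero_smul, zero_add, zero_smul, zero_add, smul_comm])
    (fun i j a x ha hx => by
      change A1.counit a • x ∈ M.deg (i + j)
      by_cases hi : i = 0
      · rw [hi, zero_add]
        exact Submodule.smul_mem _ _ hx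
      · rw [counit_of_mem ha hi, zero_smul]
        exact Submodule.zero_mem _)

@[simp] theorem augMap_tm (M : GMod.{u}) (a : A1) (x : M) :
    (augMap M).1 (tm reg M a x) = A1.counit a • x := tHom_tm _ _ _ _ _ _

/-- `P` is a retract of `A(1) ⊗ P`, which inherits contractibility from `A(1)`. With the next two
lemmas, projective, free and contractible all agree, and so tensoring with any module preserves
projectives. -/
theorem IsProjective.contractible {P : GMod.{u}} (hP : IsProjective P) : Contractible P := by
  have hs : Function.Surjective (augMap P).1 := fun x => ⟨tm reg P (1 : A1) x, by
    rw [augMap_tm, map_one, one_smul]⟩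
  obtain ⟨i, hi⟩ := hP (reg.tensor P) P (augMap P) (Hom.id P) hs
  have hreg : Contractible reg := contractible_reg
  exact (hreg.tensor P).retract i.1 (augMap P).1 fun x => Hom.congr hi x

theorem Contractible.isFree {M : GMod.{u}} (h : Contractible M) : IsFree M := h.freeCond.isFree

theorem Contractible.isProjective {M : GMod.{u}} (h : Contractible M) : IsProjective M :=
  h.isFree.isProjective

theorem Hom.IsNull.tensor_right {M N : GMod.{u}} {f : Hom M N} (hf : f.IsNull) (K : GMod.{v}) :
    (f.tensor (Hom.id K)).IsNull := by
  obtain ⟨P, g, h, hP, rfl⟩ := hf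
  exact ⟨P.tensor K, g.tensor (Hom.id K), h.tensor (Hom.id K),
    (hP.contractible.tensor K).isProjective,
    tensor_hom_ext fun x y => by simp⟩

theorem StableIso.tensor_right {M N : GMod.{u}} (h : StableIso M N) (K : GMod.{v}) :
    StableIso (M.tensor K) (N.tensor K) := by
  obtain ⟨f, g, h1, h2⟩ := h
  refine ⟨f.tensor (Hom.id K), g.tensor (Hom.id K), ?_, ?_⟩
  · have : (g.tensor (Hom.id K)).comp (f.tensor (Hom.id K)) - Hom.id _
        = (g.comp f - Hom.id M).tensor (Hom.id K) := tensor_hom_ext fun x y => by simp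
    rw [this]
    exact h1.tensor_right K
  · have : (f.tensor (Hom.id K)).comp (g.tensor (Hom.id K)) - Hom.id _
        = (f.comp g - Hom.id N).tensor (Hom.id K) := tensor_hom_ext fun x y => by simp
    rw [this]
    exact h2.tensor_right K

theorem StableIso.tensor_left {M N : GMod.{u}} (h : StableIso M N) (K : GMod.{v}) :
    StableIso (K.tensor M) (K.tensor N) :=
  ((iso_tensor_comm K M).stableIso.trans (h.tensor_right K)).trans (iso_tensor_comm N K).stableIso

theorem StableIso.tensor {M N M' N' : GMod.{u}} (h : StableIso M M') (h' : StableIso N N') :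
    StableIso (M.tensor N) (M'.tensor N') :=
  (h.tensor_right N).trans (h'.tensor_left M')

theorem StableIso.loop {M N : GMod.{u}} (h : StableIso M N) : StableIso M.loop N.loop :=
  h.tensor_left augIdeal

theorem StableIso.loopInv {M N : GMod.{u}} (h : StableIso M N) : StableIso M.loopInv N.loopInv :=
  h.tensor_left augInv

/-! ### Suspensions -/

/-- The suspension of a homomorphism. -/
noncomputable def Hom.susp {M : GMod.{u}} {N : GMod.{v}} (k : ℤ) (f : Hom M N) :
    Hom (M.susp k) (N.susp k) := ⟨f.1, fun n x hx => f.2 (n - k) x hx⟩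

theorem Hom.IsNull.susp {M N : GMod.{u}} {f : Hom M N} (hf : f.IsNull) (k : ℤ) :
    (Hom.susp k f).IsNull := by
  obtain ⟨P, g, h, hP, rfl⟩ := hf
  have hc : Contractible (P.susp k) := hP.contractible
  exact ⟨P.susp k, Hom.susp k g, Hom.susp k h, hc.isProjective, rfl⟩

theorem StableIso.susp {M N : GMod.{u}} (h : StableIso M N) (k : ℤ) :
    StableIso (M.susp k) (N.susp k) := by
  obtain ⟨f, g, h1, h2⟩ := h
  exact ⟨Hom.susp k f, Hom.susp k g, h1.susp k, h2.susp k⟩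

/-- Modules that differ only in the notation of their gradings. -/
theorem iso_susp_of_eq {M : GMod.{u}} {k l : ℤ} (h : k = l) : Iso (M.susp k) (M.susp l) := by
  subst h
  exact ⟨Hom.id _, Hom.id _, rfl, rfl⟩

theorem iso_susp_zero (M : GMod.{u}) : Iso (M.susp 0) M :=
  ⟨⟨LinearMap.id, fun n _ hx => mem_deg_cast (M := M) hx (sub_zero n)⟩,
    ⟨LinearMap.id, fun n _ hx => mem_deg_cast (M := M) hx (sub_zero n).symm⟩, rfl, rfl⟩

theorem iso_susp_susp (M : GMod.{u}) (k l : ℤ) : Iso ((M.susp k).susp l) (M.susp (k + l)) :=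
  ⟨⟨LinearMap.id, fun n _ hx => mem_deg_cast (M := M) (m := n - l - k) hx (by ring)⟩,
    ⟨LinearMap.id, fun n _ hx => mem_deg_cast (M := M) (n := n - l - k) hx (by ring)⟩, rfl, rfl⟩

theorem iso_susp_tensor (M : GMod.{u}) (N : GMod.{v}) (k : ℤ) :
    Iso ((M.susp k).tensor N) ((M.tensor N).susp k) := by
  refine ⟨⟨(LinearMap.id : (M.tensor N) →ₗ[A1] (M.tensor N)), fun n z hz => ?_⟩,
    ⟨(LinearMap.id : (M.tensor N) →ₗ[A1] (M.tensor N)), fun n z hz => ?_⟩, rfl, rfl⟩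
  · refine tensor_deg_induction (M := M.susp k) (p := fun z => z ∈ (M.tensor N).deg (n - k))
      (fun i j x y hx hy h => ?_) (Submodule.zero_mem _) (fun _ _ => Submodule.add_mem _)
      (fun c _ => Submodule.smul_mem _ c) hz
    exact tm_mem (M := M) (i := i - k) hx hy (by rw [← h]; ring)
  · refine tensor_deg_induction (M := M) (n := n - k)
      (p := fun z => z ∈ ((M.susp k).tensor N).deg n)
      (fun i j x y hx hy h => ?_) (Submodule.zero_mem _) (fun _ _ => Submodule.add_mem _)
      (fun c _ => Submodule.smul_mem _ c) hz
    exact tm_mem (M := M.susp k) (i := i + k) (mem_deg_cast (M := M) hx (by ring)) hy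
      (by linarith)

theorem Iso.susp {M : GMod.{u}} {N : GMod.{v}} (h : Iso M N) (k : ℤ) :
    Iso (M.susp k) (N.susp k) := by
  obtain ⟨f, g, h1, h2⟩ := h
  exact ⟨Hom.susp k f, Hom.susp k g, Hom.ext' (fun x => Hom.congr h1 x),
    Hom.ext' (fun x => Hom.congr h2 x)⟩

theorem iso_tensor_susp (M : GMod.{u}) (N : GMod.{v}) (k : ℤ) :
    Iso (M.tensor (N.susp k)) ((M.tensor N).susp k) :=
  ((iso_tensor_comm M (N.susp k)).trans (iso_susp_tensor N M k)).trans
    ((iso_tensor_comm N M).susp k)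

/-! ### Acyclic modules -/

theorem mem_of_proj_mem {M : GMod.{u}} (S : Submodule (ZMod 2) M) {x : M}
    (h : ∀ n, M.proj n x ∈ S) : x ∈ S := by
  obtain ⟨s, hs⟩ := M.exists_sum_proj x
  rw [← hs s subset_rfl]
  exact Submodule.sum_mem _ fun n _ => h n

/-- The `Q_k`-homology vanishes. -/
def Acyclic (k : Fin 2) (M : Type*) [AddCommGroup M] [Module A1 M] : Prop :=
  ∀ x : M, Q k • x = 0 → ∃ y : M, x = Q k • y

theorem mem_range_lact {M : Type*} [AddCommGroup M] [Module A1 M] [Module (ZMod 2) M]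
    [IsScalarTower (ZMod 2) A1 M] {a : A1} {x : M} :
    x ∈ LinearMap.range (lact M a) ↔ ∃ y, x = a • y :=
  ⟨fun ⟨y, hy⟩ => ⟨y, hy.symm⟩, fun ⟨y, hy⟩ => ⟨y, hy.symm⟩⟩

/-- A homogeneous boundary is the boundary of a homogeneous element. -/
theorem exists_mem_deg_of_eq_Q {M : GMod.{u}} {k : Fin 2} {n : ℤ} {x y : M} (hx : x ∈ M.deg n)
    (h : x = Q k • y) : ∃ z ∈ M.deg (n - Qdeg k), x = Q k • z := by
  refine ⟨M.proj (n - Qdeg k) y, M.proj_mem _ _, ?_⟩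
  rw [Q_proj, sub_add_cancel, ← h, proj_self hx]

theorem acyclic_of_subsingleton {M : GMod.{u}} {k : Fin 2}
    (h : ∀ n, Subsingleton (M.homology k n)) : Acyclic k M := by
  intro x hx
  rw [← mem_range_lact]
  refine mem_of_proj_mem _ fun n => ?_
  have h1 := Submodule.Quotient.subsingleton_iff.1 (h n)
  have h2 : (⟨M.proj n x, M.proj_mem n x, by
    change Q k • M.proj n x = 0
    rw [Q_proj, hx, map_zero]⟩ : ↥(M.deg n ⊓ LinearMap.ker (M.act (A1.Q k)))) ∈
    (LinearMap.range (M.act (A1.Q k))).comap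
      (M.deg n ⊓ LinearMap.ker (M.act (A1.Q k))).subtype := by rw [h1]; trivial
  exact h2

theorem subsingleton_of_acyclic {M : GMod.{u}} {k : Fin 2} (h : Acyclic k M) (n : ℤ) :
    Subsingleton (M.homology k n) := by
  refine Submodule.Quotient.subsingleton_iff.2 (eq_top_iff.2 fun x _ => ?_)
  obtain ⟨y, hy⟩ := h x.1 x.2.2
  exact ⟨y, hy.symm⟩

theorem Contractible.acyclic {M : Type*} [AddCommGroup M] [Module A1 M] [Module (ZMod 2) M]
    (h : Contractible M) (k : Fin 2) : Acyclic k M := by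
  obtain ⟨θ, h⟩ := h
  intro x hx
  have h1 := h x
  fin_cases k
  · have hx : Q 0 • x = 0 := hx
    refine ⟨Q 1 • θ x + θ (Q 1 • x), ?_⟩
    rw [hx, Q_comm x, hx, smul_zero, map_zero, smul_zero, add_zero, add_zero] at h1
    rw [smul_add]
    exact h1.symm
  · have hx : Q 1 • x = 0 := hx
    refine ⟨Q 0 • θ x + θ (Q 0 • x), ?_⟩
    rw [hx, smul_zero, map_zero, smul_zero, add_zero, add_zero, Q_comm] at h1
    rw [smul_add]
    exact h1.symm

/-- The descent argument for bounded-below modules without `Q_0`-homology. -/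
theorem descent {M : GMod.{u}} (hM : M.IsBoundedBelow) (h0 : Acyclic 0 M) (n : ℤ)
    (h1 : ∀ m < n, ∀ x ∈ M.deg m, Q 1 • x = 0 → ∃ y, x = Q 1 • y) {r w : M}
    (hr : r ∈ M.deg n) (hw : w ∈ M.deg (n - 2)) (h : Q 0 • r = Q 1 • w) :
    ∃ v ∈ M.deg (n - 3), ∃ v' ∈ M.deg (n - 1), r = Q 1 • v + Q 0 • v' := by
  obtain ⟨b, hb⟩ := hM
  -- Induction on the height of `r` above the lower bound of the module; each step lowers the degree
  -- by 2.
  obtain ⟨k, hk⟩ : ∃ k : ℕ, n < b + k := ⟨(n - b + 1).toNat, by omega⟩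
  induction k generalizing n r w with
  | zero =>
    rw [hb n (by simpa using hk), Submodule.mem_bot] at hr
    exact ⟨0, Submodule.zero_mem _, 0, Submodule.zero_mem _, by simp [hr]⟩
  | succ k ih =>
    -- `Q_0 w` is a `Q_1`-cycle in degree `n - 1 < n`, so `Q_0 w = Q_1 w'`: the pair `(w, w')`
    -- satisfies the hypothesis two degrees lower. From `w = Q_1 v + Q_0 v'` it follows that `r +
    -- Q_1 v'` is a `Q_0`-cycle, hence a boundary.
    have hwd : Q 0 • w ∈ M.deg (n - 1) := mem_deg_cast (M.Q_mem 0 hw) (by simp [Qdeg]; ring)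
    obtain ⟨w', hw'⟩ := h1 _ (by omega) _ hwd (by rw [← Q_comm, ← h, Q_Q])
    obtain ⟨w', hwd', hw'⟩ := exists_mem_deg_of_eq_Q hwd hw'
    obtain ⟨v, hv, v', hv', hvv⟩ := ih (n - 2) (fun m hm => h1 m (by omega)) hw
      (mem_deg_cast hwd' (by simp [Qdeg]; ring)) hw' (by push_cast at hk; omega)
    have hv'd : v' ∈ M.deg (n - 3) := mem_deg_cast hv' (by ring)
    have hs : r + Q 1 • v' ∈ M.deg n :=
      Submodule.add_mem _ hr (mem_deg_cast (M.Q_one_mem hv'd) (by ring))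
    obtain ⟨e, he⟩ := h0 (r + Q 1 • v') (by
      rw [smul_add, h, hvv, smul_add, Q_Q, zero_add, Q_comm, char_two_add])
    obtain ⟨e, hed, he⟩ := exists_mem_deg_of_eq_Q hs he
    refine ⟨v', hv'd, e, hed, ?_⟩
    rw [← he, add_comm r, add_self_left]

/-- Bounded-below modules without Margolis homology are free. -/
theorem freeCond_of_acyclic {M : GMod.{u}} (hM : M.IsBoundedBelow) (h0 : Acyclic 0 M)
    (h1 : Acyclic 1 M) : FreeCond M := by
  intro x hx
  have : x ∈ LinearMap.range (lact M (Q 0)) ⊔ LinearMap.range (lact M (Q 1)) := by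
    refine mem_of_proj_mem _ fun n => ?_
    have hd : Q 0 • M.proj n x ∈ M.deg (n + 1) := M.Q_mem 0 (M.proj_mem n x)
    obtain ⟨w, hw⟩ := h1 (Q 0 • M.proj n x) (by
      rw [← Q_comm, Q_proj, Q_proj, hx, map_zero])
    obtain ⟨w, hwd, hw⟩ := exists_mem_deg_of_eq_Q hd hw
    obtain ⟨v, -, v', -, h⟩ := descent hM h0 n (fun m _ x _ => h1 x) (M.proj_mem n x)
      (mem_deg_cast hwd (by simp [Qdeg]; ring)) hw
    rw [h, add_comm]
    exact Submodule.add_mem_sup ⟨v', rfl⟩ ⟨v, rfl⟩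
  obtain ⟨_, ⟨a, rfl⟩, _, ⟨b, rfl⟩, h⟩ := Submodule.mem_sup.1 this
  exact ⟨a, b, h.symm⟩

/-! ### Maps that induce isomorphisms in Margolis homology -/

/-- `f` induces an isomorphism in `Q_k`-homology. -/
def Hom.IsEquiv {M : GMod.{u}} {N : GMod.{v}} (k : Fin 2) (f : Hom M N) : Prop :=
  (∀ x y, Q k • x = 0 → f.1 x = Q k • y → ∃ z, x = Q k • z) ∧
    ∀ y, Q k • y = 0 → ∃ x w, Q k • x = 0 ∧ y = f.1 x + Q k • w

theorem Hom.isEquiv_of_acyclic {M : GMod.{u}} {N : GMod.{v}} {k : Fin 2} (hM : Acyclic k M)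
    (hN : Acyclic k N) (f : Hom M N) : f.IsEquiv k := by
  refine ⟨fun x _ hx _ => hM x hx, fun y hy => ?_⟩
  obtain ⟨w, hw⟩ := hN y hy
  exact ⟨0, w, smul_zero _, by rw [map_zero, zero_add, hw]⟩

theorem Hom.IsNull.map_eq_Q {M N : GMod.{u}} {f : Hom M N} (hf : f.IsNull) {k : Fin 2} {x : M}
    (hx : Q k • x = 0) : ∃ y, f.1 x = Q k • y := by
  obtain ⟨P, g, h, hP, rfl⟩ := hf
  obtain ⟨y, hy⟩ := hP.contractible.acyclic k (g.1 x) (by rw [← map_smul, hx, map_zero])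
  exact ⟨h.1 y, by rw [Hom.comp_apply, hy, map_smul]⟩

theorem Hom.isEquiv_of_stable {M N : GMod.{u}} {f : Hom M N} {g : Hom N M}
    (h1 : (g.comp f - Hom.id M).IsNull) (h2 : (f.comp g - Hom.id N).IsNull) (k : Fin 2) :
    f.IsEquiv k := by
  refine ⟨fun x y hx hxy => ?_, fun y hy => ?_⟩
  · obtain ⟨z, hz⟩ := h1.map_eq_Q hx
    refine ⟨g.1 y - z, ?_⟩
    simp only [Hom.sub_apply, Hom.comp_apply, Hom.id_apply, hxy, map_smul] at hz
    rw [smul_sub, ← hz]; abel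
  · obtain ⟨z, hz⟩ := h2.map_eq_Q hy
    refine ⟨g.1 y, -z, by rw [← map_smul, hy, map_zero], ?_⟩
    simp only [Hom.sub_apply, Hom.comp_apply, Hom.id_apply] at hz
    rw [smul_neg, ← hz]; abel

theorem IsBoundedBelow.susp {M : GMod.{u}} (h : M.IsBoundedBelow) (k : ℤ) :
    (M.susp k).IsBoundedBelow := by
  obtain ⟨b, hb⟩ := h
  exact ⟨b + k, fun n hn => hb (n - k) (by omega)⟩

theorem IsBoundedBelow.tensor {M : GMod.{u}} {N : GMod.{v}} (hM : M.IsBoundedBelow)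
    (hN : N.IsBoundedBelow) : (M.tensor N).IsBoundedBelow := by
  obtain ⟨b, hb⟩ := hM
  obtain ⟨c, hc⟩ := hN
  refine ⟨b + c, fun n hn => (Submodule.eq_bot_iff _).2 fun z hz => ?_⟩
  refine tensor_deg_induction (p := fun z => z = 0) (fun i j x y hx hy h => ?_) rfl
    (fun x y hx hy => by rw [hx, hy, add_zero]) (fun c x hx => by rw [hx, smul_zero]) hz
  by_cases hi : i < b
  · rw [hb i hi, Submodule.mem_bot] at hx
    simp [hx]
  · rw [hc j (by omega), Submodule.mem_bot] at hy
    simp [hy]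

theorem isBoundedBelow_reg : reg.IsBoundedBelow := by
  refine ⟨0, fun n hn => (Submodule.eq_bot_iff _).2 fun a ha => ?_⟩
  rw [A1.eq_sum_of_mem_deg ha]
  exact Finset.sum_eq_zero fun i _ => if_neg (by omega)

theorem isHomogeneous_range {M : GMod.{u}} {N : GMod.{v}} (f : Hom M N) :
    N.IsHomogeneous (LinearMap.range f.1) := by
  rintro _ ⟨x, rfl⟩ n
  exact ⟨M.proj n x, f.map_proj n x⟩

/-- The embedding `m ↦ top ⊗ m` of a module in a free module. -/
noncomputable def topEmb (M : GMod.{u}) : Hom M ((reg.tensor M).susp (-6)) :=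
  Hom.mk' (N := (reg.tensor M).susp (-6)) (tm reg M (top : A1))
    (fun x => by
      refine Eq.trans ?_ (sq1_tm (M := reg) (N := M) (top : A1) x).symm
      have : sq1 • (top : reg) = 0 := by simpa using sq1_top (1 : A1)
      rw [this, map_zero, LinearMap.zero_apply, zero_add]; rfl)
    (fun x => by
      refine Eq.trans ?_ (sq2_tm (M := reg) (N := M) (top : A1) x).symm
      have h1 : sq1 • (top : reg) = 0 := by simpa using sq1_top (1 : A1)
      have h2 : sq2 • (top : reg) = 0 := by simpa using sq2_top (1 : A1)
      rw [h1, h2, map_zero, LinearMap.zero_apply, LinearMap.zero_apply, zero_add, zero_add]; rfl)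
    (fun n x hx => by
      have h : (top : A1) ∈ reg.deg 6 := by
        exact A1.word_mem_deg 7
      exact tm_mem (M := reg) h hx (by ring))

theorem topEmb_injective (M : GMod.{u}) : Function.Injective (topEmb M).1 := by
  intro x y h
  have h : tm reg M (top : A1) x = tm reg M (top : A1) y := h
  have h2 := congrArg (tlift (LinearMap.mk₂ (ZMod 2) (fun (a : reg) (x : M) => coefₗ 7 a • x)
    (fun a b x => by rw [← add_smul]; exact congrArg (· • x) (map_add (coefₗ 7) a b))
    (fun c a x => by rw [← smul_assoc]; exact congrArg (· • x) (map_smul (coefₗ 7) c a))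
    (fun a x y => smul_add _ _ _) (fun c a x => smul_comm _ _ _))) h
  rw [tlift_tm, tlift_tm] at h2
  have h3 : coefₗ 7 top = 1 := coef_top 7
  simpa [h3] using h2

theorem mem_deg_of_injective {M : GMod.{u}} {N : GMod.{v}} {f : Hom M N}
    (hf : Function.Injective f.1) {n : ℤ} {x : M} (h : f.1 x ∈ N.deg n) : x ∈ M.deg n := by
  refine mem_deg_of_proj (hf ?_)
  rw [Hom.map_proj, proj_self h]

/-- Adding to `f` the embedding of `M` in the projective module `J` gives an injection `j : M → N ⊕
J`. Its cokernel `C` is bounded below without Margolis homology, hence projective. So the sequence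
splits, `N ⊕ J ≅ M ⊕ C`, with `J` and `C` projective. -/
theorem stableIso_of_isEquiv {M N : GMod.{u}} (hM : M.IsBoundedBelow) (hN : N.IsBoundedBelow)
    (f : Hom M N) (hf : ∀ k, f.IsEquiv k) : StableIso M N := by
  let J : GMod.{u} := (reg.tensor M).susp (-6)
  have hreg : Contractible reg := contractible_reg
  have hJc : Contractible J := hreg.tensor M
  have hJb : J.IsBoundedBelow := (isBoundedBelow_reg.tensor hM).susp (-6)
  let ι : Hom M J := topEmb M
  let j : Hom M (N.prod J) := ⟨LinearMap.prod f.1 ι.1, fun n x hx => ⟨f.2 n x hx, ι.2 n x hx⟩⟩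
  have hj : Function.Injective j.1 := fun x y h => topEmb_injective M (congrArg Prod.snd h)
  let C : GMod.{u} := (N.prod J).quot (LinearMap.range j.1) (isHomogeneous_range j)
  let π : Hom (N.prod J) C := ⟨(LinearMap.range j.1).mkQ, fun n x hx => ⟨x, hx, rfl⟩⟩
  have hπs : Function.Surjective π.1 := Submodule.mkQ_surjective _
  have hπ (y : N.prod J) : π.1 y = 0 ↔ ∃ x, j.1 x = y := by
    refine (Submodule.Quotient.mk_eq_zero _).trans ?_
    rfl
  have hCb : C.IsBoundedBelow := by
    obtain ⟨b, hb⟩ := hN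
    obtain ⟨c, hc⟩ := hJb
    refine ⟨min b c, fun n hn => (Submodule.eq_bot_iff _).2 ?_⟩
    rintro _ ⟨⟨x, y⟩, ⟨hx, hy⟩, rfl⟩
    have hx : x ∈ N.deg n := hx
    have hy : y ∈ J.deg n := hy
    rw [hb n (by omega), Submodule.mem_bot] at hx
    rw [hc n (by omega), Submodule.mem_bot] at hy
    rw [hx, hy]
    exact map_zero π.1
  have hCa (k : Fin 2) : Acyclic k C := by
    intro c hc
    obtain ⟨y, rfl⟩ := hπs c
    rw [← map_smul, hπ] at hc
    obtain ⟨m, hm⟩ := hc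
    have h1 : Q k • m = 0 := hj (by rw [map_smul, hm, Q_Q, map_zero])
    -- Here `f m` is a boundary, so injectivity in homology makes `m` one. Then `y - j m'` is a
    -- cycle representing the same class of `C`, and surjectivity writes it as `j x` plus a
    -- boundary.
    obtain ⟨m', rfl⟩ := (hf k).1 m y.1 h1 (congrArg Prod.fst hm)
    rw [map_smul] at hm
    have h2 : Q k • (y - j.1 m') = 0 := by rw [smul_sub, ← hm, sub_self]
    obtain ⟨x, w, hx, hxw⟩ := (hf k).2 (y - j.1 m').1 (congrArg Prod.fst h2)
    obtain ⟨e, he⟩ := hJc.acyclic k ((y - j.1 m').2 - ι.1 x) (by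
      rw [smul_sub, ← map_smul, hx, map_zero, sub_zero]
      exact congrArg Prod.snd h2)
    let q : N.prod J := ((w, e) : N × J)
    refine ⟨π.1 q, ?_⟩
    rw [← map_smul, ← sub_eq_zero, ← map_sub, hπ]
    refine ⟨m' + x, ?_⟩
    rw [map_add]
    have h3 : y - j.1 m' = j.1 x + Q k • q := by
      refine Prod.ext hxw ?_
      change (y - j.1 m').2 = ι.1 x + Q k • e
      rw [← he]; abel
    have h4 : y = j.1 m' + (j.1 x + Q k • q) := by rw [← h3]; abel
    have h5 : j.1 m' + j.1 x = (j.1 m' + (j.1 x + Q k • q)) - Q k • q := by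
      abel
    rw [h5]
    exact congrArg (· - Q k • q) h4.symm
  have hC : IsProjective C := (freeCond_of_acyclic hCb (hCa 0) (hCa 1)).isFree.isProjective
  obtain ⟨σ, hσ⟩ := hC (N.prod J) C π (Hom.id C) hπs
  have hσ (c : C) : π.1 (σ.1 c) = c := Hom.congr hσ c
  let p : (N.prod J) →ₗ[A1] (N.prod J) := LinearMap.id - σ.1 ∘ₗ π.1
  have hp (y) : p y ∈ LinearMap.range j.1 := by
    obtain ⟨x, hx⟩ := (hπ (p y)).1 (by
      change π.1 (y - σ.1 (π.1 y)) = 0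
      rw [map_sub, hσ, sub_self])
    exact ⟨x, hx⟩
  let r0 : (N.prod J) →ₗ[A1] M :=
    (LinearEquiv.ofInjective j.1 hj).symm.toLinearMap ∘ₗ p.codRestrict _ hp
  have hjr (y) : j.1 (r0 y) = y - σ.1 (π.1 y) :=
    congrArg Subtype.val ((LinearEquiv.ofInjective j.1 hj).apply_symm_apply ⟨p y, hp y⟩)
  have hrj (x) : r0 (j.1 x) = x := by
    apply hj
    rw [hjr, (hπ _).2 ⟨x, rfl⟩, map_zero, sub_zero]
  let r : Hom (N.prod J) M := ⟨r0, fun n y hy => by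
    apply mem_deg_of_injective hj
    rw [hjr]
    exact Submodule.sub_mem _ hy (σ.2 n _ (π.2 n y hy))⟩
  let inl : Hom N (N.prod J) := ⟨LinearMap.inl A1 N J, fun n x hx => ⟨hx, Submodule.zero_mem _⟩⟩
  let inr : Hom J (N.prod J) := ⟨LinearMap.inr A1 N J, fun n x hx => ⟨Submodule.zero_mem _, hx⟩⟩
  let fst : Hom (N.prod J) N := ⟨LinearMap.fst A1 N J, fun n x hx => hx.1⟩
  -- The inverse is the retraction restricted to `N`. Applying `r j = 1` to `(f x, ι x)` gives a
  -- defect through `J`; the first component of `j r = 1 - σ π` gives a defect through `C`.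
  refine ⟨f, r.comp inl, ⟨J, ι, 0 - r.comp inr, hJc.isProjective, Hom.ext' fun x => ?_⟩,
    ⟨C, π.comp inl, 0 - fst.comp σ, hC, Hom.ext' fun y => ?_⟩⟩
  · change r0 ((f.1 x, 0) : N × J) - x = 0 - r0 ((0, ι.1 x) : N × J)
    have h1 : j.1 x = ((f.1 x, 0) : N × J) + ((0, ι.1 x) : N × J) := by
      refine Prod.ext ?_ ?_
      · exact (add_zero (f.1 x)).symm
      · exact (zero_add (ι.1 x)).symm
    have h2 := hrj x
    rw [h1] at h2
    have h3 : r0 ((f.1 x, 0) : N × J) + r0 ((0, ι.1 x) : N × J) = x :=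
      (map_add r0 _ _).symm.trans h2
    rw [sub_eq_sub_iff_add_eq_add, h3]; abel
  · change f.1 (r0 ((y, 0) : N × J)) - y = 0 - (σ.1 (π.1 ((y, 0) : N × J))).1
    have h1 := congrArg Prod.fst (hjr ((y, 0) : N × J))
    have h2 : f.1 (r0 ((y, 0) : N × J)) = y - (σ.1 (π.1 ((y, 0) : N × J))).1 := h1
    rw [h2]; abel

/-! ### The module `P_0` -/

/-- The Laurent polynomial underlying an element of `P_0`. -/
noncomputable def toLaurent (x : P0.{u}) : ℤ →₀ ZMod 2 := x.down.1

/-- The element of `P_0` with a given Laurent polynomial. -/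
noncomputable def ofLaurent (f : ℤ →₀ ZMod 2) (hf : ∀ n < -1, f n = 0) : P0.{u} := ⟨⟨f, hf⟩⟩

@[simp] theorem toLaurent_ofLaurent (f : ℤ →₀ ZMod 2) (hf : ∀ n < -1, f n = 0) :
    toLaurent (ofLaurent.{u} f hf) = f := rfl

theorem toLaurent_injective : Function.Injective toLaurent.{u} := fun _ _ h =>
  ULift.ext _ _ (Subtype.ext h)

theorem toLaurent_coeff (x : P0.{u}) {n : ℤ} (hn : n < -1) : toLaurent x n = 0 := x.down.2 n hn

theorem toLaurent_zero : toLaurent (0 : P0.{u}) = 0 := rfl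

theorem toLaurent_add (x y : P0.{u}) : toLaurent (x + y) = toLaurent x + toLaurent y := rfl

theorem toLaurent_sq1 (x : P0.{u}) : toLaurent (sq1 • x) = laurentSq 1 (toLaurent x) :=
  laurent_smul_sq1 x.down.1

theorem toLaurent_sq2 (x : P0.{u}) : toLaurent (sq2 • x) = laurentSq 2 (toLaurent x) :=
  laurent_smul_sq2 x.down.1

theorem mem_deg_P0 {x : P0.{u}} {n : ℤ} :
    x ∈ P0.{u}.deg n ↔ toLaurent x = Finsupp.single n (toLaurent x n) := by
  constructor
  · intro hx
    have hx : x.down.1 ∈ laurent.deg n := hx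
    exact (proj_self hx).symm.trans (laurent_proj n x.down.1)
  · intro hx
    have e : laurent.proj n x.down.1 = x.down.1 := (laurent_proj n x.down.1).trans hx.symm
    change x.down.1 ∈ laurent.deg n
    exact mem_deg_of_proj e

theorem laurentSq_apply (k : ℕ) (f : ℤ →₀ ZMod 2) (n : ℤ) :
    laurentSq k f n = f (n - k) * ((Ring.choose (n - k) k : ℤ) : ZMod 2) := by
  induction f using Finsupp.induction_linear with
  | zero => simp
  | add f g hf hg => rw [map_add, Finsupp.add_apply, hf, hg, Finsupp.add_apply, add_mul]
  | single m c =>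
    rw [laurentSq_single, Finsupp.single_apply, Finsupp.single_apply]
    by_cases h : m + k = n
    · rw [if_pos h, if_pos (by omega)]
      rw [← h, add_sub_cancel_right]
    · rw [if_neg h, if_neg (by omega), zero_mul]

theorem toLaurent_Q_zero (x : P0.{u}) (n : ℤ) :
    toLaurent (Q 0 • x) n = toLaurent x (n - 1) * ((n - 1 : ℤ) : ZMod 2) := by
  rw [Q_zero_smul, toLaurent_sq1, laurentSq_apply]
  simp

/-- `Q_1` acts as the derivation `x^4 d/dx`, just as `Q_0` acts as `x^2 d/dx`; the binomial
coefficients are compared by residues mod 4. -/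
theorem toLaurent_Q_one (x : P0.{u}) (n : ℤ) :
    toLaurent (Q 1 • x) n = toLaurent x (n - 3) * ((n - 3 : ℤ) : ZMod 2) := by
  rw [Q_one_smul, toLaurent_add, toLaurent_sq1, toLaurent_sq2, toLaurent_sq1, toLaurent_sq2,
    Finsupp.add_apply]
  simp only [laurentSq_apply]
  have e1 : n - ((2 : ℕ) : ℤ) - ((1 : ℕ) : ℤ) = n - 3 := by push_cast; ring
  have e2 : n - ((1 : ℕ) : ℤ) - ((2 : ℕ) : ℤ) = n - 3 := by push_cast; ring
  rw [e1, e2]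
  simp only [Ring.choose_one_right', Nat.cast_one, Nat.cast_ofNat]
  rw [mul_assoc, mul_assoc, ← mul_add]
  congr 1
  obtain ⟨m, rfl⟩ : ∃ m, n = m + 3 := ⟨n - 3, by omega⟩
  rw [show m + 3 - 3 = m by omega, show m + 3 - 2 = m + 1 by omega,
    show m + 3 - 1 = m + 2 by omega]
  have h4 : m = 4 * (m / 4) ∨ m = 4 * (m / 4) + 1 ∨ m = 4 * (m / 4) + 2 ∨ m = 4 * (m / 4) + 3 := by
    omega
  generalize m / 4 = l at h4
  obtain ⟨a0, a1, a2, a3⟩ := choose_two l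
  obtain ⟨b0, -⟩ := choose_two (l + 1)
  have z4 : (4 : ZMod 2) = 0 := rfl
  have z2 : (2 : ZMod 2) = 0 := rfl
  have z3 : (3 : ZMod 2) = 1 := rfl
  have hb0 : 4 * l + 3 + 1 = 4 * (l + 1) := by ring
  rcases h4 with rfl | rfl | rfl | rfl
  · simp [a0, a1, z4]
  · rw [show 4 * l + 1 + 1 = 4 * l + 2 by ring, a1, a2]
    simp [z4]
  · rw [show 4 * l + 2 + 1 = 4 * l + 3 by ring, a2, a3]
    simp [z4, z2]
  · rw [hb0, b0, a3]
    simp [z4, z3, z2]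

/-- The shift of Laurent polynomials. -/
noncomputable def shift (k : ℤ) (f : ℤ →₀ ZMod 2) : ℤ →₀ ZMod 2 :=
  f.embDomain (Equiv.addRight k).toEmbedding

theorem shift_apply (k : ℤ) (f : ℤ →₀ ZMod 2) (n : ℤ) : shift k f n = f (n - k) := by
  have := Finsupp.embDomain_apply_self (Equiv.addRight k).toEmbedding f (n - k)
  simpa [shift] using this

theorem isBoundedBelow_P0 : P0.{u}.IsBoundedBelow := by
  refine ⟨-1, fun n hn => (Submodule.eq_bot_iff _).2 fun x hx => ?_⟩
  apply toLaurent_injective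
  rw [mem_deg_P0.1 hx, toLaurent_coeff x hn, Finsupp.single_zero, toLaurent_zero]

theorem zmod_two_cast (n : ℤ) :
    (n % 2 = 0 ∧ (n : ZMod 2) = 0) ∨ (n % 2 = 1 ∧ (n : ZMod 2) = 1) := by
  rcases Int.emod_two_eq_zero_or_one n with h | h
  · exact Or.inl ⟨h, (ZMod.intCast_zmod_eq_zero_iff_dvd n 2).2 (Int.dvd_of_emod_eq_zero h)⟩
  · refine Or.inr ⟨h, ?_⟩
    rw [show n = 2 * (n / 2) + 1 by omega]
    push_cast
    rw [show (2 : ZMod 2) = 0 from rfl, zero_mul, zero_add]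

/-- `Q_0` carries each odd power to the next even one. The truncation begins with the odd exponent
`-1`, so the powers are paired off completely. -/
theorem acyclic_P0 : Acyclic 0 P0.{u} := by
  intro x hx
  have hodd (n : ℤ) (hn : n % 2 = 1) : toLaurent x n = 0 := by
    have h := DFunLike.congr_fun (congrArg toLaurent hx) (n + 1)
    rw [toLaurent_Q_zero, toLaurent_zero, add_sub_cancel_right] at h
    rcases zmod_two_cast n with h2 | h2
    · omega
    · rw [h2.2, mul_one] at h
      exact h
  refine ⟨ofLaurent (shift (-1) (toLaurent x)) fun n hn => ?_, ?_⟩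
  · rw [shift_apply]
    by_cases h : n = -2
    · exact hodd _ (by omega)
    · exact toLaurent_coeff x (by omega)
  · apply toLaurent_injective
    ext n
    rw [toLaurent_Q_zero, toLaurent_ofLaurent, shift_apply, sub_neg_eq_add, sub_add_cancel]
    rcases zmod_two_cast (n - 1) with h2 | h2
    · rw [hodd n (by omega), zero_mul]
    · rw [h2.2, mul_one]

/-- The element `x^0` of `P_0`. -/
noncomputable def P0one : P0.{u} :=
  ofLaurent (Finsupp.single 0 1) fun n hn => by rw [Finsupp.single_apply, if_neg (by omega)]

theorem P0one_mem : P0one.{u} ∈ P0.{u}.deg 0 := by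
  rw [mem_deg_P0]
  simp [P0one]

theorem sq1_P0one : sq1 • P0one.{u} = 0 := by
  apply toLaurent_injective
  simp [P0one, toLaurent_sq1, laurentSq_single, toLaurent_zero]

theorem sq2_P0one : sq2 • P0one.{u} = 0 := by
  apply toLaurent_injective
  simp [P0one, toLaurent_sq2, laurentSq_single, toLaurent_zero]

/-- `Sq^2 x^2 = x^4`. This is the property of `P_0` that separates it from the modules of kind 2. -/
theorem eq_zero_of_mem_deg_two {x : P0.{u}} (hx : x ∈ P0.{u}.deg 2) (h : sq2 • x = 0) : x = 0 := by
  apply toLaurent_injective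
  rw [mem_deg_P0.1 hx, toLaurent_zero, Finsupp.single_eq_zero]
  have h1 := DFunLike.congr_fun (congrArg toLaurent h) 4
  have h2 := (choose_two 0).2.2.1
  rw [toLaurent_sq2, laurentSq_apply, toLaurent_zero] at h1
  norm_num at h1 h2
  simpa [h2] using h1

/-! ### Generators of one-dimensional homology -/

/-- The `Q_1`-homology of `M` is one-dimensional and generated by the class of `z`. -/
structure IsGen {M : Type*} [AddCommGroup M] [Module A1 M] (z : M) : Prop where
  cycle : Q 1 • z = 0
  ne : ∀ y, z ≠ Q 1 • y
  gen : ∀ x, Q 1 • x = 0 → (∃ y, x = Q 1 • y) ∨ ∃ y, x = z + Q 1 • y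

theorem IsGen.add_boundary {M : Type*} [AddCommGroup M] [Module A1 M] {z : M} (h : IsGen z)
    (y : M) : IsGen (z + Q 1 • y) := by
  refine ⟨by rw [smul_add, h.cycle, Q_Q, add_zero], fun w hw => h.ne (w - y) ?_, fun x hx => ?_⟩
  · rw [smul_sub, ← hw, add_sub_cancel_right]
  · rcases h.gen x hx with h | ⟨w, hw⟩
    · exact Or.inl h
    · exact Or.inr ⟨w - y, by rw [smul_sub, hw]; abel⟩

/-- `Q_1` pairs each odd `n ≥ -1` with `n + 3 ≥ 2`. The only even power left over is `x^0`, whose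
partner `x^{-3}` is cut off by the truncation. -/
theorem isGen_P0one : IsGen P0one.{u} := by
  refine ⟨by rw [Q_one_smul, sq1_P0one, sq2_P0one, smul_zero, smul_zero, add_zero], ?_, ?_⟩
  · intro y hy
    have h := DFunLike.congr_fun (congrArg toLaurent hy) 0
    rw [toLaurent_Q_one, toLaurent_coeff y (by norm_num), zero_mul] at h
    simp [P0one] at h
  · intro x hx
    have hodd (n : ℤ) (hn : n % 2 = 1) : toLaurent x n = 0 := by
      have h := DFunLike.congr_fun (congrArg toLaurent hx) (n + 3)
      rw [toLaurent_Q_one, toLaurent_zero, add_sub_cancel_right] at h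
      rcases zmod_two_cast n with h2 | h2
      · omega
      · rw [h2.2, mul_one] at h
        exact h
    have key (y : P0.{u}) (hy : ∀ n, n % 2 = 1 → toLaurent y n = 0) (h0 : toLaurent y 0 = 0) :
        ∃ w, y = Q 1 • w := by
      refine ⟨ofLaurent (shift (-3) (toLaurent y)) fun n hn => ?_, ?_⟩
      · rw [shift_apply, sub_neg_eq_add]
        by_cases h : n = -2
        · exact hy _ (by omega)
        by_cases h : n = -3
        · rw [h]; exact h0
        by_cases h : n = -4
        · exact hy _ (by omega)
        · exact toLaurent_coeff y (by omega)
      · apply toLaurent_injective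
        ext n
        rw [toLaurent_Q_one, toLaurent_ofLaurent, shift_apply, sub_neg_eq_add, sub_add_cancel]
        rcases zmod_two_cast (n - 3) with h2 | h2
        · rw [hy n (by omega), zero_mul]
        · rw [h2.2, mul_one]
    by_cases h0 : toLaurent x 0 = 0
    · exact Or.inl (key x hodd h0)
    · have h1 : toLaurent x 0 = 1 := by
        generalize toLaurent x 0 = c at h0
        revert c; decide
      obtain ⟨w, hw⟩ := key (x + P0one) (fun n hn => by
        rw [toLaurent_add, Finsupp.add_apply, hodd n hn]
        have : n ≠ 0 := by omega
        simp [P0one, this]) (by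
        rw [toLaurent_add, Finsupp.add_apply, h1]
        simp only [P0one, toLaurent_ofLaurent, Finsupp.single_eq_same]
        rfl)
      refine Or.inr ⟨w, ?_⟩
      rw [← hw, add_comm x, add_self_left]

section contraction

variable {M : Type*} [AddCommGroup M] [Module A1 M] [Module (ZMod 2) M]
  [IsScalarTower (ZMod 2) A1 M]

/-- Over a field an acyclic differential has a contracting homotopy, built from a section `σ` of
`Q_k` onto its image and a projection `ρ` to that image. Homotopies, unlike statements about
elements, can be tensored. -/
theorem Acyclic.exists_contraction {k : Fin 2} (h : Acyclic k M) :
    ∃ e : M →ₗ[ZMod 2] M, ∀ x, Q k • e x + e (Q k • x) = x := by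
  obtain ⟨σ, hσ⟩ := (lact M (Q k)).rangeRestrict.exists_rightInverse_of_surjective
    (lact M (Q k)).range_rangeRestrict
  obtain ⟨ρ, hρ⟩ := (LinearMap.range (lact M (Q k))).subtype.exists_leftInverse_of_injective
    (Submodule.ker_subtype _)
  have hσ (b : LinearMap.range (lact M (Q k))) : Q k • σ b = b :=
    congrArg Subtype.val (DFunLike.congr_fun hσ b)
  have hρ (b : LinearMap.range (lact M (Q k))) : ρ b = b := DFunLike.congr_fun hρ b
  let q := (lact M (Q k)).rangeRestrict
  have hq (x : M) : (q x : M) = Q k • x := rfl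
  have hqq (x : M) : q (Q k • x) = 0 := Subtype.ext (Q_Q k x)
  refine ⟨σ ∘ₗ ρ ∘ₗ (LinearMap.id - σ ∘ₗ q), fun x => ?_⟩
  have h1 : Q k • (x - σ (q x)) = 0 := by rw [smul_sub, hσ, hq, sub_self]
  obtain ⟨y, hy⟩ := h _ h1
  have h2 : (ρ (x - σ (q x)) : M) = x - σ (q x) := by
    rw [hy]
    exact congrArg Subtype.val (hρ (q y))
  simp only [LinearMap.comp_apply, LinearMap.sub_apply, LinearMap.id_apply, hqq, map_zero,
    sub_zero]
  rw [hσ, h2, show ρ (Q k • x) = q x from hρ (q x), sub_add_cancel]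

/-- Linear splittings give a deformation of `(M, Q_1)` onto the line of `z`: the functional `l`
reads off the class in homology and `e` is the homotopy. The converse is `isGen_of_contraction`. -/
theorem IsGen.exists_contraction {z : M} (h : IsGen z) :
    ∃ (l : M →ₗ[ZMod 2] ZMod 2) (e : M →ₗ[ZMod 2] M), l z = 1 ∧ (∀ x, l (Q 1 • x) = 0) ∧
      ∀ x, Q 1 • e x + e (Q 1 • x) + l x • z = x := by
  obtain ⟨σ, hσ⟩ := (lact M (Q 1)).rangeRestrict.exists_rightInverse_of_surjective
    (lact M (Q 1)).range_rangeRestrict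
  obtain ⟨ρ, hρ⟩ := (LinearMap.range (lact M (Q 1))).subtype.exists_leftInverse_of_injective
    (Submodule.ker_subtype _)
  have hσ (b : LinearMap.range (lact M (Q 1))) : Q 1 • σ b = b :=
    congrArg Subtype.val (DFunLike.congr_fun hσ b)
  have hρ (b : LinearMap.range (lact M (Q 1))) : ρ b = b := DFunLike.congr_fun hρ b
  obtain ⟨l, hlz, hl⟩ := Submodule.exists_le_ker_of_notMem
    (p := LinearMap.range (lact M (Q 1))) (v := z) (fun ⟨y, hy⟩ => h.ne y hy.symm)
  have hl1 : l z = 1 := by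
    generalize l z = c at hlz
    revert c; decide
  have hl0 (x : M) : l (Q 1 • x) = 0 := hl ⟨x, rfl⟩
  let q := (lact M (Q 1)).rangeRestrict
  have hq (x : M) : (q x : M) = Q 1 • x := rfl
  have hqq (x : M) : q (Q 1 • x) = 0 := Subtype.ext (Q_Q 1 x)
  let c : M →ₗ[ZMod 2] M := LinearMap.id - σ ∘ₗ q
  have hc (x : M) : c x = x - σ (q x) := rfl
  let ρ' : M →ₗ[ZMod 2] LinearMap.range (lact M (Q 1)) := ρ ∘ₗ (LinearMap.id - l.smulRight z)
  have hρ' (x : M) : ρ' x = ρ (x - l x • z) := rfl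
  refine ⟨l ∘ₗ c, σ ∘ₗ ρ' ∘ₗ c, ?_, fun x => ?_, fun x => ?_⟩
  · have : q z = 0 := Subtype.ext h.cycle
    rw [LinearMap.comp_apply, hc, this, map_zero, sub_zero, hl1]
  · rw [LinearMap.comp_apply, hc, hqq, map_zero, sub_zero, hl0]
  · have h1 : Q 1 • c x = 0 := by rw [hc, smul_sub, hσ, hq, sub_self]
    have h2 : (ρ' (c x) : M) + l (c x) • z = c x := by
      rcases h.gen _ h1 with ⟨y, hy⟩ | ⟨y, hy⟩
      · rw [hy, hρ', hl0, zero_smul, sub_zero, add_zero]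
        exact congrArg Subtype.val (hρ (q y))
      · rw [hy, hρ', map_add, hl0, hl1, add_zero, one_smul, add_sub_cancel_left, add_comm]
        congr 1
        exact congrArg Subtype.val (hρ (q y))
    have h3 : ρ' (c (Q 1 • x)) = q x := by
      rw [hc, hqq, map_zero, sub_zero, hρ', hl0, zero_smul, sub_zero]
      exact hρ (q x)
    simp only [LinearMap.comp_apply, h3, hσ]
    rw [add_right_comm, h2, hc, sub_add_cancel]

omit [IsScalarTower (ZMod 2) A1 M] in
theorem isGen_of_contraction {z : M} (l : M →ₗ[ZMod 2] ZMod 2) (e : M →ₗ[ZMod 2] M)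
    (hz : Q 1 • z = 0) (h1 : l z = 1) (h2 : ∀ x, l (Q 1 • x) = 0)
    (h3 : ∀ x, Q 1 • e x + e (Q 1 • x) + l x • z = x) : IsGen z := by
  refine ⟨hz, fun y hy => ?_, fun x hx => ?_⟩
  · rw [hy, h2] at h1
    exact zero_ne_one h1
  · have h4 := h3 x
    rw [hx, map_zero, add_zero] at h4
    by_cases h : l x = 0
    · rw [h, zero_smul, add_zero] at h4
      exact Or.inl ⟨_, h4.symm⟩
    · have : l x = 1 := by
        generalize l x = c at h
        revert c; decide
      rw [this, one_smul, add_comm] at h4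
      exact Or.inr ⟨_, h4.symm⟩

end contraction

/-- The Künneth formula for one-dimensional homology: contract the first factor by `e ⊗ 1` and then,
on the line of `z`, the second by `l z ⊗ e'`. -/
theorem IsGen.tensor {M : GMod.{u}} {N : GMod.{v}} {z : M} {w : N} (hz : IsGen z) (hw : IsGen w) :
    IsGen (tm M N z w) := by
  obtain ⟨l, e, hl, hl0, he⟩ := hz.exists_contraction
  obtain ⟨l', e', hl', hl0', he'⟩ := hw.exists_contraction
  let E : (M.tensor N) →ₗ[ZMod 2] (M.tensor N) :=
    tlift ((tm M N).comp e) + tlift ((tm M N).compl₁₂ (l.smulRight z) e')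
  let Λ : (M.tensor N) →ₗ[ZMod 2] ZMod 2 := tlift ((LinearMap.mul (ZMod 2) (ZMod 2)).compl₁₂ l l')
  have hΛ (x : M) (y : N) : Λ (tm M N x y) = l x * l' y := by simp [Λ]
  have hE (x : M) (y : N) : E (tm M N x y) = tm M N (e x) y + l x • tm M N z (e' y) := by simp [E]
  refine isGen_of_contraction Λ E ?_ (by rw [hΛ, hl, hl', mul_one]) ?_ ?_
  · rw [Q_tm, hz.cycle, hw.cycle]; simp
  · refine tensor_forall (f := Λ ∘ₗ lact _ (Q 1)) (g := 0) fun x y => ?_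
    simp [Q_tm, hΛ, hl0, hl0']
  · refine tensor_forall (f := lact _ (Q 1) ∘ₗ E + E ∘ₗ lact _ (Q 1) + Λ.smulRight (tm M N z w))
      (g := LinearMap.id) fun x y => ?_
    simp only [LinearMap.add_apply, LinearMap.comp_apply, lact_apply, hE, Q_tm, map_add,
      smul_comm (Q 1) (l x), hz.cycle, hl0, zero_smul, LinearMap.smulRight_apply, hΛ, map_zero,
      LinearMap.zero_apply, add_zero, zero_add, LinearMap.id_apply]
    have h1 := congrArg (fun a => tm M N a y) (he x)
    have h2 := congrArg (fun a => l x • tm M N z a) (he' y)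
    simp only [map_add, LinearMap.add_apply, map_smul, LinearMap.smul_apply, smul_add] at h1 h2
    apply eq_of_add_eq_zero
    rw [← h1, ← h2, mul_smul]
    abel_nf
    simp only [two_zsmul_eq_zero, add_zero]

theorem Acyclic.tensor_right {k : Fin 2} {M : GMod.{u}} (h : Acyclic k M) (N : GMod.{v}) :
    Acyclic k (M.tensor N) := by
  obtain ⟨e, he⟩ := h.exists_contraction
  have key := tensor_forall (f := lact _ (Q k) ∘ₗ tlift ((tm M N).comp e)
    + tlift ((tm M N).comp e) ∘ₗ lact _ (Q k)) (g := LinearMap.id) fun x y => by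
      have h2 := congrArg (fun a => tm M N a y) (he x)
      simp only [map_add, LinearMap.add_apply] at h2
      simp only [LinearMap.add_apply, LinearMap.comp_apply, lact_apply, tlift_tm, Q_tm, map_add,
        LinearMap.id_apply]
      rw [add_add_add_comm, h2, char_two_add, add_zero]
  intro z hz
  have h3 := key z
  simp only [LinearMap.add_apply, LinearMap.comp_apply, lact_apply, hz, map_zero, add_zero,
    LinearMap.id_apply] at h3
  exact ⟨_, h3.symm⟩

theorem Acyclic.of_iso {k : Fin 2} {M : GMod.{u}} {N : GMod.{v}} (h : Acyclic k M) (e : Iso M N) :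
    Acyclic k N := by
  obtain ⟨f, g, -, h2⟩ := e
  intro y hy
  obtain ⟨x, hx⟩ := h (g.1 y) (by rw [← map_smul, hy, map_zero])
  exact ⟨f.1 x, by rw [← map_smul, ← hx]; exact (Hom.congr h2 y).symm⟩

theorem Acyclic.tensor_left {k : Fin 2} {M : GMod.{u}} (h : Acyclic k M) (N : GMod.{v}) :
    Acyclic k (N.tensor M) := (h.tensor_right N).of_iso (iso_tensor_comm M N)

/-! ### Tensoring with an invariant element -/

theorem tm_sq1_of_invariant {M : GMod.{u}} {N : GMod.{v}} {w : N} (h1 : sq1 • w = 0) (x : M) :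
    tm N M w (sq1 • x) = sq1 • tm N M w x := by
  rw [sq1_tm, h1, map_zero, LinearMap.zero_apply, zero_add]

theorem tm_sq2_of_invariant {M : GMod.{u}} {N : GMod.{v}} {w : N} (h1 : sq1 • w = 0)
    (h2 : sq2 • w = 0) (x : M) : tm N M w (sq2 • x) = sq2 • tm N M w x := by
  rw [sq2_tm, h1, h2, map_zero, LinearMap.zero_apply, LinearMap.zero_apply, zero_add, zero_add]

/-- The map `x ↦ w ⊗ x` given by an invariant element `w` of degree `a`. -/
noncomputable def tmHom {N : GMod.{v}} (M : GMod.{u}) {a : ℤ} (w : N) (hw : w ∈ N.deg a)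
    (h1 : sq1 • w = 0) (h2 : sq2 • w = 0) : Hom (M.susp a) (N.tensor M) :=
  Hom.mk' (M := M.susp a) (tm N M w) (tm_sq1_of_invariant h1) (tm_sq2_of_invariant h1 h2)
    (fun n x hx => tm_mem (i := a) (j := n - a) hw hx (by omega))

/-- `l ⊗ 1` is a left inverse commuting with `Q_1`, since `l w = 1`, and `e ⊗ 1` is a homotopy from
the other composite to the identity. -/
theorem isEquiv_tmHom {N : GMod.{v}} (M : GMod.{u}) {a : ℤ} {w : N} (hw : w ∈ N.deg a)
    (h1 : sq1 • w = 0) (h2 : sq2 • w = 0) (h : IsGen w) : (tmHom M w hw h1 h2).IsEquiv 1 := by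
  obtain ⟨l, e, hl, hl0, he⟩ := h.exists_contraction
  let Λ : (N.tensor M) →ₗ[ZMod 2] M :=
    tlift (LinearMap.mk₂ (ZMod 2) (fun y x => l y • x)
      (fun y z x => by rw [map_add, add_smul]) (fun c y x => by rw [map_smul, smul_assoc])
      (fun y x z => smul_add _ _ _) (fun c y x => smul_comm _ _ _))
  have hΛ (y : N) (x : M) : Λ (tm N M y x) = l y • x := tlift_tm _ _ _
  let E : (N.tensor M) →ₗ[ZMod 2] (N.tensor M) := tlift ((tm N M).comp e)
  have hE (y : N) (x : M) : E (tm N M y x) = tm N M (e y) x := tlift_tm _ _ _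
  have hΛQ : ∀ z, Λ (Q 1 • z) = Q 1 • Λ z :=
    tensor_forall (f := Λ ∘ₗ lact _ (Q 1)) (g := lact _ (Q 1) ∘ₗ Λ) fun y x => by
      simp only [LinearMap.comp_apply, lact_apply, Q_tm, map_add, hΛ, hl0, zero_smul, zero_add]
      rw [smul_comm]
  have hid : ∀ z, Q 1 • E z + E (Q 1 • z) + tm N M w (Λ z) = z :=
    tensor_forall (f := lact _ (Q 1) ∘ₗ E + E ∘ₗ lact _ (Q 1) + (tm N M w) ∘ₗ Λ)
      (g := LinearMap.id) fun y x => by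
      simp only [LinearMap.add_apply, LinearMap.comp_apply, lact_apply, hE, Q_tm, map_add, hΛ,
        map_smul, LinearMap.id_apply]
      have h3 := congrArg (fun a => tm N M a x) (he y)
      simp only [map_add, LinearMap.add_apply, map_smul, LinearMap.smul_apply] at h3
      apply eq_of_add_eq_zero
      rw [← h3]
      abel_nf
      simp only [two_zsmul_eq_zero, add_zero]
  refine ⟨fun x y _ hy => ⟨Λ y, ?_⟩, fun z hz => ⟨Λ z, E z, ?_, ?_⟩⟩
  · have h3 (x : M) : Λ (tm N M w x) = x := by rw [hΛ, hl, one_smul]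
    exact (h3 x).symm.trans ((congrArg Λ hy).trans (hΛQ y))
  · exact (hΛQ z).symm.trans ((congrArg Λ hz).trans (map_zero Λ))
  · have h3 := hid z
    rw [hz, map_zero, add_zero, add_comm] at h3
    exact h3.symm

theorem smul_tm_of_invariant {M : GMod.{u}} {N : GMod.{v}} {z : N} (h1 : sq1 • z = 0)
    (h2 : sq2 • z = 0) (a : A1) (x : M) : a • tm M N x z = tm M N (a • x) z :=
  ((toLinearMap ((tm M N).flip z) (fun x => by simp [sq1_tm, h1])
    (fun x => by simp [sq2_tm, h1, h2])).map_smul a x).symm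

/-! ### Local modules, and `P_0` as their unit. -/

/-- `M` is bounded below with trivial `Q_0`-homology. -/
structure Loc (M : GMod.{u}) : Prop where
  bdd : M.IsBoundedBelow
  acyclic : Acyclic 0 M

theorem isLocal_iff {M : GMod.{u}} : IsLocal 1 M ↔ Loc M := by
  refine ⟨fun h => ⟨h.1, acyclic_of_subsingleton (h.2 0 (by decide))⟩, fun h => ⟨h.bdd, ?_⟩⟩
  intro i hi n
  obtain rfl : i = 0 := by omega
  exact subsingleton_of_acyclic h.acyclic n

theorem Loc.tensor_right {M : GMod.{u}} {N : GMod.{v}} (hM : Loc M) (hN : N.IsBoundedBelow) :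
    Loc (M.tensor N) := ⟨hM.bdd.tensor hN, hM.acyclic.tensor_right N⟩

theorem Loc.tensor_left {M : GMod.{u}} {N : GMod.{v}} (hM : Loc M) (hN : N.IsBoundedBelow) :
    Loc (N.tensor M) := ⟨hN.tensor hM.bdd, hM.acyclic.tensor_left N⟩

theorem Loc.susp {M : GMod.{u}} (hM : Loc M) (k : ℤ) : Loc (M.susp k) :=
  ⟨hM.bdd.susp k, hM.acyclic⟩

theorem loc_P0 : Loc P0.{u} := ⟨isBoundedBelow_P0, acyclic_P0⟩

theorem isBoundedBelow_augIdeal : augIdeal.IsBoundedBelow := by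
  obtain ⟨b, hb⟩ := isBoundedBelow_reg
  refine ⟨b, fun n hn => (Submodule.eq_bot_iff _).2 fun x hx => ?_⟩
  have hx : x.1 ∈ reg.deg n := hx
  rw [hb n hn] at hx
  exact Subtype.ext hx

theorem isBoundedBelow_augInv : augInv.IsBoundedBelow := by
  refine IsBoundedBelow.susp ?_ _
  obtain ⟨b, hb⟩ := isBoundedBelow_reg
  refine ⟨b, fun n hn => (Submodule.eq_bot_iff _).2 ?_⟩
  rintro _ ⟨x, hx, rfl⟩
  rw [hb n hn, SetLike.mem_coe, Submodule.mem_bot] at hx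
  rw [hx, map_zero]
  rfl

theorem Loc.loop {M : GMod.{u}} (hM : Loc M) : Loc M.loop := hM.tensor_left isBoundedBelow_augIdeal

theorem Loc.loopInv {M : GMod.{u}} (hM : Loc M) : Loc M.loopInv :=
  hM.tensor_left isBoundedBelow_augInv

/-- Both sides have trivial `Q_0`-homology and `x ↦ w ⊗ x` is an isomorphism in `Q_1`-homology, so
`stableIso_of_isEquiv` applies. -/
theorem stableIso_tensor_of_isGen {N M : GMod.{u}} (hN : Loc N) (hM : Loc M) {a : ℤ} {w : N}
    (hw : w ∈ N.deg a) (h1 : sq1 • w = 0) (h2 : sq2 • w = 0) (h : IsGen w) :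
    StableIso (M.susp a) (N.tensor M) := by
  refine stableIso_of_isEquiv (hM.susp a).bdd (hN.tensor_right hM.bdd).bdd
    (tmHom M w hw h1 h2) fun k => ?_
  obtain rfl | rfl : k = 0 ∨ k = 1 := by omega
  · exact Hom.isEquiv_of_acyclic (hM.susp a).acyclic (hN.tensor_right hM.bdd).acyclic _
  · exact isEquiv_tmHom M hw h1 h2 h

theorem Loc.stableIso_P0_tensor {M : GMod.{u}} (hM : Loc M) : StableIso (P0.tensor M) M :=
  ((iso_susp_zero M).symm.stableIso.trans
    (stableIso_tensor_of_isGen loc_P0 hM P0one_mem sq1_P0one sq2_P0one isGen_P0one)).symm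

/-! ### Loops -/

/-- The inclusion `I ⊗ M → A(1) ⊗ M`. -/
noncomputable def loopIncl (M : GMod.{u}) : Hom M.loop (reg.tensor M) :=
  Hom.tensor ⟨(RingHom.ker A1.counit : Ideal A1).subtype, fun _ _ hx => hx⟩ (Hom.id M)

/-- The retraction `a ↦ a + ε(a)` of `A(1)` to the augmentation ideal. -/
noncomputable def augRetr : reg →ₗ[ZMod 2] augIdeal :=
  ((LinearMap.id - A1.counit.toLinearMap.smulRight (1 : A1)).codRestrict
    ((RingHom.ker A1.counit : Ideal A1).restrictScalars (ZMod 2)) fun a => by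
      change A1.counit (a - A1.counit a • 1) = 0
      rw [map_sub, map_smul, map_one, smul_eq_mul, mul_one, sub_self])

theorem augRetr_val (a : A1) : (augRetr a).1 = a - A1.counit a • 1 := rfl

/-- The retraction `a ⊗ x ↦ (a + ε(a)) ⊗ x` of `A(1) ⊗ M` to `I ⊗ M`. -/
noncomputable def loopRetr (M : GMod.{u}) : (reg.tensor M) →ₗ[ZMod 2] M.loop :=
  tlift ((tm augIdeal M).comp augRetr)

theorem loopRetr_tm {M : GMod.{u}} (a : A1) (x : M) :
    loopRetr M (tm reg M a x) = tm augIdeal M (augRetr a) x := tlift_tm _ _ _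

theorem loopIncl_tm {M : GMod.{u}} (a : augIdeal) (x : M) :
    (loopIncl M).1 (tm augIdeal M a x) = tm reg M (a.1 : A1) x := Hom.tensor_tm _ _ _ _

theorem loopIncl_loopRetr {M : GMod.{u}} (y : reg.tensor M) :
    (loopIncl M).1 (loopRetr M y) = y - tm reg M (1 : A1) ((augMap M).1 y) := by
  refine tensor_forall (f := (loopIncl M).1.restrictScalars (ZMod 2) ∘ₗ loopRetr M)
    (g := LinearMap.id - tm reg M (1 : A1) ∘ₗ (augMap M).1.restrictScalars (ZMod 2))
    (fun a x => ?_) y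
  change (loopIncl M).1 (loopRetr M (tm reg M a x)) = tm reg M a x - tm reg M (1 : A1)
    ((augMap M).1 (tm reg M a x))
  rw [loopRetr_tm, augMap_tm, map_smul]
  refine (loopIncl_tm _ _).trans ?_
  rw [augRetr_val]
  refine (congrArg (fun f => f x) (map_sub (tm reg M) a (A1.counit a • (1 : A1)))).trans ?_
  rw [LinearMap.sub_apply]
  exact congrArg (fun f => tm reg M a x - f x) (map_smul (tm reg M) (A1.counit a) (1 : A1))

theorem loopIncl_injective (M : GMod.{u}) : Function.Injective (loopIncl M).1 := by
  refine Function.LeftInverse.injective (g := loopRetr M) fun z => ?_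
  refine tensor_forall (f := loopRetr M ∘ₗ (loopIncl M).1.restrictScalars (ZMod 2))
    (g := LinearMap.id) (fun a x => ?_) z
  change loopRetr M ((loopIncl M).1 (tm augIdeal M a x)) = tm augIdeal M a x
  rw [loopIncl_tm, loopRetr_tm]
  congr 2
  apply Subtype.ext
  rw [augRetr_val, show A1.counit a.1 = 0 from a.2, zero_smul, sub_zero]

/-- Exactness of `I ⊗ M → A(1) ⊗ M → M` in the middle. Elements of `ΩM` are constructed below as
elements of `A(1) ⊗ M` with vanishing image in `M`. -/
theorem exists_loopIncl_eq {M : GMod.{u}} {n : ℤ} {y : reg.tensor M}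
    (hy : y ∈ (reg.tensor M).deg n) (h : (augMap M).1 y = 0) :
    ∃ x ∈ M.loop.deg n, (loopIncl M).1 x = y := by
  have h1 := loopIncl_loopRetr y
  rw [h, map_zero, sub_zero] at h1
  refine ⟨loopRetr M y, mem_deg_of_injective (loopIncl_injective M) ?_, h1⟩
  rw [h1]
  exact hy

/-- The element `Q_1` of the augmentation ideal. -/
noncomputable def augQ : augIdeal := ⟨Q 1, by
  change A1.counit (sq2 * sq1 + sq1 * sq2) = 0
  rw [map_add, counit_sq1_mul, counit_sq2_mul, add_zero]⟩

theorem Q_one_reg (x : A1) : Q 1 * x = 0 → ∃ y, x = Q 1 * y := contractible_reg.acyclic 1 x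

theorem Q_one_mul_Q_one : (Q 1 : A1) * Q 1 = 0 := by simpa using Q_one_Q_one (1 : A1)

/-- `A(1)` is `Q_1`-acyclic, so the homology of `I` is a line generated by the image `Q_1 · 1` of
the class of `1` under the connecting map. -/
theorem isGen_augQ : IsGen augQ := by
  refine ⟨Subtype.ext Q_one_mul_Q_one, fun y hy => ?_, fun x hx => ?_⟩
  · have h1 : Q 1 * (1 + y.1) = 0 := by
      rw [mul_add, mul_one, show Q 1 * y.1 = Q 1 from (congrArg Subtype.val hy).symm, char_two_add]
    obtain ⟨w, hw⟩ := Q_one_reg _ h1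
    have h2 := congrArg A1.counit hw
    rw [map_add, map_one, show A1.counit y.1 = 0 from y.2, map_mul,
      show A1.counit (Q 1) = 0 from augQ.2, zero_mul, add_zero] at h2
    exact one_ne_zero h2
  · obtain ⟨y, hy⟩ := Q_one_reg x.1 (congrArg Subtype.val hx)
    by_cases h : A1.counit y = 0
    · exact Or.inl ⟨⟨y, h⟩, Subtype.ext hy⟩
    · have h1 : A1.counit y = 1 := by
        generalize A1.counit y = c at h
        revert c; decide
      refine Or.inr ⟨⟨y + 1, by
        change A1.counit (y + 1) = 0
        rw [map_add, h1, map_one]; rfl⟩, Subtype.ext ?_⟩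
      change x.1 = Q 1 + Q 1 * (y + 1)
      rw [mul_add, mul_one, ← hy, add_comm x.1, add_self_left]

/-- This is the connecting isomorphism, computed with an arbitrary lift `y` of a generator: `Q_1 y`
differs from the Künneth generator `Q_1 ⊗ z`, with `z` the image of `y`, by a boundary in `ΩM`. -/
theorem isGen_loop {M : GMod.{u}} {y : reg.tensor M} (h : IsGen ((augMap M).1 y)) {x : M.loop}
    (hx : (loopIncl M).1 x = Q 1 • y) : IsGen x := by
  obtain ⟨w, hw, hw'⟩ : ∃ w : M.loop, IsGen w ∧
      (loopIncl M).1 w = tm reg M (Q 1 : A1) ((augMap M).1 y) :=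
    ⟨tm augIdeal M augQ ((augMap M).1 y), isGen_augQ.tensor h, loopIncl_tm _ _⟩
  have h1 : x = w + Q 1 • loopRetr M y := by
    apply loopIncl_injective M
    rw [hx, map_add, map_smul, loopIncl_loopRetr, hw', smul_sub, Q_tm, h.cycle, map_zero, add_zero]
    change Q 1 • y = tm reg M (Q 1 : A1) _ + (Q 1 • y - tm reg M (Q 1 * 1 : A1) _)
    rw [mul_one, add_sub_cancel]
  rw [h1]
  exact hw.add_boundary _

/-! ### The kinds of local modules -/

/-- There is an invariant generator of the homology in degree `a`. -/
def KindZero (M : GMod.{u}) (a : ℤ) : Prop :=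
  ∃ z ∈ M.deg a, sq1 • z = 0 ∧ sq2 • z = 0 ∧ IsGen z

/-- The homology is generated by `Sq^1 Sq^2 f`, where `f` is killed by the socle. -/
def KindOne (M : GMod.{u}) (a : ℤ) : Prop :=
  ∃ f ∈ M.deg (a - 3), top • f = 0 ∧ IsGen (sq1 • sq2 • f)

/-- The homology is generated by `Sq^1 p = Sq^2 x`. -/
def KindTwo (M : GMod.{u}) (a : ℤ) : Prop :=
  ∃ x ∈ M.deg (a - 2), ∃ p ∈ M.deg (a - 1), sq2 • x = sq1 • p ∧ IsGen (sq1 • p)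

/-- The homology is generated by `Sq^1 g`, where `Sq^2 g = 0` and `Sq^2 Sq^1 g = Sq^1 k`. -/
def KindThree (M : GMod.{u}) (a : ℤ) : Prop :=
  ∃ g ∈ M.deg (a - 1), ∃ k ∈ M.deg (a + 1), sq2 • g = 0 ∧ sq2 • sq1 • g = sq1 • k ∧
    IsGen (sq1 • g)

theorem tm_one_mem {M : GMod.{u}} {n : ℤ} {x : M} (hx : x ∈ M.deg n) :
    tm reg M (1 : A1) x ∈ (reg.tensor M).deg n :=
  tm_mem (i := 0) (A1.word_mem_deg 0) hx (zero_add n)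

theorem augMap_one {M : GMod.{u}} (x : M) : (augMap M).1 (tm reg M (1 : A1) x) = x := by
  rw [augMap_tm, map_one, one_smul]

/-- The new generator is `top • (1 ⊗ f) = Q_1 Sq^1 Sq^2 (1 ⊗ f)`. It lies in `ΩM` because `top • f =
0`, and `Sq^1` and `Sq^2` kill it because they kill `top`. -/
theorem KindOne.loop {M : GMod.{u}} {a : ℤ} (h : KindOne M a) : KindZero M.loop (a + 3) := by
  obtain ⟨f, hf, hf0, hg⟩ := h
  obtain ⟨z, hz, hz'⟩ := exists_loopIncl_eq (top_mem _ (tm_one_mem hf))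
    (by rw [map_smul, augMap_one, hf0])
  refine ⟨z, mem_deg_cast hz (by omega), loopIncl_injective M ?_, loopIncl_injective M ?_,
    isGen_loop (y := sq1 • sq2 • tm reg M (1 : A1) f) ?_ ?_⟩
  · rw [map_smul, hz', sq1_top, map_zero]
  · rw [map_smul, hz', sq2_top, map_zero]
  · rwa [map_smul, map_smul, augMap_one]
  · rw [hz', Q_one_sq1_sq2]

/-- The relation `Sq^2 x = Sq^1 p` puts `Sq^1 (1 ⊗ p) + Sq^2 (1 ⊗ x)` in `ΩM`. This is the new `f`,
with `Sq^1 Sq^2 f = Q_1 Sq^1 (1 ⊗ p)`. -/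
theorem KindTwo.loop {M : GMod.{u}} {a : ℤ} (h : KindTwo M a) : KindOne M.loop (a + 3) := by
  obtain ⟨x, hx, p, hp, hxp, hg⟩ := h
  have hm1 := mem_deg_cast (sq1_mem _ (tm_one_mem hp)) (show a - 1 + 1 = a by omega)
  have hm2 := mem_deg_cast (sq2_mem _ (tm_one_mem hx)) (show a - 2 + 2 = a by omega)
  obtain ⟨f, hf, hf'⟩ := exists_loopIncl_eq (Submodule.add_mem _ hm1 hm2)
    (by rw [map_add, map_smul, map_smul, augMap_one, augMap_one, hxp, char_two_add])
  refine ⟨f, mem_deg_cast hf (by omega), loopIncl_injective M ?_,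
    isGen_loop (y := sq1 • tm reg M (1 : A1) p) ?_ ?_⟩
  · rw [map_smul, hf', smul_add, top_sq1, top_sq2, add_zero, map_zero]
  · rwa [map_smul, augMap_one]
  · rw [map_smul, map_smul, hf', smul_add, smul_add, sq2_sq2, sq1_sq1, add_zero, Q_one_sq1]

/-- The two relations put `Sq^2 (1 ⊗ g)` and `Sq^2 Sq^1 (1 ⊗ g) + Sq^1 (1 ⊗ k)` in `ΩM`. They serve
as `x` and `p`, with `Sq^2 x = Sq^1 p = Q_1 Sq^1 (1 ⊗ g)`. -/
theorem KindThree.loop {M : GMod.{u}} {a : ℤ} (h : KindThree M a) : KindTwo M.loop (a + 3) := by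
  obtain ⟨g, hg, k, hk, hg0, hgk, hgen⟩ := h
  obtain ⟨x, hx, hx'⟩ := exists_loopIncl_eq (sq2_mem _ (tm_one_mem hg))
    (by rw [map_smul, augMap_one, hg0])
  have hm1 := mem_deg_cast (sq2_mem _ (sq1_mem _ (tm_one_mem hg)))
    (show a - 1 + 1 + 2 = a + 2 by omega)
  have hm2 := mem_deg_cast (sq1_mem _ (tm_one_mem hk)) (show a + 1 + 1 = a + 2 by omega)
  obtain ⟨p, hp, hp'⟩ := exists_loopIncl_eq (Submodule.add_mem _ hm1 hm2)
    (by rw [map_add, map_smul, map_smul, map_smul, augMap_one, augMap_one, hgk, char_two_add])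
  refine ⟨x, mem_deg_cast hx (by omega), p, mem_deg_cast hp (by omega), loopIncl_injective M ?_,
    isGen_loop (y := sq1 • tm reg M (1 : A1) g) ?_ ?_⟩
  · rw [map_smul, map_smul, hx', hp', smul_add, sq1_sq1, add_zero, sq2_sq2]
  · rwa [map_smul, augMap_one]
  · rw [map_smul, hp', smul_add, sq1_sq1, add_zero, Q_one_sq1]

/-- By `Q_0`-acyclicity `z = Sq^1 y`, and `g = Sq^2 Sq^1 (1 ⊗ y)` lies in `ΩM` because `Sq^2 z = 0`.
The element `k` exists because `Sq^1 Sq^2 Sq^1 g = Sq^2 Sq^2 g = 0` and `ΩM` is `Q_0`-acyclic. -/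
theorem KindZero.loop {M : GMod.{u}} {a : ℤ} (hM : Loc M) (h : KindZero M a) :
    KindThree M.loop (a + 3) := by
  obtain ⟨z, hz, hz1, hz2, hgen⟩ := h
  obtain ⟨y, hy⟩ := hM.acyclic z hz1
  obtain ⟨y, hyd, rfl⟩ := exists_mem_deg_of_eq_Q hz hy
  rw [Q_zero_smul] at hz2 hgen
  obtain ⟨g, hg, hg'⟩ := exists_loopIncl_eq (sq2_mem _ (sq1_mem _ (tm_one_mem hyd)))
    (by rw [map_smul, map_smul, augMap_one, hz2])
  have hg0 : sq2 • g = 0 := loopIncl_injective M (by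
    rw [map_smul, hg', sq2_sq2, sq1_sq1, smul_zero, smul_zero, map_zero])
  have hd : g ∈ M.loop.deg (a + 3 - 1) :=
    mem_deg_cast hg (by rw [show Qdeg 0 = 1 from rfl]; omega)
  obtain ⟨k, hk⟩ := hM.loop.acyclic (sq2 • sq1 • g) (by
    rw [Q_zero_smul, ← sq2_sq2, hg0, smul_zero])
  obtain ⟨k, hkd, hk⟩ := exists_mem_deg_of_eq_Q (sq2_mem _ (sq1_mem _ hd)) hk
  refine ⟨g, hd, k, mem_deg_cast hkd (by rw [show Qdeg 0 = 1 from rfl]; omega), hg0, hk,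
    isGen_loop (y := sq1 • tm reg M (1 : A1) y) ?_ ?_⟩
  · rwa [map_smul, augMap_one]
  · rw [map_smul, hg', Q_one_sq1]

/-! ### The inverse loops of an invariant element -/

theorem mem_socle {x : A1} : x ∈ socle ↔ ∃ c : ZMod 2, x = c • top := by
  have h : sq2 * sq2 * sq2 = top := by rw [sq2_mul_sq2]; rfl
  rw [socle, h, Submodule.mem_span_singleton]
  constructor
  · rintro ⟨a, rfl⟩
    exact ⟨A1.counit a, mul_top a⟩
  · rintro ⟨c, rfl⟩
    exact ⟨algebraMap _ _ c, by rw [algebraMap_smul]⟩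

/-- The class of an element of `A(1)` in `I⁻¹`. -/
noncomputable def toAugInv : A1 →ₗ[A1] augInv := socle.mkQ

theorem toAugInv_surjective : Function.Surjective toAugInv := Submodule.mkQ_surjective _

theorem toAugInv_eq_zero {x : A1} : toAugInv x = 0 ↔ x ∈ socle := Submodule.Quotient.mk_eq_zero _

/-- `A(1)` is `Q_1`-acyclic, so the homology of its quotient by the socle is a line, mapped
isomorphically to the socle by the connecting map; and `Q_1 Sq^1 Sq^2 = top`. -/
theorem isGen_toAugInv : IsGen (toAugInv (sq1 * sq2)) := by
  have htop : Q 1 * (sq1 * sq2) = top := by simpa using Q_one_sq1_sq2 (1 : A1)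
  refine ⟨?_, fun y hy => ?_, fun x hx => ?_⟩
  · rw [← map_smul, toAugInv_eq_zero, mem_socle]
    exact ⟨1, by rw [one_smul]; exact htop⟩
  · obtain ⟨y, rfl⟩ := toAugInv_surjective y
    rw [← map_smul, ← sub_eq_zero, ← map_sub, toAugInv_eq_zero, mem_socle] at hy
    obtain ⟨c, hc⟩ := hy
    have h : sq1 * sq2 = Q 1 * (y + c • (sq1 * sq2)) := by
      rw [mul_add, mul_smul_comm, htop, ← hc, smul_eq_mul, add_sub_cancel]
    apply top_ne_zero
    rw [← htop, h, ← mul_assoc, Q_one_mul_Q_one, zero_mul]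
  · obtain ⟨x, rfl⟩ := toAugInv_surjective x
    rw [← map_smul, toAugInv_eq_zero, mem_socle] at hx
    obtain ⟨c, hc⟩ := hx
    obtain ⟨y, hy⟩ := Q_one_reg (x - c • (sq1 * sq2)) (by
      rw [mul_sub, mul_smul_comm, htop, ← hc, smul_eq_mul, sub_self])
    rw [sub_eq_iff_eq_add] at hy
    rw [hy, map_add, ← smul_eq_mul, map_smul]
    obtain rfl | rfl : c = 0 ∨ c = 1 := by clear hc hy; revert c; decide
    · exact Or.inl ⟨toAugInv y, by rw [zero_smul, map_zero, add_zero]⟩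
    · exact Or.inr ⟨toAugInv y, by rw [one_smul, add_comm]⟩

/-- Take `f = [1] ⊗ z`. As `z` is invariant, `A(1)` acts on the first factor only, where `top` is
zero and `Sq^1 Sq^2` is a generator. -/
theorem KindZero.loopInv {M : GMod.{u}} {a : ℤ} (h : KindZero M a) :
    KindOne M.loopInv (a - 3) := by
  obtain ⟨z, hz, hz1, hz2, hgen⟩ := h
  have hone : toAugInv 1 ∈ augInv.deg (-6) := ⟨1, A1.word_mem_deg 0, rfl⟩
  refine ⟨tm augInv M (toAugInv 1) z, tm_mem hone hz (by omega), ?_, ?_⟩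
  · refine (smul_tm_of_invariant hz1 hz2 _ _).trans ?_
    rw [← map_smul, smul_eq_mul, mul_one, toAugInv_eq_zero.2 (mem_socle.2 ⟨1, (one_smul _ _).symm⟩),
      map_zero]
    rfl
  · have h := isGen_toAugInv.tensor hgen
    have h1 : sq1 • sq2 • tm augInv M (toAugInv 1) z = tm augInv M (toAugInv (sq1 * sq2)) z := by
      rw [smul_tm_of_invariant hz1 hz2, smul_tm_of_invariant hz1 hz2, ← map_smul, ← map_smul,
        smul_eq_mul, smul_eq_mul, mul_one]
    exact h1 ▸ h

/-- `M ≃ P_0 ⊗ M ≅ M ⊗ P_0 ≃ Σ^a P_0`, by the invariant generators `x^0` of `P_0` and `z` of `M`. -/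
theorem KindZero.stableIso {M : GMod.{u}} {a : ℤ} (hM : Loc M) (h : KindZero M a) :
    StableIso M (P0.susp a) := by
  obtain ⟨z, hz, hz1, hz2, hgen⟩ := h
  exact hM.stableIso_P0_tensor.symm.trans
    (((iso_tensor_comm P0 M).stableIso).trans
      (stableIso_tensor_of_isGen hM loc_P0 hz hz1 hz2 hgen).symm)

theorem kindZero_P0 : KindZero P0.{u} 0 :=
  ⟨P0one, P0one_mem, sq1_P0one, sq2_P0one, isGen_P0one⟩

/-! ### Homogeneous generators -/

theorem IsGen.exists_eq_of_ne {M : GMod.{u}} {a : ℤ} {z : M} (hg : IsGen z) (hz : z ∈ M.deg a)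
    {n : ℤ} (hn : n ≠ a) {x : M} (hx : x ∈ M.deg n) (h : Q 1 • x = 0) :
    ∃ y ∈ M.deg (n - 3), x = Q 1 • y := by
  obtain ⟨y, hy⟩ : ∃ y, x = Q 1 • y := by
    rcases hg.gen x h with h | ⟨y, hy⟩
    · exact h
    · refine ⟨M.proj (n - 3) y, ?_⟩
      rw [Q_proj, show n - 3 + Qdeg 1 = n from sub_add_cancel n 3, ← proj_self hx, hy, map_add,
        M.proj_of_mem n hz, if_neg hn.symm, zero_add]
  exact exists_mem_deg_of_eq_Q hx hy

theorem IsGen.gen_deg {M : GMod.{u}} {a : ℤ} {z : M} (hg : IsGen z) (hz : z ∈ M.deg a) {x : M}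
    (hx : x ∈ M.deg a) (h : Q 1 • x = 0) :
    (∃ y ∈ M.deg (a - 3), x = Q 1 • y) ∨ ∃ y ∈ M.deg (a - 3), x = z + Q 1 • y := by
  rcases hg.gen x h with ⟨y, hy⟩ | ⟨y, hy⟩
  · exact Or.inl (exists_mem_deg_of_eq_Q hx hy)
  · obtain ⟨y, hyd, h1⟩ := exists_mem_deg_of_eq_Q (k := 1) (y := y) (Submodule.sub_mem _ hx hz)
      (sub_eq_of_eq_add' hy)
    exact Or.inr ⟨y, hyd, by rw [← h1, add_sub_cancel]⟩

/-- A cycle is a boundary once all its homogeneous components are; those outside degree `a` always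
are, and the one in degree `a` is compared with `z`. -/
theorem HomologyIso.exists_isGen {M : GMod.{u}} {a : ℤ} (h : HomologyIso M 1 a) :
    ∃ z ∈ M.deg a, IsGen z := by
  obtain ⟨h0, ⟨e⟩⟩ := h
  obtain ⟨⟨z, hz, hzc⟩, hz1⟩ := Submodule.Quotient.mk_surjective _ (e.symm 1)
  have hcyc : Q 1 • z = 0 := hzc
  have hmem {n : ℤ} (x : ↥(M.deg n ⊓ LinearMap.ker (M.act (A1.Q 1))))
      (hx : (Submodule.Quotient.mk x : M.homology 1 n) = 0) :
      x.1 ∈ LinearMap.range (lact M (Q 1)) :=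
    (Submodule.Quotient.mk_eq_zero ((LinearMap.range (M.act (A1.Q 1))).comap
      (M.deg n ⊓ LinearMap.ker (M.act (A1.Q 1))).subtype)).1 hx
  have key (x : M) (hx : Q 1 • x = 0) (ha : M.proj a x ∈ LinearMap.range (lact M (Q 1))) :
      ∃ y, x = Q 1 • y := by
    refine mem_range_lact.1 (mem_of_proj_mem _ fun n => ?_)
    by_cases hn : n = a
    · rwa [hn]
    · have := h0 n hn
      exact hmem ⟨M.proj n x, M.proj_mem n x, by
        change Q 1 • M.proj n x = 0
        rw [Q_proj, hx, map_zero]⟩ (Subsingleton.elim _ _)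
  have hc (x : M) (hx : Q 1 • x = 0) : M.proj a x ∈ M.deg a ⊓ LinearMap.ker (M.act (A1.Q 1)) :=
    ⟨M.proj_mem a x, by
      change Q 1 • M.proj a x = 0
      rw [Q_proj, hx, map_zero]⟩
  refine ⟨z, hz, hcyc, fun y hy => ?_, fun x hx => ?_⟩
  · have h1 : (Submodule.Quotient.mk ⟨z, hz, hzc⟩ : M.homology 1 a) = 0 :=
      (Submodule.Quotient.mk_eq_zero _).2 ⟨y, hy.symm⟩
    rw [hz1, LinearEquiv.map_eq_zero_iff] at h1
    exact one_ne_zero h1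
  · generalize hv : e (Submodule.Quotient.mk ⟨M.proj a x, hc x hx⟩) = c
    obtain rfl | rfl : c = 0 ∨ c = 1 := by clear hv; revert c; decide
    · rw [LinearEquiv.map_eq_zero_iff] at hv
      exact Or.inl (key x hx (hmem _ hv))
    · rw [← LinearEquiv.eq_symm_apply, ← hz1] at hv
      have h2 := (Submodule.Quotient.eq _).1 hv
      have h3 : M.proj a x - z ∈ LinearMap.range (lact M (Q 1)) := h2
      obtain ⟨y, hy⟩ := key (x - z) (by rw [smul_sub, hx, hcyc, sub_zero]) (by
        rw [map_sub, proj_self hz]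
        exact h3)
      exact Or.inr ⟨y, by rw [← hy, add_sub_cancel]⟩

/-! ### Local modules with one-dimensional homology are of one of the four kinds. -/

section kinds

variable {M : GMod.{u}} {a : ℤ} {z : M}

/-- `descent` needs `Q_1`-acyclicity only below degree `n`, and for `n ≤ a` this avoids the degree
of the generator. -/
theorem exists_eq_of_Q_zero (hM : Loc M) (hg : IsGen z) (hz : z ∈ M.deg a) {n : ℤ} (hn : n ≤ a)
    {r w : M} (hr : r ∈ M.deg n) (h : Q 0 • r = Q 1 • w) :
    ∃ v ∈ M.deg (n - 3), ∃ v' ∈ M.deg (n - 1), r = Q 1 • v + sq1 • v' := by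
  obtain ⟨w, hw, h⟩ := exists_mem_deg_of_eq_Q (M.Q_mem 0 hr) h
  exact descent hM.bdd hM.acyclic n (fun m hm x hx hx0 => by
    obtain ⟨y, -, hy⟩ := hg.exists_eq_of_ne hz (by omega) hx hx0
    exact ⟨y, hy⟩) hr (mem_deg_cast hw (show n + 1 - 3 = n - 2 by omega)) h

/-- `Sq^1 r` is a `Q_1`-cycle in degree `n + 1`; excluding `n = a - 1` makes it a boundary. -/
theorem exists_eq_of_Q_Q (hM : Loc M) (hg : IsGen z) (hz : z ∈ M.deg a) {n : ℤ} (hn : n ≤ a)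
    (hn' : n ≠ a - 1) {r : M} (hr : r ∈ M.deg n) (h : sq1 • Q 1 • r = 0) :
    ∃ v ∈ M.deg (n - 3), ∃ v' ∈ M.deg (n - 1), r = Q 1 • v + sq1 • v' := by
  obtain ⟨w, -, hw⟩ := hg.exists_eq_of_ne hz (n := n + 1) (by omega) (M.sq1_mem hr)
    ((Q_comm r).symm.trans h)
  exact exists_eq_of_Q_zero hM hg hz hn hr hw

theorem sq2_Q_one (x : M) : sq2 • Q 1 • x = sq2 • sq1 • sq2 • x := by
  rw [Q_one_smul, smul_add, sq2_sq2, sq1_sq1, smul_zero, smul_zero, zero_add]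

theorem sq1_Q_one_comm (x : M) : sq1 • Q 1 • x = Q 1 • sq1 • x := Q_comm x

/-- The generator may be chosen to be a cycle for `Q_0`. -/
theorem exists_isGen_sq1 (hM : Loc M) (hg : IsGen z) (hz : z ∈ M.deg a) :
    ∃ z' ∈ M.deg a, IsGen z' ∧ sq1 • z' = 0 := by
  obtain ⟨y, hy, hzy⟩ := hg.exists_eq_of_ne hz (by omega) (M.sq1_mem hz)
    (by rw [← sq1_Q_one_comm, hg.cycle, smul_zero])
  obtain ⟨v, -, v', hv', h⟩ := exists_eq_of_Q_Q hM hg hz (n := a + 1 - 3) (by omega) (by omega) hy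
    (by rw [← hzy, sq1_sq1])
  -- With `Sq^1 z = Q_1 y` and `y = Q_1 v + Sq^1 v'`, one has `Sq^1 z = Q_1 Sq^1 v' = Sq^1 Q_1 v'`.
  refine ⟨z + Q 1 • v', Submodule.add_mem _ hz (mem_deg_cast (M.Q_one_mem hv') (by omega)),
    hg.add_boundary _, ?_⟩
  rw [smul_add, hzy, h, smul_add, Q_Q, zero_add, ← sq1_Q_one_comm, char_two_add]

/-- If `Sq^2 z = Q_1 Q_0 x`, then `M` is of kind `0` or `2`. -/
theorem kind_of_eq_sq2_sq2 (hM : Loc M) (hg : IsGen z) (hz : z ∈ M.deg a) (hz1 : sq1 • z = 0)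
    {x : M} (hx : x ∈ M.deg (a - 2)) (h : sq2 • z = sq1 • sq2 • sq1 • x) :
    KindZero M a ∨ KindTwo M a := by
  have htop : top • x = 0 := by
    rw [top_smul, ← sq2_sq1_sq2_sq1, ← h, sq2_sq2, hz1, smul_zero, smul_zero]
  have htx := mem_deg_cast (M.sq2_mem hx) (sub_add_cancel a 2)
  obtain ⟨w, -, hw⟩ := hg.exists_eq_of_ne hz (by omega) (M.sq1_mem htx)
    (by rw [Q_one_sq1_sq2, htop])
  obtain ⟨v, hv, v', hv', hvv⟩ := exists_eq_of_Q_zero hM hg hz le_rfl htx hw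
  -- `Sq^2 x = Q_1 v + Sq^1 v'`; moving `Sq^2 Sq^1 v` to the left gives `Sq^2 (x + Sq^1 v) = Sq^1
  -- (Sq^2 v + v')`.
  have hx1 : x + sq1 • v ∈ M.deg (a - 2) :=
    Submodule.add_mem _ hx (mem_deg_cast (M.sq1_mem hv) (by omega))
  have hp : sq2 • v + v' ∈ M.deg (a - 1) :=
    Submodule.add_mem _ (mem_deg_cast (M.sq2_mem hv) (by omega)) hv'
  have hxp : sq2 • (x + sq1 • v) = sq1 • (sq2 • v + v') := by
    rw [smul_add, hvv, Q_one_smul, smul_add]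
    abel_nf
    simp only [two_zsmul_eq_zero, zero_add]
  have h' : sq2 • z = sq1 • sq2 • sq1 • (x + sq1 • v) := by rw [smul_add, sq1_sq1, add_zero, h]
  have hsp := mem_deg_cast (M.sq1_mem hp) (sub_add_cancel a 1)
  generalize sq2 • v + v' = p at *
  generalize x + sq1 • v = x' at *
  have h1 : sq1 • (z + sq1 • p) = 0 := by rw [smul_add, hz1, sq1_sq1, add_zero]
  have h2 : sq2 • (z + sq1 • p) = 0 := by rw [smul_add, ← hxp, sq2_sq2, h', char_two_add]
  have h3 : Q 1 • (z + sq1 • p) = 0 := by rw [Q_one_smul, h1, h2, smul_zero, smul_zero, add_zero]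
  -- The invariant cycle `z + Sq^1 p` is either a boundary, and then `Sq^1 p` generates (kind 2), or
  -- itself a generator (kind 0).
  rcases hg.gen _ h3 with ⟨y, hy⟩ | ⟨y, hy⟩
  · refine Or.inr ⟨x', hx1, p, hp, hxp, ?_⟩
    rw [show sq1 • p = z + Q 1 • y by rw [← hy, add_self_left]]
    exact hg.add_boundary y
  · exact Or.inl ⟨_, Submodule.add_mem _ hz hsp, h1, h2, hy ▸ hg.add_boundary y⟩

/-- Begin with a generator `z` killed by `Sq^1` and measure how `Sq^2 z` fails to vanish. It is a
`Q_1`-cycle outside degree `a`, so `Sq^2 z = Q_1 u`. The class of `Sq^1 u` separates kinds 0 and 2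
from kinds 1 and 3; in the latter case `z = Sq^1 u` after a correction, and `Sq^2 u = Q_1 Sq^1 f`,
where the class of `Sq^1 Sq^2 f` decides between 1 and 3. -/
theorem exists_kind (hM : Loc M) (hg : IsGen z) (hz : z ∈ M.deg a) :
    KindZero M a ∨ KindOne M a ∨ KindTwo M a ∨ KindThree M a := by
  obtain ⟨z, hz, hg, hz1⟩ := exists_isGen_sq1 hM hg hz
  have hz2 : sq1 • sq2 • z = 0 := by
    have h := hg.cycle
    rwa [Q_one_smul, hz1, smul_zero, zero_add] at h
  obtain ⟨u, hu, hzu⟩ := hg.exists_eq_of_ne hz (by omega) (M.sq2_mem hz) (by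
    rw [Q_one_smul, hz2, smul_zero, sq2_sq2, sq1_sq1, zero_add])
  have hu := mem_deg_cast hu (show a + 2 - 3 = a - 1 by omega)
  have hsu := mem_deg_cast (M.sq1_mem hu) (sub_add_cancel a 1)
  rcases hg.gen_deg hz hsu (by rw [← sq1_Q_one_comm, ← hzu, hz2]) with ⟨w, -, hw⟩ | ⟨w, hwd, hw⟩
  · obtain ⟨v, -, x, hx, hvx⟩ := exists_eq_of_Q_zero hM hg hz (by omega) hu hw
    have h := kind_of_eq_sq2_sq2 hM hg hz hz1 (mem_deg_cast hx (by omega)) (by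
      rw [hzu, hvx, smul_add, Q_Q, zero_add, Q_one_sq1])
    tauto
  -- Now `Sq^1 u = z + Q_1 w` with `Q_1 w = Sq^1 Q_1 v'`, so `u + Q_1 v'` is an exact
  -- `Sq^1`-preimage of `z`.
  obtain ⟨v, -, v', hv', hvw⟩ := exists_eq_of_Q_Q hM hg hz (by omega) (by omega) hwd (by
    have h := sq1_sq1 u
    rwa [hw, smul_add, hz1, zero_add] at h)
  obtain ⟨u, hu, rfl, hstu⟩ : ∃ u' ∈ M.deg (a - 1), sq1 • u' = z ∧ sq1 • sq2 • u' = 0 := by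
    have h1 : sq1 • (u + Q 1 • v') = z := by
      rw [smul_add, hw, hvw, smul_add, Q_Q, zero_add, sq1_Q_one_comm, add_assoc, char_two_add,
        add_zero]
    refine ⟨u + Q 1 • v', Submodule.add_mem _ hu (mem_deg_cast (M.Q_one_mem hv') (by omega)),
      h1, ?_⟩
    have h2 : Q 1 • (u + Q 1 • v') = sq2 • z := by rw [smul_add, Q_Q, add_zero, hzu]
    rwa [Q_one_smul, h1, add_eq_left] at h2
  have hst : sq1 • sq2 • sq1 • u = 0 := hz2
  obtain ⟨e, hed, he⟩ := hg.exists_eq_of_ne hz (by omega) (M.sq2_mem hu) (by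
    rw [Q_one_smul, hstu, smul_zero, sq2_sq2, sq1_sq1, zero_add])
  obtain ⟨v, -, f, hf, hvf⟩ := exists_eq_of_Q_Q hM hg hz (by omega) (by omega) hed (by
    rw [← he, hstu])
  have huf : sq2 • u = sq1 • sq2 • sq1 • f := by
    rw [he, hvf, smul_add, Q_Q, zero_add, Q_one_sq1]
  have hf := mem_deg_cast hf (show a - 1 + 2 - 3 - 1 = a - 3 by omega)
  have htop : top • f = 0 := by
    rw [top_smul, ← sq2_sq1_sq2_sq1, ← huf, sq2_sq2, hst]
  have htf := mem_deg_cast (M.sq2_mem hf) (show a - 3 + 2 = a - 1 by omega)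
  -- If `Sq^1 Sq^2 f` is a boundary, `u` can be corrected by an `Sq^1`-boundary, keeping `Sq^1 u =
  -- z` and making `Sq^2 u = 0` (kind 3). Otherwise `f` exhibits kind 1.
  rcases hg.gen _ ((Q_one_sq1_sq2 f).trans htop) with ⟨w, hw⟩ | ⟨w, hw⟩
  · obtain ⟨v, hv, v', hv', hvv⟩ := exists_eq_of_Q_zero hM hg hz (by omega) htf hw
    have hsp := M.sq1_mem (Submodule.add_mem _ (mem_deg_cast (M.sq2_mem hv)
      (show a - 1 - 3 + 2 = a - 1 - 1 by omega)) hv')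
    have h1 : sq1 • (sq2 • v + v') = sq2 • f + sq2 • sq1 • v := by
      rw [hvv, Q_one_smul, smul_add]
      abel_nf
      simp only [two_zsmul_eq_zero, add_zero]
    have hq := Submodule.add_mem _ hu (mem_deg_cast hsp (sub_add_cancel _ _))
    have hq1 : sq1 • (u + sq1 • (sq2 • v + v')) = sq1 • u := by
      rw [smul_add, sq1_sq1, add_zero]
    have hq2 : sq2 • (u + sq1 • (sq2 • v + v')) = 0 := by
      rw [h1, smul_add, smul_add, sq2_sq2, sq2_sq2, sq1_sq1, smul_zero, smul_zero, add_zero, huf,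
        char_two_add]
    generalize u + sq1 • (sq2 • v + v') = q at *
    obtain ⟨k, hk⟩ := hM.acyclic (sq2 • sq1 • q) (by rw [Q_zero_smul, ← sq2_sq2, hq2, smul_zero])
    obtain ⟨k, hkd, hk⟩ := exists_mem_deg_of_eq_Q (M.sq2_mem (M.sq1_mem hq)) hk
    exact Or.inr (Or.inr (Or.inr ⟨q, hq, k,
      mem_deg_cast hkd (show a - 1 + 1 + 2 - 1 = a + 1 by omega), hq2, hk, hq1 ▸ hg⟩))
  · exact Or.inr (Or.inl ⟨f, hf, htop, hw ▸ hg.add_boundary w⟩)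

/-- The element is `Sq^2 Sq^2 x = Sq^1 Sq^2 Sq^1 x`. If it were `top • w`, then `x + Sq^2 w` would
have the form `Q_1 v + Sq^1 v'`. Applying `Sq^2` and setting `e = Sq^2 v + v'`, the generator `Sq^1
p` would be `Sq^2 Sq^1 e` up to a boundary, and a second decomposition `e = Q_1 b + Sq^1 b'` would
make that the boundary `top • b`. -/
theorem KindTwo.exists_invariant (hM : Loc M) (h : KindTwo M a) :
    ∃ y ∈ M.deg (a + 2), sq1 • y = 0 ∧ sq2 • y = 0 ∧ ∀ w, y ≠ top • w := by
  obtain ⟨x, hx, p, hp, hxp, hg⟩ := h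
  have hz := mem_deg_cast (M.sq1_mem hp) (sub_add_cancel a 1)
  have hy := mem_deg_cast (M.sq1_mem (M.sq2_mem (M.sq1_mem hx)))
    (show a - 2 + 1 + 2 + 1 = a + 2 by omega)
  refine ⟨sq1 • sq2 • sq1 • x, hy, sq1_sq1 _, ?_, fun w hw => ?_⟩
  · rw [sq2_sq1_sq2_sq1, hxp, sq1_sq1, smul_zero, smul_zero]
  · obtain ⟨w, hwd, hw⟩ : ∃ w ∈ M.deg (a - 4), sq1 • sq2 • sq1 • x = top • w := by
      refine ⟨M.proj (a - 4) w, M.proj_mem _ _, ?_⟩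
      have h := map_proj_of_shift (lact M top) 6 (fun n x hx => M.top_mem hx) (a - 4) w
      rw [lact_apply, lact_apply, show a - 4 + 6 = a + 2 by omega, ← hw, proj_self hy] at h
      exact h.symm
    have hx' := Submodule.add_mem _ hx (mem_deg_cast (M.sq2_mem hwd)
      (show a - 4 + 2 = a - 2 by omega))
    obtain ⟨v, hv, v', hv', hvv⟩ := exists_eq_of_Q_Q hM hg hz (by omega) (by omega) hx' (by
      rw [sq1_Q_one_comm, Q_one_sq1, smul_add, smul_add, smul_add, hw, top_smul, char_two_add])
    have he := Submodule.add_mem _ (mem_deg_cast (M.sq2_mem hv)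
      (show a - 2 - 3 + 2 = a - 3 by omega))
      (mem_deg_cast hv' (show a - 2 - 1 = a - 3 by omega))
    have h1 : sq2 • sq1 • (sq2 • v + v') = sq1 • p + Q 1 • sq1 • w := by
      have h2 := congrArg (fun b => sq2 • b) hvv
      simp only [smul_add, sq2_Q_one, sq2_sq2, hxp] at h2
      rw [smul_add, smul_add, ← h2, Q_one_sq1]
    generalize sq2 • v + v' = e at *
    obtain ⟨b, -, b', -, hb⟩ := exists_eq_of_Q_Q hM hg hz (by omega) (by omega) he (by
      rw [sq1_Q_one_comm, Q_one_sq1, h1, smul_add, sq1_sq1, sq1_Q_one_comm, sq1_sq1,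
        smul_zero, add_zero])
    refine (hg.add_boundary (sq1 • w)).ne (sq1 • sq2 • b) ?_
    rw [← h1, hb, smul_add, sq1_sq1, add_zero, sq1_Q_one, sq2_sq1_sq2_sq1, Q_one_sq1_sq2, top_smul]

end kinds

/-! ### Obstructions to stable isomorphism. -/

theorem IsProjective.exists_eq_top_smul {P : GMod.{u}} (hP : IsProjective P) {x : P}
    (h1 : sq1 • x = 0) (h2 : sq2 • x = 0) : ∃ y, x = top • y := by
  obtain ⟨ι, b, -⟩ := hP.contractible.isFree
  have hc (i : ι) : b.repr x i = coef (b.repr x i) 7 • top := by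
    apply eq_smul_top
    · rw [← smul_eq_mul, ← Finsupp.smul_apply, ← map_smul, h1, map_zero, Finsupp.zero_apply]
    · rw [← smul_eq_mul, ← Finsupp.smul_apply, ← map_smul, h2, map_zero, Finsupp.zero_apply]
  refine ⟨b.repr.symm ((b.repr x).mapRange (fun c => algebraMap (ZMod 2) A1 (coef c 7)) (by
    rw [coef_zero, map_zero])), ?_⟩
  rw [← map_smul, ← LinearEquiv.symm_apply_eq, LinearEquiv.symm_symm]
  ext1 i
  rw [Finsupp.smul_apply, Finsupp.mapRange_apply, hc, smul_eq_mul, ← Algebra.commutes,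
    ← Algebra.smul_def, coef_smul, coef_top, if_pos rfl, mul_one]

/-- The map to `N` kills `x`, so `x` equals its image under a map that factors through a projective
module, and there invariants are multiples of `top`. -/
theorem StableIso.eq_zero_of_invariant {M N : GMod.{u}} (h : StableIso M N) {n : ℤ}
    (hN : ∀ x ∈ N.deg n, sq1 • x = 0 → sq2 • x = 0 → x = 0) {x : M} (hx : x ∈ M.deg n)
    (h1 : sq1 • x = 0) (h2 : sq2 • x = 0) : ∃ w, x = top • w := by
  obtain ⟨f, g, ⟨P, i, j, hP, hij⟩, -⟩ := h
  have h3 := Hom.congr hij x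
  have h4 : f.1 x = 0 := hN _ (f.2 n x hx) (by rw [← map_smul, h1, map_zero])
    (by rw [← map_smul, h2, map_zero])
  obtain ⟨y, hy⟩ := hP.exists_eq_top_smul (x := i.1 x) (by rw [← map_smul, h1, map_zero])
    (by rw [← map_smul, h2, map_zero])
  refine ⟨j.1 y, ?_⟩
  rw [Hom.sub_apply, Hom.comp_apply, Hom.comp_apply, h4, map_zero, zero_sub, Hom.id_apply, hy,
    map_smul, A1.neg_eq_self] at h3
  exact h3

theorem KindTwo.not_stableIso {M : GMod.{u}} {a : ℤ} (hM : Loc M) (h : KindTwo M a) :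
    ¬ StableIso M (P0.susp a) := by
  intro hs
  obtain ⟨y, hy, h1, h2, hne⟩ := h.exists_invariant hM
  obtain ⟨w, hw⟩ := hs.eq_zero_of_invariant (fun x hx _ h2 => eq_zero_of_mem_deg_two (by
    have hx : x ∈ P0.deg (a + 2 - a) := hx
    rwa [add_sub_cancel_left] at hx) h2) hy h1 h2
  exact hne w hw

theorem StableIso.degree_eq {M N : GMod.{u}} (h : StableIso M N) {a b : ℤ} {z : M} {w : N}
    (hz : z ∈ M.deg a) (hw : w ∈ N.deg b) (hgz : IsGen z) (hgw : IsGen w) : a = b := by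
  obtain ⟨f, g, h1, h2⟩ := h
  by_contra hne
  obtain ⟨y, -, hy⟩ := hgw.exists_eq_of_ne hw hne (f.2 a z hz) (by
    rw [← map_smul, hgz.cycle, map_zero])
  obtain ⟨x, hx⟩ := (Hom.isEquiv_of_stable h1 h2 1).1 z y hgz.cycle hy
  exact hgz.ne x hx

/-! ### Iterated loops of `P_0` -/

theorem stableIso_loop_tensor (M : GMod.{u}) (N : GMod.{u}) :
    StableIso (M.loop.tensor N) (M.tensor N).loop := (iso_tensor_assoc augIdeal M N).stableIso

theorem stableIso_loopInv_tensor (M : GMod.{u}) (N : GMod.{u}) :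
    StableIso (M.loopInv.tensor N) (M.tensor N).loopInv := (iso_tensor_assoc augInv M N).stableIso

/-- For `P_0` this follows from the kinds: `Ω⁻¹ P_0` is of kind 1 in degree `-3`, so its loops are
of kind 0 in degree 0. Tensoring with `M` gives the general case, since `P_0` is a unit. -/
theorem Loc.loop_loopInv {M : GMod.{u}} (hM : Loc M) : StableIso M.loopInv.loop M := by
  have h0 : StableIso P0.{u}.loopInv.loop P0.{u} :=
    (kindZero_P0.loopInv.loop.stableIso loc_P0.loopInv.loop).trans (iso_susp_zero P0).stableIso
  have h1 : StableIso M.loopInv.loop (P0.{u}.loopInv.loop.tensor M) :=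
    hM.stableIso_P0_tensor.symm.loopInv.loop.trans
      ((stableIso_loopInv_tensor P0 M).symm.loop.trans (stableIso_loop_tensor P0.loopInv M).symm)
  exact h1.trans ((h0.tensor_right M).trans hM.stableIso_P0_tensor)

theorem Loc.loopInv_loop {M : GMod.{u}} (hM : Loc M) : StableIso M.loop.loopInv M := by
  have h1 : StableIso ((augInv.tensor augIdeal).tensor M) ((augIdeal.tensor augInv).tensor M) :=
    (iso_tensor_comm augInv augIdeal).stableIso.tensor_right M
  have h2 : StableIso M.loop.loopInv M.loopInv.loop :=
    (iso_tensor_assoc augInv augIdeal M).stableIso.symm.trans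
      (h1.trans (iso_tensor_assoc augIdeal augInv M).stableIso)
  exact h2.trans hM.loop_loopInv

theorem loops_natCast_succ (n : ℕ) (M : GMod.{u}) : loops ((n : ℤ) + 1) M = (loops n M).loop :=
  Function.iterate_succ_apply' loop n M

theorem loops_neg_natCast_succ (n : ℕ) (M : GMod.{u}) :
    loops (-(n : ℤ) - 1) M = (loops (-n) M).loopInv := by
  rw [show -(n : ℤ) - 1 = Int.negSucc n by omega]
  cases n with
  | zero => rfl
  | succ n => exact Function.iterate_succ_apply' GMod.loopInv (n + 1) M

theorem loc_loops (n : ℤ) : Loc (loops n P0.{u}) := by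
  induction n using Int.induction_on with
  | zero => exact loc_P0
  | succ n ih => rw [loops_natCast_succ]; exact ih.loop
  | pred n ih => rw [loops_neg_natCast_succ]; exact ih.loopInv

theorem augQ_mem : augQ ∈ augIdeal.deg 3 := by
  have h : Q 1 • (1 : A1) ∈ reg.deg (0 + 3) := reg.Q_one_mem (A1.word_mem_deg 0)
  rw [smul_eq_mul, mul_one] at h
  exact h

theorem toAugInv_mem : toAugInv (sq1 * sq2) ∈ augInv.deg (-3) := ⟨_, A1.word_mem_deg 3, rfl⟩

theorem exists_isGen_loops (n : ℤ) : ∃ z ∈ (loops n P0.{u}).deg (3 * n), IsGen z := by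
  induction n using Int.induction_on with
  | zero => exact ⟨P0one, P0one_mem, isGen_P0one⟩
  | succ n ih =>
    obtain ⟨z, hz, hg⟩ := ih
    rw [loops_natCast_succ]
    exact ⟨tm augIdeal _ augQ z, tm_mem augQ_mem hz (by omega), isGen_augQ.tensor hg⟩
  | pred n ih =>
    obtain ⟨z, hz, hg⟩ := ih
    rw [loops_neg_natCast_succ]
    exact ⟨tm augInv _ _ z, tm_mem toAugInv_mem hz (by omega), isGen_toAugInv.tensor hg⟩

theorem loops_add_one (n : ℤ) : StableIso (loops (n + 1) P0.{u}) (loops n P0).loop := by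
  induction n using Int.induction_on with
  | zero => exact StableIso.refl _
  | succ n _ => exact loops_natCast_succ (n + 1) P0.{u} ▸ StableIso.refl _
  | pred n _ =>
    rw [loops_neg_natCast_succ, sub_add_cancel]
    exact (loc_loops _).loop_loopInv.symm

theorem loops_sub_one (n : ℤ) : StableIso (loops (n - 1) P0.{u}) (loops n P0).loopInv := by
  have h := (loops_add_one.{u} (n - 1)).loopInv.trans (loc_loops _).loopInv_loop
  rw [sub_add_cancel] at h
  exact h.symm

theorem loops_add (m n : ℤ) :
    StableIso ((loops m P0.{u}).tensor (loops n P0.{u})) (loops (m + n) P0) := by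
  induction m using Int.induction_on with
  | zero => rw [zero_add]; exact (loc_loops.{u} n).stableIso_P0_tensor
  | succ m ih =>
    have h := ((loops_add_one.{u} m).tensor_right (loops n P0.{u})).trans
      ((stableIso_loop_tensor _ _).trans (ih.loop.trans (loops_add_one _).symm))
    rwa [add_right_comm] at h
  | pred m ih =>
    have h := ((loops_sub_one.{u} (-m)).tensor_right (loops n P0.{u})).trans
      ((stableIso_loopInv_tensor _ _).trans (ih.loopInv.trans (loops_sub_one _).symm))
    rwa [add_sub_right_comm] at h

/-! ### The classes of the modules `Σ^{a-3b} Ω^b P_0`. -/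

/-- The module `Σ^{a-3b} Ω^b P_0`, the homology of which is generated in degree `a`. -/
noncomputable def twist (a b : ℤ) : GMod.{u} := (loops b P0).susp (a - 3 * b)

theorem loc_twist (a b : ℤ) : Loc (twist.{u} a b) := (loc_loops b).susp _

theorem exists_isGen_twist (a b : ℤ) : ∃ z ∈ (twist.{u} a b).deg a, IsGen z := by
  obtain ⟨z, hz, hg⟩ := exists_isGen_loops.{u} b
  exact ⟨z, mem_deg_cast (M := loops b P0) hz (show 3 * b = a - (a - 3 * b) by omega), hg⟩

theorem stableIso_susp_susp (M : GMod.{u}) {k l m : ℤ} (h : k + l = m) :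
    StableIso ((M.susp k).susp l) (M.susp m) :=
  ((iso_susp_susp M k l).trans (iso_susp_of_eq h)).stableIso

theorem twist_tensor (a b c d : ℤ) :
    StableIso ((twist.{u} a b).tensor (twist.{u} c d)) (twist (a + c) (b + d)) :=
  (iso_susp_tensor _ _ _).stableIso.trans
    (((iso_tensor_susp _ _ _).stableIso.susp _).trans
      ((stableIso_susp_susp _ (by ring)).trans ((loops_add b d).susp _)))

theorem twist_zero : StableIso (twist.{u} 0 0) P0 := (iso_susp_zero P0).stableIso

theorem KindZero.stableIso_twist {M : GMod.{u}} {a : ℤ} (hM : Loc M) (h : KindZero M a) :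
    StableIso M (twist a 0) :=
  (h.stableIso hM).trans (iso_susp_of_eq (by ring)).stableIso

theorem stableIso_twist_of_loop {M : GMod.{u}} {a b : ℤ} (hM : Loc M)
    (h : StableIso M.loop (twist (a + 3) (b + 1))) : StableIso M (twist a b) := by
  have h1 := loops_sub_one.{u} (b + 1)
  rw [add_sub_cancel_right] at h1
  refine hM.loopInv_loop.symm.trans (h.loopInv.trans
    ((iso_tensor_susp augInv (loops (b + 1) P0) _).stableIso.trans ((h1.symm.susp _).trans ?_)))
  exact (iso_susp_of_eq (by ring)).stableIso

/-- A module of kind `k` becomes a suspension of `P_0` after `k` loops; undoing them gives `b = -k`.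
-/
theorem exists_stableIso_twist {M : GMod.{u}} {a : ℤ} {z : M} (hM : Loc M) (hg : IsGen z)
    (hz : z ∈ M.deg a) : ∃ b, StableIso M (twist a b) := by
  have h1 {M : GMod.{u}} {a : ℤ} (hM : Loc M) (h : KindOne M a) : StableIso M (twist a (-1)) :=
    stableIso_twist_of_loop hM (h.loop.stableIso_twist hM.loop)
  have h2 {M : GMod.{u}} {a : ℤ} (hM : Loc M) (h : KindTwo M a) : StableIso M (twist a (-2)) :=
    stableIso_twist_of_loop hM (h1 hM.loop h.loop)
  rcases exists_kind hM hg hz with h | h | h | h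
  · exact ⟨_, h.stableIso_twist hM⟩
  · exact ⟨_, h1 hM h⟩
  · exact ⟨_, h2 hM h⟩
  · exact ⟨-3, stableIso_twist_of_loop (b := -3) hM (h2 hM.loop h.loop)⟩

theorem cls_eq_iff {M N : GMod.{u}} : cls M = cls N ↔ StableIso M N := Quotient.eq

theorem cls_twist_congr {a b c d a' b' c' d' : ℤ} (h : cls (twist.{u} a b) = cls (twist a' b'))
    (h' : cls (twist.{u} c d) = cls (twist c' d')) :
    cls (twist.{u} (a + c) (b + d)) = cls (twist (a' + c') (b' + d')) := by
  rw [cls_eq_iff] at *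
  exact (twist_tensor a b c d).symm.trans ((h.tensor h').trans (twist_tensor _ _ _ _))

/-- The kinds run through 0 → 3 → 2 → 1 → 0, so `Ω^4 P_0` is of kind 0 in degree 12. -/
theorem cls_twist_four : cls (twist.{u} 0 4) = cls (twist 0 0) := by
  rw [cls_eq_iff]
  have h := (kindZero_P0.{u}.loop loc_P0).loop.loop.loop.stableIso loc_P0.loop.loop.loop.loop
  exact (h.susp _).trans (stableIso_susp_susp _ (by norm_num))

/-- `Ω^2 P_0` is of kind 2 in degree 6, hence not stably `Σ^6 P_0`. -/
theorem cls_twist_two_ne : cls (twist.{u} 0 2) ≠ cls (twist 0 0) := by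
  rw [Ne, cls_eq_iff]
  intro h
  refine (kindZero_P0.{u}.loop loc_P0).loop.not_stableIso loc_P0.loop.loop ?_
  have h1 : StableIso P0.{u}.loop.loop ((twist.{u} 0 2).susp 6) :=
    ((iso_susp_zero _).symm.stableIso).trans (stableIso_susp_susp P0.loop.loop (by norm_num)).symm
  exact h1.trans ((h.susp 6).trans (stableIso_susp_susp P0 (by norm_num)))

theorem cls_twist_add_four_mul (a b q : ℤ) :
    cls (twist.{u} a (b + 4 * q)) = cls (twist a b) := by
  have h (b : ℤ) : cls (twist.{u} a (b + 4)) = cls (twist a b) := by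
    have := cls_twist_congr.{u} (rfl : cls (twist a b) = _) cls_twist_four
    rwa [add_zero, add_zero] at this
  induction q using Int.induction_on with
  | zero => rw [mul_zero, add_zero]
  | succ q ih => rw [← ih, mul_add, ← add_assoc, mul_one, h]
  | pred q ih => rw [← ih, ← h (b + 4 * (-q - 1))]; congr 2; ring

theorem cls_twist_eq_iff {a b c d : ℤ} :
    cls (twist.{u} a b) = cls (twist c d) ↔ a = c ∧ (b : ZMod 4) = d := by
  constructor
  · intro h
    obtain ⟨z, hz, hgz⟩ := exists_isGen_twist.{u} a b
    obtain ⟨w, hw, hgw⟩ := exists_isGen_twist.{u} c d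
    obtain rfl := (cls_eq_iff.1 h).degree_eq hz hw hgz hgw
    refine ⟨rfl, ?_⟩
    have h1 := cls_twist_congr h (rfl : cls (twist.{u} (-a) (-d)) = _)
    rw [add_neg_cancel, add_neg_cancel, ← sub_eq_add_neg] at h1
    rw [← sub_eq_zero, ← Int.cast_sub, ZMod.intCast_zmod_eq_zero_iff_dvd]
    generalize b - d = e at h1
    have h2 : cls (twist.{u} 0 (e % 4)) = cls (twist 0 0) := by
      rw [← h1, ← cls_twist_add_four_mul 0 (e % 4) (e / 4), Int.emod_add_mul_ediv]
    -- Doubling reduces the residues 1 and 3 to the residue 2, which is excluded.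
    have h3 := cls_twist_congr h2 h2
    have h4 : e % 4 = 0 ∨ e % 4 = 1 ∨ e % 4 = 2 ∨ e % 4 = 3 := by omega
    rcases h4 with h4 | h4 | h4 | h4
    · exact Int.dvd_of_emod_eq_zero h4
    · rw [h4] at h3
      exact absurd h3 cls_twist_two_ne
    · rw [h4] at h2
      exact absurd h2 cls_twist_two_ne
    · rw [h4] at h3
      exact absurd ((cls_twist_add_four_mul 0 2 1).symm.trans h3) cls_twist_two_ne
  · rintro ⟨rfl, h⟩
    rw [← sub_eq_zero, ← Int.cast_sub, ZMod.intCast_zmod_eq_zero_iff_dvd] at h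
    obtain ⟨q, hq⟩ := h
    rw [← cls_twist_add_four_mul a d q]
    congr 2
    push_cast at hq
    omega

/-! ### Invertible modules -/

theorem IsGen.of_stableIso {M N : GMod.{u}} (h : StableIso M N) {z : M} (hz : IsGen z) :
    ∃ w : N, IsGen w := by
  obtain ⟨f, g, h1, h2⟩ := h
  have hf := Hom.isEquiv_of_stable h1 h2 1
  refine ⟨f.1 z, by rw [← map_smul, hz.cycle, map_zero], fun y hy => ?_, fun y hy => ?_⟩
  · obtain ⟨x, hx⟩ := hf.1 z y hz.cycle hy
    exact hz.ne x hx
  · obtain ⟨x, w, hx, rfl⟩ := hf.2 y hy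
    rcases hz.gen x hx with ⟨v, rfl⟩ | ⟨v, rfl⟩
    · exact Or.inl ⟨f.1 v + w, by rw [map_smul, smul_add]⟩
    · exact Or.inr ⟨f.1 v + w, by rw [map_add, map_smul, smul_add, add_assoc]⟩

theorem exists_functional {M : GMod.{u}} {m : M} (hm : ∀ y, m ≠ Q 1 • y) :
    ∃ l : M →ₗ[ZMod 2] ZMod 2, l m ≠ 0 ∧ ∀ y, l (Q 1 • y) = 0 := by
  obtain ⟨l, hl, h⟩ := Submodule.exists_le_ker_of_notMem
    (p := LinearMap.range (lact M (Q 1))) (v := m) (fun ⟨y, hy⟩ => hm y hy.symm)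
  exact ⟨l, hl, fun y => h ⟨y, rfl⟩⟩

/-- The product of two functionals that vanish on boundaries vanishes on boundaries of `M ⊗ N` and
is nonzero on `m ⊗ n`. -/
theorem tm_ne_Q {M : GMod.{u}} {N : GMod.{v}} {m : M} {n : N} (hm : ∀ y, m ≠ Q 1 • y)
    (hn : ∀ y, n ≠ Q 1 • y) (y : M.tensor N) : tm M N m n ≠ Q 1 • y := by
  obtain ⟨l, hl, hl0⟩ := exists_functional hm
  obtain ⟨k, hk, hk0⟩ := exists_functional hn
  let Λ : (M.tensor N) →ₗ[ZMod 2] ZMod 2 := tlift ((LinearMap.mul (ZMod 2) (ZMod 2)).compl₁₂ l k)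
  have hΛ (x : M) (y : N) : Λ (tm M N x y) = l x * k y := by simp [Λ]
  have h0 : ∀ z, Λ (Q 1 • z) = 0 :=
    tensor_forall (f := Λ ∘ₗ lact _ (Q 1)) (g := 0) fun x y => by simp [Q_tm, hΛ, hl0, hk0]
  intro h
  have h1 := hΛ m n
  rw [h, h0] at h1
  exact mul_ne_zero hl hk h1.symm

theorem exists_ne_Q_of_not_acyclic {M : GMod.{u}} (h : ¬ Acyclic 1 M) :
    ∃ n, ∃ m ∈ M.deg n, Q 1 • m = 0 ∧ ∀ y, m ≠ Q 1 • y := by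
  by_contra! hn
  refine h fun x hx => mem_range_lact.1 (mem_of_proj_mem _ fun n => ?_)
  exact mem_range_lact.2 (hn n _ (M.proj_mem n x) (by rw [Q_proj, hx, map_zero]))

/-- By Künneth the dimensions multiply to 1. Concretely, fix a nonzero class `n` of `N`: for nonzero
classes `m`, `x` of `M` both `m ⊗ n` and `x ⊗ n` represent the class of `w`, so `(m + x) ⊗ n` is a
boundary and hence so is `m + x`. -/
theorem exists_isGen_of_tensor {M N : GMod.{u}} {w : M.tensor N} (hw : IsGen w) :
    ∃ a, ∃ z ∈ M.deg a, IsGen z := by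
  obtain ⟨a, m, hma, hm, hm'⟩ := exists_ne_Q_of_not_acyclic (M := M) fun h => by
    obtain ⟨y, hy⟩ := h.tensor_right N w hw.cycle
    exact hw.ne y hy
  obtain ⟨-, n, -, hn, hn'⟩ := exists_ne_Q_of_not_acyclic (M := N) fun h => by
    obtain ⟨y, hy⟩ := h.tensor_left M w hw.cycle
    exact hw.ne y hy
  have key (x : M) (hx : Q 1 • x = 0) (hx' : ∀ y, x ≠ Q 1 • y) :
      ∃ y, tm M N x n = w + Q 1 • y := by
    refine (hw.gen (tm M N x n) (by rw [Q_tm, hx, hn]; simp)).resolve_left ?_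
    rintro ⟨y, hy⟩
    exact tm_ne_Q hx' hn' y hy
  refine ⟨a, m, hma, hm, hm', fun x hx => ?_⟩
  by_contra! hne
  have hx' (y : M) : m + x ≠ Q 1 • y := fun hy => hne.2 y (by rw [← hy, add_self_left])
  obtain ⟨y, hy⟩ := key x hx hne.1
  obtain ⟨y', hy'⟩ := key m hm hm'
  refine tm_ne_Q hx' hn' (y' + y) ?_
  rw [map_add, LinearMap.add_apply, hy, hy', add_add_add_comm, char_two_add, zero_add, smul_add]

theorem mem_Pic1_iff {c : StableClass.{u}} : c ∈ Pic1 ↔ ∃ a b, c = cls (twist a b) := by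
  constructor
  · rintro ⟨M, N, hM, -, h, rfl⟩
    obtain ⟨w, hw⟩ := isGen_P0one.of_stableIso h.symm
    obtain ⟨a, z, hz, hg⟩ := exists_isGen_of_tensor hw
    obtain ⟨b, hb⟩ := exists_stableIso_twist (isLocal_iff.1 hM) hg hz
    exact ⟨a, b, cls_eq_iff.2 hb⟩
  · rintro ⟨a, b, rfl⟩
    refine ⟨twist a b, twist (-a) (-b), isLocal_iff.2 (loc_twist _ _),
      isLocal_iff.2 (loc_twist _ _), ?_, rfl⟩
    have h := twist_tensor.{u} a b (-a) (-b)
    rw [add_neg_cancel, add_neg_cancel] at h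
    exact h.trans twist_zero

theorem cls_twist_val (a b : ℤ) :
    cls (twist.{u} a ((b : ZMod 4).val : ℤ)) = cls (twist a b) :=
  cls_twist_eq_iff.2 ⟨rfl, by rw [Int.cast_natCast, ZMod.natCast_zmod_val]⟩

/-- The bijection `(a, b) ↦ [Σ^{a-3b} Ω^b P_0]`. -/
noncomputable def picEquiv : Multiplicative (ℤ × ZMod 4) ≃ Pic1.{u} :=
  Equiv.ofBijective
    (fun x => ⟨cls (twist x.toAdd.1 (x.toAdd.2.val : ℤ)), mem_Pic1_iff.2 ⟨_, _, rfl⟩⟩) <| by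
    constructor
    · intro x y h
      obtain ⟨h1, h2⟩ := cls_twist_eq_iff.1 (congrArg Subtype.val h)
      rw [Int.cast_natCast, Int.cast_natCast, ZMod.natCast_zmod_val, ZMod.natCast_zmod_val] at h2
      exact Prod.ext h1 h2
    · rintro ⟨c, hc⟩
      obtain ⟨a, b, rfl⟩ := mem_Pic1_iff.1 hc
      exact ⟨Multiplicative.ofAdd (a, (b : ZMod 4)), Subtype.ext (cls_twist_val a b)⟩

theorem picEquiv_apply (a b : ℤ) :
    (picEquiv.{u} (Multiplicative.ofAdd (a, (b : ZMod 4)))).1 = cls (twist a b) :=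
  cls_twist_val a b

theorem stableIso_reducedPart {P : GMod.{u}} {b : ℤ}
    (h : IsReducedPart P (susp (-b) (loops b P0))) (a : ℤ) :
    StableIso (twist a b) (P.susp (a - 2 * b)) :=
  (stableIso_susp_susp (loops b P0) (by ring)).symm.trans (h.stableIso.susp (a - 2 * b))

end GMod

theorem mainTheorem1 :
    -- the modules `P_n = (Σ^{-n} Ω^n P_0)^red` exist
    (∀ n : ℤ, ∃ N : GMod.{u}, GMod.IsReducedPart N (GMod.susp (-n) (GMod.loops n GMod.P0))) ∧
    ∀ P : ℤ → GMod.{u},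
      (∀ n : ℤ, GMod.IsReducedPart (P n) (GMod.susp (-n) (GMod.loops n GMod.P0))) →
      (∀ (M : GMod.{u}) (a : ℤ), GMod.IsLocal 1 M → GMod.HomologyIso M 1 a →
        ∃ b : ℤ, GMod.StableIso M (GMod.susp (a - 2 * b) (P b))) ∧
      -- the tensor product makes `Pic^{(1)}(A(1))` a commutative group with unit `P_0`
      ∃ _ : CommGroup (GMod.Pic1.{u}),
        (∀ (X Y : GMod.Pic1.{u}) (M N : GMod.{u}), X.1 = GMod.cls M → Y.1 = GMod.cls N →
          (X * Y).1 = GMod.cls (GMod.tensor M N)) ∧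
        (1 : GMod.Pic1.{u}).1 = GMod.cls GMod.P0 ∧
        ∃ e : Multiplicative (ℤ × ZMod 4) ≃* GMod.Pic1.{u},
          ∀ a b : ℤ, (e (Multiplicative.ofAdd (a, (b : ZMod 4)))).1
            = GMod.cls (GMod.susp (a - 2 * b) (P b)) := by
  refine ⟨fun n => GMod.exists_isReducedPart _, fun P hP => ⟨fun M a hM h => ?_, ?_⟩⟩
  · obtain ⟨z, hz, hg⟩ := h.exists_isGen
    obtain ⟨b, hb⟩ := GMod.exists_stableIso_twist (GMod.isLocal_iff.1 hM) hg hz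
    exact ⟨b, hb.trans (GMod.stableIso_reducedPart (hP b) a)⟩
  -- The group structure is transported along the bijection with `ℤ × ℤ/4`; that its product is the
  -- tensor product of representatives is `twist_tensor`.
  · let : CommGroup GMod.Pic1.{u} := GMod.picEquiv.symm.commGroup
    let e : Multiplicative (ℤ × ZMod 4) ≃* GMod.Pic1.{u} := (GMod.picEquiv.symm.mulEquiv).symm
    have he (a b : ℤ) : (e (Multiplicative.ofAdd (a, (b : ZMod 4)))).1
        = GMod.cls (GMod.twist a b) :=
      GMod.picEquiv_apply a b
    refine ⟨inferInstance, fun X Y M N hX hY => ?_, ?_, e, fun a b => ?_⟩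
    · obtain ⟨x, rfl⟩ := e.surjective X
      obtain ⟨y, rfl⟩ := e.surjective Y
      obtain ⟨⟨a, b⟩, rfl⟩ := Multiplicative.ofAdd.surjective x
      obtain ⟨⟨c, d⟩, rfl⟩ := Multiplicative.ofAdd.surjective y
      obtain ⟨b, rfl⟩ := ZMod.intCast_surjective b
      obtain ⟨d, rfl⟩ := ZMod.intCast_surjective d
      rw [← map_mul, ← ofAdd_add, Prod.mk_add_mk, ← Int.cast_add, he, GMod.cls_eq_iff]
      rw [he, GMod.cls_eq_iff] at hX hY
      exact (GMod.twist_tensor a b c d).symm.trans (hX.tensor hY)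
    · rw [← map_one e]
      have h := he 0 0
      rw [Int.cast_zero] at h
      exact h.trans (GMod.cls_eq_iff.2 GMod.twist_zero)
    · exact (he a b).trans (GMod.cls_eq_iff.2 (GMod.stableIso_reducedPart (hP b) a))
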